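/- **Koszul–Tate resolution of Lagrangian constraints.** Let $Y\to X$ be a fibred manifold, i.e. a smooth surjective submersion (for instance a smooth fibre bundle); $X$ and $Y$ are Hausdorff, second-countable, connected smooth manifolds, $\dim X=n$, $\dim Y=n+m$. Let $(x^\lambda,y^i)$ denote fibred coordinates, and let $$\Pi=\wedge^nT^*X\otimes_Y V^*Y\otimes_Y TX$$ be the Legendre bundle with its induced coordinates $(x^\lambda,y^i,p^\lambda_i)$. Let $L:J^1Y\to\wedge^nT^*X$ be a quadratic Lagrangian, locally $$\mathcal L=\tfrac12 a^{\lambda\mu}_{ij}y^i_\lambda y^j_\mu+b^\lambda_iy^i_\lambda+c$$ with smooth local functions $a,b,c$ on $Y$, $a$ symmetric, and let the matrix $a$ have constant rank. Let $\widehat L:J^1Y\to\Pi$, $p^\lambda_i\circ\widehat L=\partial\mathcal L/\partial y^i_\lambda$, be the Legendre map and $N_L=\widehat L(J^1Y)$ the Lagrangian constraint space; assume that $N_L$ contains the zero section of $\Pi\to Y$. Regard $a$ as the linear bundle map $T^*X\otimes_Y VY\to\Pi$ over $Y$, and let $\sigma_0:\Pi\to T^*X\otimes_Y VY$ be any smooth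 linear bundle map over $Y$ with $a\sigma_0a=a$ and $\sigma_0a\sigma_0=\sigma_0$. Put $P=a\sigma_0$ and $R=1-P$, with components $P^{\lambda k}_{i\nu}$, $R^{\lambda k}_{i\nu}$. Let $E^*\to\Pi$ be the direct sum of copies, indexed by $r=1,2,\dots$, of the dual $V_Y^*\Pi$ of the vertical tangent bundle of $\Pi\to Y$, and let $c^{\lambda(r)}_i$ be the holonomic fibre basis of the $r$-th copy (transforming as $p^\lambda_i$), of antighost number $r$ and parity $r \bmod 2$. Let $\mathcal N^k$ be the $C^\infty(\Pi)$-module of smooth sections of antighost number $k$ of the bundle of free graded commutative algebras generated by $E^*$, i.e. of local finite sums $\sum f\,c^{\lambda_1(r_1)}_{i_1}\cdots c^{\lambda_s(r_s)}_{i_s}$ with $f$ smooth and $r_1+\dots+r_s=k$. Let $\mathcal A(\Pi)$ be the algebra of sections generated by all $\mathcal N^k$. Let $\delta$ be the $C^\infty(\Pi)$-linear odd graded derivation with $$\delta(f)=0\ \ (f\in C^\infty(\Pi)),\qquad \delta c^{\lambda(1)}_i=R^{\lambda k}_{i\nu}p^\nu_k,\qquad \delta c^{\lambda(2l)}_i=P^{\lambda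 k}_{i\nu}c^{\nu(2l-1)}_k,\qquad \delta c^{\lambda(2l+1)}_i=R^{\lambda k}_{i\nu}c^{\nu(2l)}_k\quad(l>0).$$ Then: 1. $N_L=\{q\in\Pi: R(q)=0\}$. 2. $\mathcal A(\Pi)=\bigoplus_{k\ge0}\mathcal N^k$ is a graded commutative algebra and $\mathcal N^0=C^\infty(\Pi)$. 3. $\delta$ is well defined on $\mathcal A(\Pi)$, $\delta\circ\delta=0$, $\delta(\mathcal N^0)=0$ and $\delta(\mathcal N^{k+1})\subset\mathcal N^k$. 4. The complex $0\leftarrow C^\infty(\Pi)\leftarrow\mathcal N^1\leftarrow\mathcal N^2\leftarrow\cdots$ has homology $$H_k=0\quad(k>0),\qquad H_0=C^\infty(\Pi)/I_{N_L}=C^\infty(N_L),$$ where $I_{N_L}$ is the ideal of smooth functions on $\Pi$ vanishing on $N_L$; the first equality is induced by the identity of $C^\infty(\Pi)$ and the second by restriction of functions to $N_L$. Thus the complex is a Koszul–Tate resolution of the reducible Lagrangian constraints $R=0$. -/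

import Mathlib

open scoped Manifold ContDiff

/-! ### The graded commutative algebra of antighosts over a point

`V` is a real vector space (below: a fibre of the Legendre bundle).  The algebra is generated by
countably many copies of the dual `V*`.  The copy with index `r : ℕ` has antighost number `r + 1`
and Grassmann parity `(r + 1) mod 2`. -/

section Antighosts

variable (V : Type*) [AddCommGroup V] [Module ℝ V]

/-- The direct sum `V* ⊕ V* ⊕ ⋯` of generators; the `r`-th summand has antighost number `r + 1`. -/
abbrev AntighostGen : Type _ := ℕ →₀ Module.Dual ℝ V

/-- The graded commutativity relations: `e e' = (-1)^{[e][e']} e' e` for homogeneous generators. -/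
inductive AntighostRel :
    TensorAlgebra ℝ (AntighostGen V) → TensorAlgebra ℝ (AntighostGen V) → Prop
  | comm (r s : ℕ) (ξ η : Module.Dual ℝ V) : AntighostRel
      (TensorAlgebra.ι ℝ (Finsupp.single r ξ) * TensorAlgebra.ι ℝ (Finsupp.single s η))
      ((-1 : ℝ) ^ ((r + 1) * (s + 1)) •
        (TensorAlgebra.ι ℝ (Finsupp.single s η) * TensorAlgebra.ι ℝ (Finsupp.single r ξ)))

/-- The free graded commutative algebra on the antighosts: the tensor algebra of `V* ⊕ V* ⊕ ⋯`
modulo the graded commutativity relations. -/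
def AntighostAlgebra : Type _ := RingQuot (AntighostRel V)

noncomputable instance : Ring (AntighostAlgebra V) :=
  inferInstanceAs (Ring (RingQuot (AntighostRel V)))

noncomputable instance : Algebra ℝ (AntighostAlgebra V) :=
  inferInstanceAs (Algebra ℝ (RingQuot (AntighostRel V)))

namespace AntighostAlgebra

variable {V}

/-- The generators, as a linear map. -/
noncomputable def ι : AntighostGen V →ₗ[ℝ] AntighostAlgebra V :=
  (RingQuot.mkAlgHom ℝ (AntighostRel V)).toLinearMap ∘ₗ TensorAlgebra.ι ℝ

/-- The antighost `c^{(r+1)}` contracted with the covector `ξ`; its antighost number is `r + 1`. -/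
noncomputable def c (r : ℕ) (ξ : Module.Dual ℝ V) : AntighostAlgebra V := ι (Finsupp.single r ξ)

/-- The product `c^{(r₁+1)}(ξ₁) ⋯ c^{(r_k+1)}(ξ_k)` of a list of antighosts. -/
noncomputable def monomial (l : List (ℕ × Module.Dual ℝ V)) : AntighostAlgebra V :=
  (l.map fun p => c p.1 p.2).prod

/-- The elements of antighost number `k`. -/
noncomputable def degree (k : ℕ) : Submodule ℝ (AntighostAlgebra V) :=
  Submodule.span ℝ {x | ∃ l : List (ℕ × Module.Dual ℝ V),
    (l.map fun p => p.1 + 1).sum = k ∧ x = monomial l}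

theorem c_mul_c (r s : ℕ) (ξ η : Module.Dual ℝ V) :
    c r ξ * c s η = (-1 : ℝ) ^ ((r + 1) * (s + 1)) • (c s η * c r ξ) := by
  have h := RingQuot.mkAlgHom_rel ℝ (AntighostRel.comm r s ξ η)
  rw [map_mul, map_smul, map_mul] at h
  exact h

/-- Universal property of the antighost algebra. -/
noncomputable def lift {B : Type*} [Ring B] [Algebra ℝ B] (f : AntighostGen V →ₗ[ℝ] B)
    (hf : ∀ r s ξ η, f (Finsupp.single r ξ) * f (Finsupp.single s η) =
      (-1 : ℝ) ^ ((r + 1) * (s + 1)) • (f (Finsupp.single s η) * f (Finsupp.single r ξ))) :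
    AntighostAlgebra V →ₐ[ℝ] B :=
  RingQuot.liftAlgHom ℝ ⟨TensorAlgebra.lift ℝ f, by
    rintro _ _ ⟨r, s, ξ, η⟩
    simpa using hf r s ξ η⟩

@[simp] theorem lift_ι {B : Type*} [Ring B] [Algebra ℝ B] (f : AntighostGen V →ₗ[ℝ] B)
    (hf) (e : AntighostGen V) : lift f hf (ι e) = f e := by
  unfold lift ι
  refine (RingQuot.liftAlgHom_mkAlgHom_apply ℝ _ _ _).trans ?_
  simp

theorem hom_ext {B : Type*} [Ring B] [Algebra ℝ B] {f g : AntighostAlgebra V →ₐ[ℝ] B}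
    (h : ∀ e, f (ι e) = g (ι e)) : f = g := by
  refine RingQuot.ringQuot_ext' ℝ _ _ (TensorAlgebra.hom_ext (LinearMap.ext fun e => ?_))
  exact h e

/-- The sign `e ↦ (-1)^{[e]} e` on generators. -/
noncomputable def signGen : AntighostGen V →ₗ[ℝ] AntighostGen V :=
  Finsupp.lsum ℝ fun r => ((-1 : ℝ) ^ (r + 1)) • Finsupp.lsingle r

/-- The parity involution `f ↦ (-1)^{[f]} f`. -/
noncomputable def parity : AntighostAlgebra V →ₐ[ℝ] AntighostAlgebra V :=
  lift (ι ∘ₗ signGen) (by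
    intro r s ξ η
    have h := c_mul_c r s ξ η
    unfold c at h
    simp only [signGen, LinearMap.comp_apply, Finsupp.lsum_single, LinearMap.smul_apply,
      Finsupp.lsingle_apply, map_smul, smul_mul_assoc, mul_smul_comm]
    rw [h]
    simp only [smul_smul]
    congr 1
    ring)

theorem parity_c (r : ℕ) (ξ : Module.Dual ℝ V) :
    parity (c r ξ) = (-1 : ℝ) ^ (r + 1) • c r ξ := by
  simp only [parity, c, signGen, lift_ι, LinearMap.comp_apply, Finsupp.lsum_single,
    LinearMap.smul_apply, Finsupp.lsingle_apply, map_smul]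

/-- The values of the Koszul--Tate differential at the point `q` on the antighosts, with `P` an
endomorphism and `R = 1 - P`:
`δ c^{(1)}(ξ) = ξ(R q)`, `δ c^{(2l)}(ξ) = c^{(2l-1)}(ξ ∘ P)`, `δ c^{(2l+1)}(ξ) = c^{(2l)}(ξ ∘ R)`
for `l > 0`. -/
noncomputable def deltaC (P : V →ₗ[ℝ] V) (q : V) : ℕ → Module.Dual ℝ V →ₗ[ℝ] AntighostAlgebra V
  | 0 => (Algebra.linearMap ℝ (AntighostAlgebra V)) ∘ₗ
      Module.Dual.eval ℝ V (q - P q)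
  | r + 1 => ι ∘ₗ Finsupp.lsingle r ∘ₗ
      Module.Dual.transpose (R := ℝ) (if Even r then P else LinearMap.id - P)

/-- The same, on all generators. -/
noncomputable def deltaGen (P : V →ₗ[ℝ] V) (q : V) : AntighostGen V →ₗ[ℝ] AntighostAlgebra V :=
  Finsupp.lsum ℝ (deltaC P q)

theorem deltaC_mul_c (P : V →ₗ[ℝ] V) (q : V) (r s : ℕ) (ξ η : Module.Dual ℝ V) :
    deltaC P q r ξ * c s η = (-1 : ℝ) ^ (r * (s + 1)) • (c s η * deltaC P q r ξ) := by
  cases r with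
  | zero => simpa [deltaC] using Algebra.commutes (ξ (q - P q)) (c s η)
  | succ r =>
    have := c_mul_c r s (Module.Dual.transpose (R := ℝ)
      (if Even r then P else LinearMap.id - P) ξ) η
    simpa [deltaC, c] using this

/-- `e ↦ (parity e, δ e; 0, e)`, the matrix form of an odd derivation. -/
noncomputable def deltaMatrixGen (P : V →ₗ[ℝ] V) (q : V) :
    AntighostGen V →ₗ[ℝ] Matrix (Fin 2) (Fin 2) (AntighostAlgebra V) where
  toFun e := !![parity (ι e), deltaGen P q e; 0, ι e]
  map_add' e e' := by
    ext i j; fin_cases i <;> fin_cases j <;> simp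
  map_smul' t e := by
    ext i j; fin_cases i <;> fin_cases j <;> simp

/-- The algebra map `x ↦ (parity x, δ x; 0, x)`. -/
noncomputable def deltaMatrix (P : V →ₗ[ℝ] V) (q : V) :
    AntighostAlgebra V →ₐ[ℝ] Matrix (Fin 2) (Fin 2) (AntighostAlgebra V) :=
  lift (deltaMatrixGen P q) (by
    intro r s ξ η
    have h1 := c_mul_c r s ξ η
    have h2 := congrArg parity h1
    have h3 := deltaC_mul_c P q r s ξ η
    have h4 := deltaC_mul_c P q s r η ξ
    simp only [map_mul, map_smul] at h2
    have pr := parity_c r ξ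
    have ps := parity_c s η
    unfold c at *
    have key : parity (ι (Finsupp.single r ξ)) * deltaC P q s η
        + deltaC P q r ξ * ι (Finsupp.single s η) =
        (-1 : ℝ) ^ ((r + 1) * (s + 1)) • (parity (ι (Finsupp.single s η)) * deltaC P q r ξ
        + deltaC P q s η * ι (Finsupp.single r ξ)) := by
      rw [pr, ps, h3, h4]
      simp only [smul_mul_assoc, smul_add, smul_smul]
      rw [add_comm]
      congr 2
      · have : (-1 : ℝ) ^ (s + 1) * (-1 : ℝ) ^ (s + 1) = 1 := by
          rw [← mul_pow]; norm_num
        calc (-1 : ℝ) ^ (r * (s + 1))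
            = (-1 : ℝ) ^ (r * (s + 1)) * ((-1 : ℝ) ^ (s + 1) * (-1 : ℝ) ^ (s + 1)) := by
              rw [this, mul_one]
          _ = _ := by ring
      · have : (-1 : ℝ) ^ (s * (r + 1)) * (-1 : ℝ) ^ (s * (r + 1)) = 1 := by
          rw [← mul_pow]; norm_num
        calc (-1 : ℝ) ^ (r + 1)
            = (-1 : ℝ) ^ (r + 1) *
              ((-1 : ℝ) ^ (s * (r + 1)) * (-1 : ℝ) ^ (s * (r + 1))) := by rw [this, mul_one]
          _ = _ := by ring
    ext i j
    fin_cases i <;> fin_cases j <;>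
      simp [deltaMatrixGen, deltaGen, Matrix.mul_apply, Fin.sum_univ_two, h2, h1, key])

/-- The Koszul--Tate differential on the antighost algebra at the point `q`.  It is the odd graded
derivation with the values `deltaC` on the antighosts, see `delta_c_zero`, `delta_c_even`,
`delta_c_odd`, `delta_algebraMap` and `delta_mul`. -/
noncomputable def delta (P : V →ₗ[ℝ] V) (q : V) : AntighostAlgebra V →ₗ[ℝ] AntighostAlgebra V :=
  Matrix.entryLinearMap ℝ (AntighostAlgebra V) (0 : Fin 2) (1 : Fin 2) ∘ₗ
    (deltaMatrix P q).toLinearMap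

theorem delta_algebraMap (P : V →ₗ[ℝ] V) (q : V) (t : ℝ) :
    delta P q (algebraMap ℝ _ t) = 0 := by
  simp [delta, Matrix.algebraMap_matrix_apply]

/-- `δ c^{(1)}(ξ) = ξ(R q)`. -/
theorem delta_c_zero (P : V →ₗ[ℝ] V) (q : V) (ξ : Module.Dual ℝ V) :
    delta P q (c 0 ξ) = algebraMap ℝ _ (ξ (q - P q)) := by
  simp [delta, deltaMatrix, c, deltaMatrixGen, deltaGen, deltaC]

/-- `δ c^{(2l)}(ξ) = c^{(2l-1)}(ξ ∘ P)` for `l > 0`. -/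
theorem delta_c_even (P : V →ₗ[ℝ] V) (q : V) (l : ℕ) (ξ : Module.Dual ℝ V) :
    delta P q (c (2 * l + 1) ξ) = c (2 * l) (ξ ∘ₗ P) := by
  simp [delta, deltaMatrix, c, deltaMatrixGen, deltaGen, deltaC]
  rfl

/-- `δ c^{(2l+1)}(ξ) = c^{(2l)}(ξ ∘ R)` for `l > 0`. -/
theorem delta_c_odd (P : V →ₗ[ℝ] V) (q : V) (l : ℕ) (ξ : Module.Dual ℝ V) :
    delta P q (c (2 * l + 2) ξ) = c (2 * l + 1) (ξ ∘ₗ (LinearMap.id - P)) := by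
  have h : ¬ Even (2 * l + 1) := by simp
  simp only [delta, deltaMatrix, c, LinearMap.comp_apply, AlgHom.toLinearMap_apply, lift_ι,
    Matrix.entryLinearMap_apply, deltaMatrixGen, deltaGen, LinearMap.coe_mk, AddHom.coe_mk,
    Matrix.of_apply, Matrix.cons_val', Matrix.cons_val_zero, Matrix.cons_val_one,
    Finsupp.lsum_single, deltaC, if_neg h]
  rfl

/-- The graded Leibniz rule `δ(x y) = δ(x) y + (-1)^{[x]} x δ(y)`. -/
theorem delta_mul (P : V →ₗ[ℝ] V) (q : V) (x y : AntighostAlgebra V) :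
    delta P q (x * y) = delta P q x * y + parity x * delta P q y := by
  have h00 : ∀ x : AntighostAlgebra V, deltaMatrix P q x 0 0 = parity x ∧
      deltaMatrix P q x 1 0 = 0 ∧ deltaMatrix P q x 1 1 = x := by
    intro x
    let S : Subalgebra ℝ (AntighostAlgebra V) :=
      { carrier := {x | deltaMatrix P q x 0 0 = parity x ∧
          deltaMatrix P q x 1 0 = 0 ∧ deltaMatrix P q x 1 1 = x}
        mul_mem' := by
          rintro a b ⟨ha, hb, hc⟩ ⟨ha', hb', hc'⟩
          simp [Matrix.mul_apply, Fin.sum_univ_two, ha, hb, hc, ha', hb', hc']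
        add_mem' := by
          rintro a b ⟨ha, hb, hc⟩ ⟨ha', hb', hc'⟩
          simp [ha, hb, hc, ha', hb', hc']
        algebraMap_mem' := by
          intro t
          simp [Matrix.algebraMap_matrix_apply] }
    let F : AntighostAlgebra V →ₐ[ℝ] S := lift
      { toFun := fun e => ⟨ι e, by simp [S, deltaMatrix, deltaMatrixGen]⟩
        map_add' := fun e e' => Subtype.ext (by simp)
        map_smul' := fun t e => Subtype.ext (by simp) }
      (fun r s ξ η => Subtype.ext (c_mul_c r s ξ η))
    have hF : S.val.comp F = AlgHom.id ℝ _ := hom_ext fun e => by simp [F]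
    have := (F x).2
    have hx : (F x : AntighostAlgebra V) = x := DFunLike.congr_fun hF x
    rw [hx] at this
    exact this
  simp only [delta, LinearMap.comp_apply, AlgHom.toLinearMap_apply, map_mul,
    Matrix.entryLinearMap_apply, Matrix.mul_apply, Fin.sum_univ_two]
  rw [(h00 x).1, (h00 y).2.2, add_comm]

end AntighostAlgebra

end Antighosts

/-! ### Fibred manifolds and the fibres of their bundles -/

section Geometry

variable {n m : ℕ}
  {X : Type*} [TopologicalSpace X] [ChartedSpace (EuclideanSpace ℝ (Fin n)) X]
  {Y : Type*} [TopologicalSpace Y]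
  [ChartedSpace (EuclideanSpace ℝ (Fin n) × EuclideanSpace ℝ (Fin m)) Y]

/-- Fibred coordinates `(x^λ, y^i)` on `Y → X`: smooth charts of `X` and of `Y` in which `π` is
the projection `(x, y) ↦ x`. -/
structure FibredChart (π : Y → X) where
  /-- the chart `x^λ` of the base -/
  base : OpenPartialHomeomorph X (EuclideanSpace ℝ (Fin n))
  /-- the chart `(x^λ, y^i)` of the total space -/
  total : OpenPartialHomeomorph Y (EuclideanSpace ℝ (Fin n) × EuclideanSpace ℝ (Fin m))
  base_mem : base ∈ IsManifold.maximalAtlas 𝓘(ℝ, EuclideanSpace ℝ (Fin n)) ∞ X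
  total_mem : total ∈ IsManifold.maximalAtlas
    𝓘(ℝ, EuclideanSpace ℝ (Fin n) × EuclideanSpace ℝ (Fin m)) ∞ Y
  mapsTo : ∀ y ∈ total.source, π y ∈ base.source
  compat : ∀ y ∈ total.source, (total y).1 = base (π y)

/-- `π : Y → X` is a fibred manifold: a smooth surjection with fibred coordinates around every
point of `Y` (equivalently, a surjective submersion).  Smooth fibre bundles are of this kind. -/
structure IsFibredManifold (π : Y → X) : Prop where
  contMDiff : ContMDiff 𝓘(ℝ, EuclideanSpace ℝ (Fin n) × EuclideanSpace ℝ (Fin m))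
    𝓘(ℝ, EuclideanSpace ℝ (Fin n)) ∞ π
  surjective : Function.Surjective π
  exists_chart : ∀ y, ∃ κ : FibredChart (n := n) (m := m) π, y ∈ κ.total.source

/-- The tangent space of `X` at `π y`. -/
abbrev BaseTangent (π : Y → X) (y : Y) : Type _ :=
  TangentSpace 𝓘(ℝ, EuclideanSpace ℝ (Fin n)) (π y)

/-- The tangent space of `Y` at `y`. -/
abbrev TotalTangent (n m : ℕ) {Y : Type*} [TopologicalSpace Y]
    [ChartedSpace (EuclideanSpace ℝ (Fin n) × EuclideanSpace ℝ (Fin m)) Y] (y : Y) : Type _ :=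
  TangentSpace 𝓘(ℝ, EuclideanSpace ℝ (Fin n) × EuclideanSpace ℝ (Fin m)) y

/-- The tangent map of `π` at `y`. -/
noncomputable def tangentMapAt (π : Y → X) (y : Y) :
    TotalTangent n m y →ₗ[ℝ] BaseTangent (n := n) π y :=
  (mfderiv 𝓘(ℝ, EuclideanSpace ℝ (Fin n) × EuclideanSpace ℝ (Fin m))
    𝓘(ℝ, EuclideanSpace ℝ (Fin n)) π y).toLinearMap

variable (n m)

/-- The fibre `V_y Y` of the vertical tangent bundle. -/
noncomputable abbrev Vertical (π : Y → X) (y : Y) : Submodule ℝ (TotalTangent n m y) :=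
  LinearMap.ker (tangentMapAt (n := n) (m := m) π y)

/-- The fibre `J¹_y Y` of the first order jet manifold: linear splittings of the tangent map. -/
abbrev JetFibre (π : Y → X) (y : Y) : Type _ :=
  {j : BaseTangent (n := n) π y →ₗ[ℝ] TotalTangent n m y //
    ∀ v, tangentMapAt (n := n) (m := m) π y (j v) = v}

/-- The fibre of `T*X ⊗ VY` at `y`, over which `J¹Y → Y` is an affine bundle. -/
def SolderingFibre (π : Y → X) (y : Y) : Type _ :=
  BaseTangent (n := n) π y →ₗ[ℝ] Vertical n m π y

noncomputable instance (π : Y → X) (y : Y) : AddCommGroup (SolderingFibre n m π y) :=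
  inferInstanceAs (AddCommGroup (BaseTangent (n := n) π y →ₗ[ℝ] Vertical n m π y))

noncomputable instance (π : Y → X) (y : Y) : Module ℝ (SolderingFibre n m π y) :=
  inferInstanceAs (Module ℝ (BaseTangent (n := n) π y →ₗ[ℝ] Vertical n m π y))

/-- The fibre of `∧ⁿ T*X` at `π y`. -/
abbrev DensityFibre (π : Y → X) (y : Y) : Type _ :=
  BaseTangent (n := n) π y [⋀^Fin n]→ₗ[ℝ] ℝ

/-- The fibre at `y` of the Legendre bundle `Π = ∧ⁿT*X ⊗ V*Y ⊗ TX`, written as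
`Hom(T*X ⊗ VY, ∧ⁿT*X)`. -/
def LegendreFibre (π : Y → X) (y : Y) : Type _ :=
  SolderingFibre n m π y →ₗ[ℝ] DensityFibre n π y

noncomputable instance (π : Y → X) (y : Y) : AddCommGroup (LegendreFibre n m π y) :=
  inferInstanceAs (AddCommGroup (SolderingFibre n m π y →ₗ[ℝ] DensityFibre n π y))

noncomputable instance (π : Y → X) (y : Y) : Module ℝ (LegendreFibre n m π y) :=
  inferInstanceAs (Module ℝ (SolderingFibre n m π y →ₗ[ℝ] DensityFibre n π y))

/-- The Legendre bundle `Π` (its total space). -/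
abbrev LegendreBundle (π : Y → X) : Type _ := Σ y : Y, LegendreFibre n m π y

variable {n m}

/-- An element of `T*X ⊗ VY` as a linear map `T X → T Y` with vertical values. -/
noncomputable def SolderingFibre.toHom {π : Y → X} {y : Y} (h : SolderingFibre n m π y) :
    BaseTangent (n := n) π y →ₗ[ℝ] TotalTangent n m y :=
  (Vertical n m π y).subtype ∘ₗ
    (show BaseTangent (n := n) π y →ₗ[ℝ] Vertical n m π y from h)

/-- The value of an element of `Π_y` on an element of `T*X ⊗ VY`. -/
noncomputable def LegendreFibre.eval {π : Y → X} {y : Y} (q : LegendreFibre n m π y)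
    (h : SolderingFibre n m π y) : DensityFibre n π y :=
  (show SolderingFibre n m π y →ₗ[ℝ] DensityFibre n π y from q) h

/-- The affine action of `T*X ⊗ VY` on `J¹Y`. -/
noncomputable def JetFibre.translate {π : Y → X} {y : Y} (j : JetFibre n m π y)
    (h : SolderingFibre n m π y) : JetFibre n m π y :=
  ⟨j.1 + h.toHom, fun v => by
    have : tangentMapAt (n := n) (m := m) π y (h.toHom v) = 0 :=
      ((show BaseTangent (n := n) π y →ₗ[ℝ] Vertical n m π y from h) v).2
    rw [LinearMap.add_apply, map_add, this, j.2 v, add_zero]⟩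

/-! ### Induced coordinates -/

namespace FibredChart

variable {π : Y → X} (κ : FibredChart (n := n) (m := m) π)

theorem base_mdiff : κ.base.MDifferentiable 𝓘(ℝ, EuclideanSpace ℝ (Fin n))
    𝓘(ℝ, EuclideanSpace ℝ (Fin n)) :=
  ⟨(contMDiffOn_of_mem_maximalAtlas κ.base_mem).mdifferentiableOn (by simp),
    (contMDiffOn_symm_of_mem_maximalAtlas κ.base_mem).mdifferentiableOn (by simp)⟩

theorem total_mdiff : κ.total.MDifferentiable
    𝓘(ℝ, EuclideanSpace ℝ (Fin n) × EuclideanSpace ℝ (Fin m))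
    𝓘(ℝ, EuclideanSpace ℝ (Fin n) × EuclideanSpace ℝ (Fin m)) :=
  ⟨(contMDiffOn_of_mem_maximalAtlas κ.total_mem).mdifferentiableOn (by simp),
    (contMDiffOn_symm_of_mem_maximalAtlas κ.total_mem).mdifferentiableOn (by simp)⟩

/-- The coordinates `(dx^λ)` of tangent vectors of `X`. -/
noncomputable def dBase {y : Y} (hy : y ∈ κ.total.source) :
    BaseTangent (n := n) π y ≃L[ℝ] EuclideanSpace ℝ (Fin n) :=
  (κ.base_mdiff.mfderiv (κ.mapsTo y hy)).trans (NormedSpace.fromTangentSpace _)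

/-- The coordinates `(dx^λ, dy^i)` of tangent vectors of `Y`. -/
noncomputable def dTotal {y : Y} (hy : y ∈ κ.total.source) :
    TotalTangent n m y ≃L[ℝ] EuclideanSpace ℝ (Fin n) × EuclideanSpace ℝ (Fin m) :=
  (κ.total_mdiff.mfderiv hy).trans (NormedSpace.fromTangentSpace _)

theorem dTotal_fst {y : Y} (hy : y ∈ κ.total.source) (v : TotalTangent n m y) :
    (κ.dTotal hy v).1 = κ.dBase hy (tangentMapAt (n := n) (m := m) π y v) := by
  have hb := κ.base_mdiff
  have ht := κ.total_mdiff
  have hnhds : κ.total.source ∈ nhds y := κ.total.open_source.mem_nhds hy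
  have htot := ht.mdifferentiableAt hy
  have hfst : MDifferentiableAt 𝓘(ℝ, EuclideanSpace ℝ (Fin n) × EuclideanSpace ℝ (Fin m))
      𝓘(ℝ, EuclideanSpace ℝ (Fin n))
      (Prod.fst : EuclideanSpace ℝ (Fin n) × EuclideanSpace ℝ (Fin m) → _) (κ.total y) :=
    differentiableAt_fst.mdifferentiableAt
  have hcomp := hfst.comp y htot
  have heq : (Prod.fst ∘ κ.total) =ᶠ[nhds y] (κ.base ∘ π) :=
    Filter.mem_of_superset hnhds fun z hz => κ.compat z hz
  have hpi : MDifferentiableAt 𝓘(ℝ, EuclideanSpace ℝ (Fin n) × EuclideanSpace ℝ (Fin m))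
      𝓘(ℝ, EuclideanSpace ℝ (Fin n)) π y := by
    have hsymm : MDifferentiableAt 𝓘(ℝ, EuclideanSpace ℝ (Fin n))
        𝓘(ℝ, EuclideanSpace ℝ (Fin n)) κ.base.symm ((Prod.fst ∘ κ.total) y) := by
      refine hb.mdifferentiableAt_symm ?_
      rw [Function.comp_apply, κ.compat y hy]
      exact κ.base.map_source (κ.mapsTo y hy)
    refine (hsymm.comp y hcomp).congr_of_eventuallyEq ?_
    refine Filter.mem_of_superset hnhds fun z hz => ?_
    simp only [Set.mem_ofPred_eq, Function.comp_apply]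
    rw [κ.compat z hz, κ.base.left_inv (κ.mapsTo z hz)]
  have h1 := mfderiv_comp y hfst htot
  have h2 := mfderiv_comp y (hb.mdifferentiableAt (κ.mapsTo y hy)) hpi
  rw [heq.mfderiv_eq, h2] at h1
  have h3 := DFunLike.congr_fun h1 v
  have h4 : ∀ w : EuclideanSpace ℝ (Fin n) × EuclideanSpace ℝ (Fin m),
      mfderiv 𝓘(ℝ, EuclideanSpace ℝ (Fin n) × EuclideanSpace ℝ (Fin m))
      𝓘(ℝ, EuclideanSpace ℝ (Fin n))
      (Prod.fst : EuclideanSpace ℝ (Fin n) × EuclideanSpace ℝ (Fin m) → _) (κ.total y) w =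
      w.1 := by
    intro w
    rw [mfderiv_eq_fderiv, fderiv_fst]
    rfl
  exact (h3.trans (h4 _)).symm

/-- The coordinate vector `∂_λ` of `X` at `π y`. -/
noncomputable def baseFrame {y : Y} (hy : y ∈ κ.total.source) (l : Fin n) :
    BaseTangent (n := n) π y :=
  (κ.dBase hy).symm (EuclideanSpace.single l 1)

/-- The vertical coordinate vector `∂_i` of `Y` at `y`. -/
noncomputable def vertFrame {y : Y} (hy : y ∈ κ.total.source) (i : Fin m) : Vertical n m π y :=
  ⟨(κ.dTotal hy).symm (0, EuclideanSpace.single i 1), by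
    have h := κ.dTotal_fst hy ((κ.dTotal hy).symm (0, EuclideanSpace.single i 1))
    rw [ContinuousLinearEquiv.apply_symm_apply] at h
    rw [LinearMap.mem_ker]
    exact (κ.dBase hy).injective (h.symm.trans (map_zero _).symm)⟩

/-- The element `dx^λ ⊗ ∂_i` of `T*X ⊗ VY`. -/
noncomputable def soldFrame {y : Y} (hy : y ∈ κ.total.source) (l : Fin n) (i : Fin m) :
    SolderingFibre n m π y :=
  (show BaseTangent (n := n) π y →ₗ[ℝ] Vertical n m π y from
    (((EuclideanSpace.proj l : EuclideanSpace ℝ (Fin n) →L[ℝ] ℝ).toLinearMap ∘ₗ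
      (κ.dBase hy).toLinearEquiv.toLinearMap)).smulRight (κ.vertFrame hy i))

/-- The coordinate `y^i_λ` of a linear map `T X → T Y` (of a jet, or of an element of
`T*X ⊗ VY`). -/
noncomputable def velocity {y : Y} (hy : y ∈ κ.total.source)
    (j : BaseTangent (n := n) π y →ₗ[ℝ] TotalTangent n m y) (l : Fin n) (i : Fin m) : ℝ :=
  (κ.dTotal hy (j (κ.baseFrame hy l))).2 i

/-- The coordinate of a density in `∧ⁿT*X` with respect to `ω = dx^1 ∧ ⋯ ∧ dx^n`. -/
noncomputable def density {y : Y} (hy : y ∈ κ.total.source) (d : DensityFibre n π y) : ℝ :=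
  d fun l => κ.baseFrame hy l

/-- The coordinate `p^λ_i` on the fibre of `Π`, as an element of the dual of the fibre. -/
noncomputable def momentum {y : Y} (hy : y ∈ κ.total.source) (l : Fin n) (i : Fin m) :
    Module.Dual ℝ (LegendreFibre n m π y) where
  toFun q := κ.density hy (q.eval (κ.soldFrame hy l i))
  map_add' _ _ := rfl
  map_smul' _ _ := rfl

/-- The coordinates `(x^λ, y^i, p^λ_i)` of a point of `Π`. -/
noncomputable def coord (q : LegendreBundle n m π) (hq : q.1 ∈ κ.total.source) :
    (EuclideanSpace ℝ (Fin n) × EuclideanSpace ℝ (Fin m)) × (Fin n → Fin m → ℝ) :=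
  (κ.total q.1, fun l i => κ.momentum hq l i q.2)

/-- The range of the coordinates `(x^λ, y^i, p^λ_i)`. -/
def coordRange :
    Set ((EuclideanSpace ℝ (Fin n) × EuclideanSpace ℝ (Fin m)) × (Fin n → Fin m → ℝ)) :=
  κ.total.target ×ˢ Set.univ

end FibredChart

/-! ### Smooth functions and graded functions on the Legendre bundle -/

/-- The functions on `Π` which are smooth in all coordinates `(x^λ, y^i, p^λ_i)`. -/
def smoothSubalgebra (n m : ℕ) {X : Type*} [TopologicalSpace X]
    [ChartedSpace (EuclideanSpace ℝ (Fin n)) X] {Y : Type*} [TopologicalSpace Y]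
    [ChartedSpace (EuclideanSpace ℝ (Fin n) × EuclideanSpace ℝ (Fin m)) Y] (π : Y → X) :
    Subalgebra ℝ (LegendreBundle n m π → ℝ) where
  carrier := {f | ∀ κ : FibredChart (n := n) (m := m) π,
    ∃ g, ContDiffOn ℝ ∞ g κ.coordRange ∧ ∀ q hq, f q = g (κ.coord q hq)}
  mul_mem' := by
    intro f f' hf hf' κ
    obtain ⟨g, hg, h⟩ := hf κ
    obtain ⟨g', hg', h'⟩ := hf' κ
    exact ⟨fun z => g z * g' z, hg.mul hg', fun q hq => by simp [h q hq, h' q hq]⟩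
  add_mem' := by
    intro f f' hf hf' κ
    obtain ⟨g, hg, h⟩ := hf κ
    obtain ⟨g', hg', h'⟩ := hf' κ
    exact ⟨fun z => g z + g' z, hg.add hg', fun q hq => by simp [h q hq, h' q hq]⟩
  algebraMap_mem' := fun t κ => ⟨fun _ => t, contDiffOn_const, fun _ _ => rfl⟩

/-- The ring `C^∞(Π)` of smooth functions on `Π`. -/
def SmoothFunctions (n m : ℕ) {X : Type*} [TopologicalSpace X]
    [ChartedSpace (EuclideanSpace ℝ (Fin n)) X] {Y : Type*} [TopologicalSpace Y]
    [ChartedSpace (EuclideanSpace ℝ (Fin n) × EuclideanSpace ℝ (Fin m)) Y] (π : Y → X) :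
    Type _ :=
  smoothSubalgebra n m π

noncomputable instance (π : Y → X) : CommRing (SmoothFunctions n m π) :=
  inferInstanceAs (CommRing (smoothSubalgebra n m π))

noncomputable instance (π : Y → X) : Algebra ℝ (SmoothFunctions n m π) :=
  inferInstanceAs (Algebra ℝ (smoothSubalgebra n m π))

/-- A smooth function as a map `Π → ℝ`. -/
def SmoothFunctions.toFun {π : Y → X} : SmoothFunctions n m π →+* (LegendreBundle n m π → ℝ) :=
  (smoothSubalgebra n m π).val.toRingHom

/-- Smooth functions on a subset `N` of `Π`: near every point of `N` they are restrictions of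
smooth functions of the coordinates `(x^λ, y^i, p^λ_i)`.  For an imbedded submanifold `N` this is
`C^∞(N)`. -/
def SmoothFunctionsOn {π : Y → X} (N : Set (LegendreBundle n m π)) : Subalgebra ℝ (N → ℝ) where
  carrier := {f | ∀ (κ : FibredChart (n := n) (m := m) π) (q₀ : N)
    (hq₀ : q₀.1.1 ∈ κ.total.source), ∃ U g, IsOpen U ∧ κ.coord q₀.1 hq₀ ∈ U ∧
      ContDiffOn ℝ ∞ g U ∧ ∀ (q : N) (hq : q.1.1 ∈ κ.total.source),
        κ.coord q.1 hq ∈ U → f q = g (κ.coord q.1 hq)}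
  mul_mem' := by
    intro f f' hf hf' κ q₀ hq₀
    obtain ⟨U, g, hU, hm, hg, h⟩ := hf κ q₀ hq₀
    obtain ⟨U', g', hU', hm', hg', h'⟩ := hf' κ q₀ hq₀
    exact ⟨U ∩ U', fun z => g z * g' z, hU.inter hU', ⟨hm, hm'⟩,
      (hg.mono Set.inter_subset_left).mul (hg'.mono Set.inter_subset_right),
      fun q hq hz => by simp [h q hq hz.1, h' q hq hz.2]⟩
  add_mem' := by
    intro f f' hf hf' κ q₀ hq₀
    obtain ⟨U, g, hU, hm, hg, h⟩ := hf κ q₀ hq₀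
    obtain ⟨U', g', hU', hm', hg', h'⟩ := hf' κ q₀ hq₀
    exact ⟨U ∩ U', fun z => g z + g' z, hU.inter hU', ⟨hm, hm'⟩,
      (hg.mono Set.inter_subset_left).add (hg'.mono Set.inter_subset_right),
      fun q hq hz => by simp [h q hq hz.1, h' q hq hz.2]⟩
  algebraMap_mem' := fun t κ q₀ _ =>
    ⟨Set.univ, fun _ => t, isOpen_univ, trivial, contDiffOn_const, fun _ _ _ => rfl⟩

/-- The ideal `I_N` of smooth functions on `Π` which vanish on `N`. -/
def vanishingIdeal {π : Y → X} (N : Set (LegendreBundle n m π)) :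
    Ideal (SmoothFunctions n m π) where
  carrier := {f | ∀ q ∈ N, f.toFun q = 0}
  add_mem' := by
    intro f g hf hg q hq
    simp [hf q hq, hg q hq]
  zero_mem' := fun _ _ => rfl
  smul_mem' := by
    intro f g hg q hq
    simp [hg q hq]

/-- All (not necessarily smooth) sections over `Π` of the bundle of antighost algebras
`∧E*`, `E* = V*_YΠ ⊕ V*_YΠ ⊕ ⋯`; the fibre of `V*_YΠ` at `q ∈ Π_y` is the dual of `Π_y`. -/
abbrev AntighostSections (n m : ℕ) {X : Type*} [TopologicalSpace X]
    [ChartedSpace (EuclideanSpace ℝ (Fin n)) X] {Y : Type*} [TopologicalSpace Y]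
    [ChartedSpace (EuclideanSpace ℝ (Fin n) × EuclideanSpace ℝ (Fin m)) Y] (π : Y → X) :
    Type _ :=
  ∀ q : LegendreBundle n m π, AntighostAlgebra (LegendreFibre n m π q.1)

/-- Sections form an algebra over `C^∞(Π)`, with pointwise operations. -/
noncomputable instance (π : Y → X) :
    Module (SmoothFunctions n m π) (AntighostSections n m π) where
  smul f s q := f.toFun q • s q
  one_smul s := funext fun q => one_smul ℝ (s q)
  mul_smul f g s := funext fun q => mul_smul (f.toFun q) (g.toFun q) (s q)
  smul_zero f := funext fun q => smul_zero (f.toFun q)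
  smul_add f s t := funext fun q => smul_add (f.toFun q) (s q) (t q)
  add_smul f g s := funext fun q => add_smul (f.toFun q) (g.toFun q) (s q)
  zero_smul s := funext fun q => zero_smul ℝ (s q)

noncomputable instance (π : Y → X) :
    Algebra (SmoothFunctions n m π) (AntighostSections n m π) :=
  Algebra.ofModule
    (fun f s t => funext fun q => smul_mul_assoc (f.toFun q) (s q) (t q))
    (fun f s t => funext fun q => mul_smul_comm (f.toFun q) (s q) (t q))

/-- A section is smooth if in any fibred coordinates it is a finite sum
`∑ f_α c^α`, where `f_α` are smooth functions of `(x^λ, y^i, p^λ_i)` and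
`c^α = c^{λ₁(r₁)}_{i₁} ⋯ c^{λ_k(r_k)}_{i_k}` are products of the holonomic antighosts, that is, of
copies of the fibre coordinates `p^λ_i`. -/
def IsSmoothSection {π : Y → X} (s : AntighostSections n m π) : Prop :=
  ∀ κ : FibredChart (n := n) (m := m) π,
    ∃ (N : ℕ) (α : Fin N → List (ℕ × Fin n × Fin m))
      (g : Fin N → (EuclideanSpace ℝ (Fin n) × EuclideanSpace ℝ (Fin m)) ×
        (Fin n → Fin m → ℝ) → ℝ),
      (∀ k, ContDiffOn ℝ ∞ (g k) κ.coordRange) ∧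
      ∀ q hq, s q = ∑ k, g k (κ.coord q hq) •
        AntighostAlgebra.monomial ((α k).map fun p => (p.1, κ.momentum hq p.2.1 p.2.2))

/-- The `C^∞(Π)`-module `𝒩^k` of graded functions of antighost number `k`. -/
def GradedFunctions (n m : ℕ) {X : Type*} [TopologicalSpace X]
    [ChartedSpace (EuclideanSpace ℝ (Fin n)) X] {Y : Type*} [TopologicalSpace Y]
    [ChartedSpace (EuclideanSpace ℝ (Fin n) × EuclideanSpace ℝ (Fin m)) Y] (π : Y → X) (k : ℕ) :
    Submodule (SmoothFunctions n m π) (AntighostSections n m π) where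
  carrier := {s | IsSmoothSection s ∧ ∀ q, s q ∈ AntighostAlgebra.degree k}
  add_mem' := by
    rintro s s' ⟨hs, hk⟩ ⟨hs', hk'⟩
    refine ⟨fun κ => ?_, fun q => add_mem (hk q) (hk' q)⟩
    obtain ⟨N, α, g, hg, h⟩ := hs κ
    obtain ⟨N', α', g', hg', h'⟩ := hs' κ
    refine ⟨N + N', Fin.append α α', Fin.append g g', fun k => ?_, fun q hq => ?_⟩
    · refine Fin.addCases (fun i => ?_) (fun i => ?_) k
      · simpa using hg i
      · simpa using hg' i
    · simp [Fin.sum_univ_add, h q hq, h' q hq]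
  zero_mem' := ⟨fun κ => ⟨0, Fin.elim0, Fin.elim0, fun k => k.elim0, fun q hq => by simp⟩,
    fun q => zero_mem _⟩
  smul_mem' := by
    rintro f s ⟨hs, hk⟩
    refine ⟨fun κ => ?_, fun q => Submodule.smul_mem _ (f.toFun q) (hk q)⟩
    obtain ⟨N, α, g, hg, h⟩ := hs κ
    obtain ⟨φ, hφ, hf⟩ := f.2 κ
    refine ⟨N, α, fun k z => φ z * g k z, fun k => hφ.mul (hg k), fun q hq => ?_⟩
    change f.toFun q • s q = _
    have hf' : f.toFun q = φ (κ.coord q hq) := hf q hq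
    rw [h q hq, hf', Finset.smul_sum]
    exact Finset.sum_congr rfl fun k _ => smul_smul _ _ _

/-- The algebra of sections generated by all `𝒩^k`. -/
noncomputable def gradedSubalgebra (n m : ℕ) {X : Type*} [TopologicalSpace X]
    [ChartedSpace (EuclideanSpace ℝ (Fin n)) X] {Y : Type*} [TopologicalSpace Y]
    [ChartedSpace (EuclideanSpace ℝ (Fin n) × EuclideanSpace ℝ (Fin m)) Y] (π : Y → X) :
    Subalgebra (SmoothFunctions n m π) (AntighostSections n m π) :=
  Algebra.adjoin _ (⋃ k, (GradedFunctions n m π k : Set (AntighostSections n m π)))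

/-- The graded commutative `C^∞(Π)`-algebra `𝒜(Π)` of graded functions. -/
def GradedFunctionAlgebra (n m : ℕ) {X : Type*} [TopologicalSpace X]
    [ChartedSpace (EuclideanSpace ℝ (Fin n)) X] {Y : Type*} [TopologicalSpace Y]
    [ChartedSpace (EuclideanSpace ℝ (Fin n) × EuclideanSpace ℝ (Fin m)) Y] (π : Y → X) :
    Type _ :=
  gradedSubalgebra n m π

noncomputable instance (π : Y → X) : Ring (GradedFunctionAlgebra n m π) :=
  inferInstanceAs (Ring (gradedSubalgebra n m π))

noncomputable instance (π : Y → X) :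
    Algebra (SmoothFunctions n m π) (GradedFunctionAlgebra n m π) :=
  inferInstanceAs (Algebra (SmoothFunctions n m π) (gradedSubalgebra n m π))

/-- A graded function as a section over `Π`. -/
noncomputable def GradedFunctionAlgebra.toSection {π : Y → X} :
    GradedFunctionAlgebra n m π →ₐ[SmoothFunctions n m π] AntighostSections n m π :=
  (gradedSubalgebra n m π).val

/-- The terms `𝒩^k` as submodules of `𝒜(Π)`. -/
noncomputable def gradedPart (n m : ℕ) {X : Type*} [TopologicalSpace X]
    [ChartedSpace (EuclideanSpace ℝ (Fin n)) X] {Y : Type*} [TopologicalSpace Y]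
    [ChartedSpace (EuclideanSpace ℝ (Fin n) × EuclideanSpace ℝ (Fin m)) Y] (π : Y → X) (k : ℕ) :
    Submodule (SmoothFunctions n m π) (GradedFunctionAlgebra n m π) :=
  (GradedFunctions n m π k).comap (GradedFunctionAlgebra.toSection (π := π)).toLinearMap

/-! ### Quadratic Lagrangians -/

/-- A first order Lagrangian `L : J¹Y → ∧ⁿT*X`. -/
abbrev Lagrangian (n m : ℕ) {X : Type*} [TopologicalSpace X]
    [ChartedSpace (EuclideanSpace ℝ (Fin n)) X] {Y : Type*} [TopologicalSpace Y]
    [ChartedSpace (EuclideanSpace ℝ (Fin n) × EuclideanSpace ℝ (Fin m)) Y] (π : Y → X) :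
    Type _ :=
  ∀ y : Y, JetFibre n m π y → DensityFibre n π y

namespace Lagrangian

variable {π : Y → X} (L : Lagrangian n m π)

/-- In any fibred coordinates `L` has the form
`(1/2) a^{λμ}_{ij} y^i_λ y^j_μ + b^λ_i y^i_λ + c` with smooth local functions `a`, `b`, `c`
on `Y`. -/
def IsQuadratic : Prop :=
  ∀ κ : FibredChart (n := n) (m := m) π,
    ∃ (a : EuclideanSpace ℝ (Fin n) × EuclideanSpace ℝ (Fin m) →
        Fin n → Fin m → Fin n → Fin m → ℝ)
      (b : EuclideanSpace ℝ (Fin n) × EuclideanSpace ℝ (Fin m) → Fin n → Fin m → ℝ)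
      (c : EuclideanSpace ℝ (Fin n) × EuclideanSpace ℝ (Fin m) → ℝ),
      ContDiffOn ℝ ∞ a κ.total.target ∧ ContDiffOn ℝ ∞ b κ.total.target ∧
      ContDiffOn ℝ ∞ c κ.total.target ∧ (∀ z l i k j, a z l i k j = a z k j l i) ∧
      ∀ (y : Y) (hy : y ∈ κ.total.source) (j : JetFibre n m π y),
        κ.density hy (L y j) =
          (1 / 2) * (∑ l, ∑ i, ∑ k, ∑ h, a (κ.total y) l i k h *
            κ.velocity hy j.1 l i * κ.velocity hy j.1 k h) +
          (∑ l, ∑ i, b (κ.total y) l i * κ.velocity hy j.1 l i) + c (κ.total y)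

/-- `p` is the derivative of `L` at the jet `j` along the fibre of `J¹Y → Y`. -/
def IsFibreDerivative {y : Y} (j : JetFibre n m π y) (p : LegendreFibre n m π y) : Prop :=
  ∀ (h : SolderingFibre n m π y) (v : Fin n → BaseTangent (n := n) π y),
    HasDerivAt (fun t : ℝ => L y (j.translate (t • h)) v) (p.eval h v) 0

open Classical in
/-- The Legendre map `L̂ : J¹Y → Π`, `p^λ_i ∘ L̂ = ∂L/∂y^i_λ` (zero where `L` has no fibre
derivative, which does not happen for a quadratic Lagrangian). -/
noncomputable def legendre {y : Y} (j : JetFibre n m π y) : LegendreFibre n m π y :=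
  if h : ∃ p, L.IsFibreDerivative j p then h.choose else 0

/-- The Lagrangian constraint space `N_L = L̂(J¹Y)`. -/
def constraintSpace : Set (LegendreBundle n m π) :=
  {q | ∃ j : JetFibre n m π q.1, L.legendre j = q.2}

open Classical in
/-- The linear morphism `T*X ⊗ VY → Π`, `p^λ_i = a^{λμ}_{ij} ȳ^j_μ`, over `y` which corresponds to
the affine morphism `L̂` (zero if `L̂` is not affine, which does not happen for a quadratic
Lagrangian). -/
noncomputable def linearLegendre (y : Y) : SolderingFibre n m π y →ₗ[ℝ] LegendreFibre n m π y :=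
  if h : ∃ a : SolderingFibre n m π y →ₗ[ℝ] LegendreFibre n m π y,
    ∀ (j : JetFibre n m π y) (w : SolderingFibre n m π y),
      L.legendre (j.translate w) = L.legendre j + a w then h.choose else 0

end Lagrangian

/-- Smoothness of a linear bundle map `σ : Π → T*X ⊗ VY` over `Y`,
`ȳ^i_λ ∘ σ = σ^{ij}_{λμ} p^μ_j`. -/
def IsSmoothBundleMap {π : Y → X}
    (σ : ∀ y, LegendreFibre n m π y →ₗ[ℝ] SolderingFibre n m π y) : Prop :=
  ∀ κ : FibredChart (n := n) (m := m) π,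
    ∃ s : EuclideanSpace ℝ (Fin n) × EuclideanSpace ℝ (Fin m) →
        Fin n → Fin m → Fin n → Fin m → ℝ,
      ContDiffOn ℝ ∞ s κ.total.target ∧
      ∀ (y : Y) (hy : y ∈ κ.total.source) (q : LegendreFibre n m π y) (l : Fin n) (i : Fin m),
        κ.velocity hy (σ y q).toHom l i =
          ∑ k, ∑ j, s (κ.total y) l i k j * κ.momentum hy k j q

/-- `σ₀` is a smooth solution of `a ∘ σ₀ ∘ a = a`, `σ₀ ∘ a ∘ σ₀ = σ₀`, where `a` is the linear
part of the Legendre map. -/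
structure Lagrangian.IsSplitting {π : Y → X} (L : Lagrangian n m π)
    (σ₀ : ∀ y, LegendreFibre n m π y →ₗ[ℝ] SolderingFibre n m π y) : Prop where
  smooth : IsSmoothBundleMap σ₀
  a_σ_a : ∀ (y : Y) (h : SolderingFibre n m π y),
    L.linearLegendre y (σ₀ y (L.linearLegendre y h)) = L.linearLegendre y h
  σ_a_σ : ∀ (y : Y) (q : LegendreFibre n m π y),
    σ₀ y (L.linearLegendre y (σ₀ y q)) = σ₀ y q

/-- The projection operator `P = a ∘ σ₀` on `Π`. -/
noncomputable def Lagrangian.projP {π : Y → X} (L : Lagrangian n m π)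
    (σ₀ : ∀ y, LegendreFibre n m π y →ₗ[ℝ] SolderingFibre n m π y) (y : Y) :
    LegendreFibre n m π y →ₗ[ℝ] LegendreFibre n m π y :=
  L.linearLegendre y ∘ₗ σ₀ y

/-- The projection operator `R = 1 - P` on `Π`. -/
noncomputable def Lagrangian.projR {π : Y → X} (L : Lagrangian n m π)
    (σ₀ : ∀ y, LegendreFibre n m π y →ₗ[ℝ] SolderingFibre n m π y) (y : Y) :
    LegendreFibre n m π y →ₗ[ℝ] LegendreFibre n m π y :=
  LinearMap.id - L.projP σ₀ y

end Geometry

/-!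
The differential `δ` is fibrewise: at `q ∈ Π_y` it is an odd derivation of the antighost algebra of
the finite-dimensional vector space `V = Π_y`, and it involves only the projection `P` of `V` and
the point `q`.

The affine map `L̂` restricted to a fibre has linear part `a` and takes the value `0`, so `N_L` is
fibrewise the range of `a`, which is the range of `P = a σ₀` and the kernel of `R = 1 - P`
(`Lagrangian.constraintSpace_eq_range`). In particular `P` is a smooth retraction of `Π` onto
`N_L`, so smooth functions on `N_L` extend to `Π` by composition with `P`
(`restrictHom_surjective`).

For the exactness, let `h` be the odd derivation which sends `c^{(r+1)}` to `c^{(r+2)} ∘ P` or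
`c^{(r+2)} ∘ R` according to the parity of `r` (`contract`), and a function `f` of the momenta to
`∑ₐ (∂f/∂pₐ) c^{(1)}(eᵃ ∘ R)` (`koszul`). The derivation `δ h + h δ` is the identity on all
antighosts, and on functions it is the Euler field `f ↦ df(R q)`
(`homotopy_monomial`, `delta_koszul_add`). It is therefore the infinitesimal generator of the
rescaling `c ↦ t c`, `q ↦ P q + t R q`, which commutes with `δ` (`scale_delta`) and contracts `Π`
onto `N_L` as `t → 0`. Integrating over `t ∈ [0, 1]` shows that a cycle `s` is the boundary of
`∫ t⁻¹ (rescaled h s) dt`, provided that `s` vanishes in the limit `t = 0` (`delta_weakIntegral`).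
The proviso holds in positive antighost number, and in antighost number `0` it says that `s`
vanishes on `N_L`.

The homotopy is defined on the whole of `Π` at once, without a partition of unity. Derivatives and
integrals of functions with values in the infinite-dimensional antighost algebra are tested by
linear functionals (`HasWeakDerivAt`, `HasWeakIntegral`); they are unique, so that they can be
computed in each fibred chart, where smoothness is a matter of finitely many coefficient functions
and of differentiation under the integral sign (`contDiffOn_intervalIntegral`).
-/

namespace AntighostAlgebra

section Algebra

variable {V : Type*} [AddCommGroup V] [Module ℝ V]

/-! ### Monomials and the grading -/

@[simp] theorem monomial_nil : monomial ([] : List (ℕ × Module.Dual ℝ V)) = 1 := rfl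

@[simp] theorem monomial_cons (p : ℕ × Module.Dual ℝ V) (l : List (ℕ × Module.Dual ℝ V)) :
    monomial (p :: l) = c p.1 p.2 * monomial l := by
  simp [monomial]

theorem monomial_append (l l' : List (ℕ × Module.Dual ℝ V)) :
    monomial (l ++ l') = monomial l * monomial l' := by
  simp [monomial]

theorem span_monomial :
    Submodule.span ℝ (Set.range (monomial (V := V))) = ⊤ := by
  let p := Submodule.span ℝ (Set.range (monomial (V := V)))
  have hone : (1 : AntighostAlgebra V) ∈ p := Submodule.subset_span ⟨[], rfl⟩
  have hmul : ∀ x y, x ∈ p → y ∈ p → x * y ∈ p := by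
    intro x y hx hy
    have : p * p ≤ p := by
      rw [Submodule.span_mul_span]
      refine Submodule.span_le.2 ?_
      rintro _ ⟨_, ⟨l, rfl⟩, _, ⟨l', rfl⟩, rfl⟩
      exact Submodule.subset_span ⟨l ++ l', monomial_append l l'⟩
    exact this (Submodule.mul_mem_mul hx hy)
  let S : Subalgebra ℝ (AntighostAlgebra V) := p.toSubalgebra hone hmul
  have hι : ∀ e : AntighostGen V, ι e ∈ S := by
    intro e
    induction e using Finsupp.induction_linear with
    | zero => rw [map_zero]; exact S.zero_mem
    | add e e' h h' => rw [map_add]; exact S.add_mem h h'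
    | single r ξ => exact Submodule.subset_span ⟨[(r, ξ)], by simp [c]⟩
  let F : AntighostAlgebra V →ₐ[ℝ] S := lift
    (ι.codRestrict (Subalgebra.toSubmodule S) hι)
    (fun r s ξ η => Subtype.ext (c_mul_c r s ξ η))
  have hF : S.val.comp F = AlgHom.id ℝ _ := hom_ext fun e => by
    simp only [F, AlgHom.comp_apply, lift_ι]
    rfl
  rw [eq_top_iff]
  intro x _
  have hx : (F x : AntighostAlgebra V) = x := DFunLike.congr_fun hF x
  have := (F x).2
  rw [hx] at this
  exact this

theorem linearMap_ext {M : Type*} [AddCommGroup M] [Module ℝ M] {f g : AntighostAlgebra V →ₗ[ℝ] M}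
    (h : ∀ l, f (monomial l) = g (monomial l)) : f = g :=
  LinearMap.ext_on_range span_monomial h

theorem induction_monomial {p : AntighostAlgebra V → Prop} (hz : p 0)
    (hadd : ∀ x y, p x → p y → p (x + y)) (hsmul : ∀ (t : ℝ) x, p x → p (t • x))
    (hm : ∀ l, p (monomial l)) (x : AntighostAlgebra V) : p x := by
  have hx : x ∈ Submodule.span ℝ (Set.range (monomial (V := V))) := by
    rw [span_monomial]; trivial
  induction hx using Submodule.span_induction with
  | mem x h => obtain ⟨l, rfl⟩ := h; exact hm l
  | zero => exact hz
  | add x y _ _ hx hy => exact hadd x y hx hy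
  | smul t x _ h => exact hsmul t x h

/-- The antighost number of a word. -/
def wordDegree {A : Type*} (l : List (ℕ × A)) : ℕ := (l.map fun p => p.1 + 1).sum

@[simp] theorem wordDegree_nil {A : Type*} : wordDegree ([] : List (ℕ × A)) = 0 := rfl

@[simp] theorem wordDegree_cons {A : Type*} (p : ℕ × A) (l : List (ℕ × A)) :
    wordDegree (p :: l) = p.1 + 1 + wordDegree l := by
  simp [wordDegree]

theorem monomial_mem_degree (l : List (ℕ × Module.Dual ℝ V)) :
    monomial l ∈ degree (wordDegree l) (V := V) :=
  Submodule.subset_span ⟨l, rfl, rfl⟩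

theorem one_mem_degree : (1 : AntighostAlgebra V) ∈ degree 0 (V := V) :=
  monomial_mem_degree []

theorem c_mem_degree (r : ℕ) (ξ : Module.Dual ℝ V) : c r ξ ∈ degree (r + 1) (V := V) := by
  simpa using monomial_mem_degree [(r, ξ)]

/-- Linear conditions on elements of antighost number `k` need only be checked on words. -/
theorem degree_le {k : ℕ} {p : Submodule ℝ (AntighostAlgebra V)}
    (h : ∀ l : List (ℕ × Module.Dual ℝ V), wordDegree l = k → monomial l ∈ p) :
    degree k ≤ p := by
  refine Submodule.span_le.2 ?_
  rintro _ ⟨l, hl, rfl⟩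
  exact h l hl

theorem mul_mem_degree {j k : ℕ} {x y : AntighostAlgebra V} (hx : x ∈ degree j (V := V))
    (hy : y ∈ degree k (V := V)) : x * y ∈ degree (j + k) (V := V) := by
  have : degree j * degree k ≤ degree (j + k) (V := V) := by
    unfold degree
    rw [Submodule.span_mul_span]
    refine Submodule.span_le.2 ?_
    rintro _ ⟨_, ⟨l, hl, rfl⟩, _, ⟨l', hl', rfl⟩, rfl⟩
    exact Submodule.subset_span ⟨l ++ l', by simp [hl, hl'], (monomial_append l l').symm⟩
  exact this (Submodule.mul_mem_mul hx hy)

theorem mem_degree_of_eq {j k : ℕ} {x : AntighostAlgebra V} (hx : x ∈ degree j (V := V))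
    (h : j = k) : x ∈ degree k (V := V) := h ▸ hx

/-- The algebra map `x ↦ ∑ x_k T^k`, where `x_k` is the part of `x` of antighost number `k`. -/
noncomputable def gradeHom : AntighostAlgebra V →ₐ[ℝ] Polynomial (AntighostAlgebra V) :=
  lift (Finsupp.lsum ℝ fun r =>
      (Polynomial.monomial (r + 1)).restrictScalars ℝ ∘ₗ ι ∘ₗ Finsupp.lsingle r) (by
    intro r s ξ η
    have h := c_mul_c r s ξ η
    unfold c at h
    simp only [Finsupp.lsum_single, LinearMap.comp_apply, Finsupp.lsingle_apply,
      LinearMap.coe_restrictScalars, Polynomial.monomial_mul_monomial, Polynomial.smul_monomial]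
    rw [h, add_comm (r + 1)])

theorem gradeHom_monomial (l : List (ℕ × Module.Dual ℝ V)) :
    gradeHom (monomial l) = Polynomial.monomial (wordDegree l) (monomial l) := by
  induction l with
  | nil => simp
  | cons p l ih =>
    have : gradeHom (c p.1 p.2) = Polynomial.monomial (p.1 + 1) (c p.1 p.2) := by
      simp [gradeHom, c]
    rw [monomial_cons, map_mul, ih, this, Polynomial.monomial_mul_monomial, wordDegree_cons]

/-- The projection onto antighost number `k`. -/
noncomputable def proj (k : ℕ) : AntighostAlgebra V →ₗ[ℝ] AntighostAlgebra V :=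
  (Polynomial.lcoeff (AntighostAlgebra V) k).restrictScalars ℝ ∘ₗ gradeHom.toLinearMap

theorem proj_monomial (k : ℕ) (l : List (ℕ × Module.Dual ℝ V)) :
    proj k (monomial l) = if wordDegree l = k then monomial l else 0 := by
  simp [proj, gradeHom_monomial, Polynomial.coeff_monomial]

theorem proj_of_mem {j : ℕ} (k : ℕ) {x : AntighostAlgebra V} (hx : x ∈ degree j (V := V)) :
    proj k x = if j = k then x else 0 := by
  have : degree j ≤ LinearMap.ker (proj k (V := V) - if j = k then LinearMap.id else 0) := by
    refine degree_le fun l hl => ?_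
    rw [LinearMap.mem_ker, LinearMap.sub_apply, proj_monomial, hl]
    split_ifs <;> simp
  have h := this hx
  rw [LinearMap.mem_ker, LinearMap.sub_apply, sub_eq_zero] at h
  rw [h]
  split_ifs <;> rfl

theorem proj_mem_degree (k : ℕ) (x : AntighostAlgebra V) : proj k x ∈ degree k (V := V) := by
  refine induction_monomial (p := fun x => proj k x ∈ degree k (V := V)) ?_ ?_ ?_ ?_ x
  · rw [map_zero]; exact zero_mem _
  · intro x y hx hy
    rw [map_add]
    exact add_mem hx hy
  · intro t x hx
    rw [map_smul]
    exact Submodule.smul_mem _ t hx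
  · intro l
    rw [proj_monomial]
    split_ifs with h
    · exact h ▸ monomial_mem_degree l
    · exact zero_mem _

/-- The augmentation, which kills all antighosts. -/
noncomputable def augmentation : AntighostAlgebra V →ₐ[ℝ] ℝ :=
  lift 0 (by simp)

theorem augmentation_monomial (l : List (ℕ × Module.Dual ℝ V)) :
    augmentation (monomial l) = if l = [] then 1 else 0 := by
  cases l with
  | nil => simp
  | cons p l => simp [augmentation, c]

instance : Nontrivial (AntighostAlgebra V) :=
  (augmentation (V := V)).toRingHom.domain_nontrivial

theorem mem_degree_zero {x : AntighostAlgebra V} (hx : x ∈ degree 0 (V := V)) :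
    x = algebraMap ℝ _ (augmentation x) := by
  have : degree 0 ≤ LinearMap.ker ((LinearMap.id : AntighostAlgebra V →ₗ[ℝ] _) -
      Algebra.linearMap ℝ _ ∘ₗ (augmentation (V := V)).toLinearMap) := by
    refine degree_le fun l hl => ?_
    cases l with
    | nil => simp
    | cons p l => simp at hl
  have h := this hx
  rw [LinearMap.mem_ker, LinearMap.sub_apply, sub_eq_zero] at h
  exact h

theorem algebraMap_mem_degree (t : ℝ) :
    algebraMap ℝ (AntighostAlgebra V) t ∈ degree 0 (V := V) := by
  rw [Algebra.algebraMap_eq_smul_one]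
  exact Submodule.smul_mem _ _ one_mem_degree

theorem c_mul_monomial (r : ℕ) (ξ : Module.Dual ℝ V) (l : List (ℕ × Module.Dual ℝ V)) :
    c r ξ * monomial l = (-1 : ℝ) ^ ((r + 1) * wordDegree l) • (monomial l * c r ξ) := by
  induction l with
  | nil => simp
  | cons p l ih =>
    rw [monomial_cons, ← mul_assoc, c_mul_c, smul_mul_assoc, mul_assoc, ih, mul_smul_comm,
      smul_smul, mul_assoc, wordDegree_cons]
    congr 1
    ring

theorem monomial_mul_monomial (l l' : List (ℕ × Module.Dual ℝ V)) :
    monomial l * monomial l' =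
      (-1 : ℝ) ^ (wordDegree l * wordDegree l') • (monomial l' * monomial l) := by
  induction l with
  | nil => simp
  | cons p l ih =>
    rw [monomial_cons, mul_assoc, ih, mul_smul_comm, ← mul_assoc, c_mul_monomial, smul_mul_assoc,
      smul_smul, mul_assoc, wordDegree_cons]
    congr 1
    ring

/-- Graded commutativity. -/
theorem mul_comm_of_mem_degree {j k : ℕ} {x y : AntighostAlgebra V} (hx : x ∈ degree j (V := V))
    (hy : y ∈ degree k (V := V)) : x * y = (-1 : ℝ) ^ (j * k) • (y * x) := by
  have h1 : ∀ l', wordDegree l' = k → degree j ≤ LinearMap.ker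
      (LinearMap.mulRight ℝ (monomial l' : AntighostAlgebra V) -
        (-1 : ℝ) ^ (j * k) • LinearMap.mulLeft ℝ (monomial l')) := by
    intro l' hl'
    refine degree_le fun l hl => ?_
    rw [LinearMap.mem_ker, LinearMap.sub_apply, sub_eq_zero, LinearMap.smul_apply,
      LinearMap.mulRight_apply, LinearMap.mulLeft_apply, monomial_mul_monomial, hl, hl']
  have h2 : degree k ≤ LinearMap.ker (LinearMap.mulLeft ℝ x -
        (-1 : ℝ) ^ (j * k) • LinearMap.mulRight ℝ x) := by
    refine degree_le fun l' hl' => ?_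
    have := h1 l' hl' hx
    rw [LinearMap.mem_ker, LinearMap.sub_apply, sub_eq_zero] at this ⊢
    exact this
  have := h2 hy
  rw [LinearMap.mem_ker, LinearMap.sub_apply, sub_eq_zero] at this
  exact this

/-! ### Odd derivations -/

theorem parity_monomial (l : List (ℕ × Module.Dual ℝ V)) :
    parity (monomial l) = (-1 : ℝ) ^ wordDegree l • monomial l := by
  induction l with
  | nil => simp
  | cons p l ih =>
    rw [monomial_cons, map_mul, parity_c, ih, smul_mul_assoc, mul_smul_comm, smul_smul,
      wordDegree_cons]
    congr 1
    ring

theorem parity_parity (x : AntighostAlgebra V) : parity (parity x) = x := by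
  have : (parity (V := V)).toLinearMap ∘ₗ parity.toLinearMap = LinearMap.id := by
    refine linearMap_ext fun l => ?_
    simp only [LinearMap.comp_apply, AlgHom.toLinearMap_apply, parity_monomial, map_smul, smul_smul,
      ← mul_pow]
    norm_num
  exact DFunLike.congr_fun this x

theorem c_zero_mul_parity (ξ : Module.Dual ℝ V) (x : AntighostAlgebra V) :
    c 0 ξ * parity x = x * c 0 ξ := by
  have : LinearMap.mulLeft ℝ (c 0 ξ) ∘ₗ (parity (V := V)).toLinearMap =
      LinearMap.mulRight ℝ (c 0 ξ) := by
    refine linearMap_ext fun l => ?_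
    simp only [LinearMap.comp_apply, AlgHom.toLinearMap_apply, parity_monomial,
      LinearMap.mulLeft_apply, LinearMap.mulRight_apply, mul_smul_comm, c_mul_monomial, smul_smul,
      zero_add, one_mul, ← mul_pow]
    norm_num
  exact DFunLike.congr_fun this x

variable (V) in
/-- The space of odd derivations, `D (x y) = D x y + (-1)^{[x]} x D y`. -/
noncomputable def oddDerivations : Submodule ℝ (Module.End ℝ (AntighostAlgebra V)) where
  carrier := {D | ∀ x y, D (x * y) = D x * y + parity x * D y}
  add_mem' := by
    intro D E hD hE x y
    simp only [LinearMap.add_apply, hD x y, hE x y]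
    noncomm_ring
  zero_mem' := by intro x y; simp
  smul_mem' := by
    intro t D hD x y
    simp only [LinearMap.smul_apply, hD x y, smul_add, smul_mul_assoc, mul_smul_comm]

theorem delta_mem_oddDerivations (P : V →ₗ[ℝ] V) (q : V) : delta P q ∈ oddDerivations V :=
  delta_mul P q

theorem apply_one_of_mem_oddDerivations {D : Module.End ℝ (AntighostAlgebra V)}
    (hD : D ∈ oddDerivations V) : D 1 = 0 := by
  have := hD 1 1
  simpa using this

/-- An odd derivation is determined by its values on the antighosts. -/
theorem oddDerivation_ext {D E : Module.End ℝ (AntighostAlgebra V)} (hD : D ∈ oddDerivations V)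
    (hE : E ∈ oddDerivations V) (h : ∀ r ξ, D (c r ξ) = E (c r ξ)) : D = E := by
  refine linearMap_ext fun l => ?_
  induction l with
  | nil =>
    rw [monomial_nil, apply_one_of_mem_oddDerivations hD, apply_one_of_mem_oddDerivations hE]
  | cons p l ih => rw [monomial_cons, hD, hE, h, ih]

theorem parity_apply_of_mem_oddDerivations {D : Module.End ℝ (AntighostAlgebra V)}
    (hD : D ∈ oddDerivations V) (h : ∀ r ξ, parity (D (c r ξ)) = (-1 : ℝ) ^ r • D (c r ξ))
    (x : AntighostAlgebra V) : parity (D x) = - D (parity x) := by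
  have : (parity (V := V)).toLinearMap ∘ₗ D = -(D ∘ₗ parity.toLinearMap) := by
    refine linearMap_ext fun l => ?_
    induction l with
    | nil => simp [apply_one_of_mem_oddDerivations hD]
    | cons p l ih =>
      simp only [LinearMap.comp_apply, AlgHom.toLinearMap_apply, LinearMap.neg_apply] at ih ⊢
      rw [monomial_cons, hD, map_add, map_mul, map_mul, ih, h, map_mul, hD, parity_parity,
        parity_c]
      simp only [map_smul, smul_mul_assoc, map_smul]
      norm_num [pow_succ]
      abel
  exact DFunLike.congr_fun this x

/-- The anticommutator of odd derivations is a derivation. -/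
theorem anticommutator_mul {D E : Module.End ℝ (AntighostAlgebra V)}
    (hD : D ∈ oddDerivations V) (hE : E ∈ oddDerivations V)
    (hD' : ∀ x, parity (D x) = - D (parity x)) (hE' : ∀ x, parity (E x) = - E (parity x))
    (x y : AntighostAlgebra V) :
    D (E (x * y)) + E (D (x * y)) =
      (D (E x) + E (D x)) * y + x * (D (E y) + E (D y)) := by
  rw [hD x y, hE x y, map_add, map_add, hD, hD, hE, hE, hD', hE', parity_parity]
  noncomm_ring

/-! ### The differential and its contracting derivation -/

/-- The projection which enters `δ c^{(r+2)}`: `P` if `r` is even, `R = 1 - P` if `r` is odd. -/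
noncomputable def altProj (P : V →ₗ[ℝ] V) (r : ℕ) : V →ₗ[ℝ] V :=
  if Even r then P else LinearMap.id - P

theorem altProj_zero (P : V →ₗ[ℝ] V) : altProj P 0 = P := by simp [altProj]

theorem altProj_succ (P : V →ₗ[ℝ] V) (r : ℕ) :
    altProj P (r + 1) = LinearMap.id - altProj P r := by
  unfold altProj
  by_cases h : Even r
  · rw [if_pos h, if_neg (by simpa [Nat.even_add_one] using h)]
  · rw [if_neg h, if_pos (by simpa [Nat.even_add_one] using h), sub_sub_cancel]

theorem altProj_comp_self {P : V →ₗ[ℝ] V} (hP : P ∘ₗ P = P) (r : ℕ) :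
    altProj P r ∘ₗ altProj P r = altProj P r := by
  induction r with
  | zero => rw [altProj_zero, hP]
  | succ r ih =>
    rw [altProj_succ, LinearMap.sub_comp, LinearMap.id_comp, LinearMap.comp_sub,
      LinearMap.comp_id, ih, sub_self, sub_zero]

theorem delta_c_succ (P : V →ₗ[ℝ] V) (q : V) (r : ℕ) (ξ : Module.Dual ℝ V) :
    delta P q (c (r + 1) ξ) = c r (ξ ∘ₗ altProj P r) := by
  obtain ⟨l, rfl | rfl⟩ := Nat.even_or_odd' r
  · rw [delta_c_even, altProj, if_pos (by simp)]
  · rw [delta_c_odd, altProj, if_neg (by simp)]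

theorem parity_delta_c (P : V →ₗ[ℝ] V) (q : V) (r : ℕ) (ξ : Module.Dual ℝ V) :
    parity (delta P q (c r ξ)) = (-1 : ℝ) ^ r • delta P q (c r ξ) := by
  cases r with
  | zero => rw [delta_c_zero, AlgHom.commutes, pow_zero, one_smul]
  | succ r => rw [delta_c_succ, parity_c]

theorem parity_delta (P : V →ₗ[ℝ] V) (q : V) (x : AntighostAlgebra V) :
    parity (delta P q x) = - delta P q (parity x) :=
  parity_apply_of_mem_oddDerivations (delta_mem_oddDerivations P q) (parity_delta_c P q) x

/-- `δ ∘ δ = 0`, since `R P = P R = 0`. -/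
theorem delta_delta {P : V →ₗ[ℝ] V} (hP : P ∘ₗ P = P) (q : V) (x : AntighostAlgebra V) :
    delta P q (delta P q x) = 0 := by
  -- the square of an odd derivation is a derivation, so generators suffice
  have hc : ∀ r ξ, delta P q (delta P q (c r ξ)) = 0 := by
    intro r ξ
    rcases r with _ | _ | r
    · rw [delta_c_zero, delta_algebraMap]
    · have : P (q - P q) = 0 := by
        rw [map_sub, sub_eq_zero]
        exact (DFunLike.congr_fun hP q).symm
      rw [delta_c_succ, delta_c_zero, altProj_zero, LinearMap.comp_apply, this, map_zero, map_zero]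
    · rw [delta_c_succ, delta_c_succ, LinearMap.comp_assoc]
      have : altProj P (r + 1) ∘ₗ altProj P r = 0 := by
        rw [altProj_succ, LinearMap.sub_comp, altProj_comp_self hP, LinearMap.id_comp, sub_self]
      rw [this, LinearMap.comp_zero]
      simp [c]
  have : delta P q ∘ₗ delta P q = 0 := by
    refine linearMap_ext fun l => ?_
    induction l with
    | nil =>
      rw [monomial_nil, LinearMap.comp_apply,
        apply_one_of_mem_oddDerivations (delta_mem_oddDerivations P q), map_zero,
        LinearMap.zero_apply]
    | cons p l ih =>
      simp only [LinearMap.comp_apply, LinearMap.zero_apply] at ih ⊢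
      rw [monomial_cons, delta_mul, map_add, delta_mul, delta_mul, ih, hc, parity_delta,
        parity_parity]
      noncomm_ring
  exact DFunLike.congr_fun this x

theorem delta_mem_degree (P : V →ₗ[ℝ] V) (q : V) {k : ℕ} {x : AntighostAlgebra V}
    (hx : x ∈ degree (k + 1) (V := V)) : delta P q x ∈ degree k (V := V) := by
  have key : ∀ l : List (ℕ × Module.Dual ℝ V), ∀ k, wordDegree l = k + 1 →
      delta P q (monomial l) ∈ degree k (V := V) := by
    intro l
    induction l with
    | nil => intro k h; simp at h
    | cons p l ih =>
      intro k h
      obtain ⟨r, ξ⟩ := p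
      rw [wordDegree_cons] at h
      simp only at h
      rw [monomial_cons, delta_mul]
      refine add_mem ?_ ?_
      · have hd : delta P q (c r ξ) ∈ degree r (V := V) := by
          cases r with
          | zero => rw [delta_c_zero]; exact algebraMap_mem_degree _
          | succ r => rw [delta_c_succ]; exact c_mem_degree _ _
        exact mem_degree_of_eq (mul_mem_degree hd (monomial_mem_degree l)) (by omega)
      · rw [parity_c, smul_mul_assoc]
        refine Submodule.smul_mem _ _ ?_
        rcases Nat.eq_zero_or_pos (wordDegree l) with h0 | h0
        · have hl : l = [] := by
            cases l with
            | nil => rfl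
            | cons p l => simp at h0
          rw [hl, monomial_nil,
            apply_one_of_mem_oddDerivations (delta_mem_oddDerivations P q), mul_zero]
          exact zero_mem _
        · obtain ⟨j, hj⟩ := Nat.exists_eq_succ_of_ne_zero h0.ne'
          exact mem_degree_of_eq (mul_mem_degree (c_mem_degree r ξ) (ih j hj)) (by omega)
  have : degree (k + 1) ≤ (degree k).comap (delta P q) := degree_le fun l hl => key l k hl
  exact this hx

/-- The differential vanishes on constant functions. -/
theorem delta_of_mem_degree_zero (P : V →ₗ[ℝ] V) (q : V) {x : AntighostAlgebra V}
    (hx : x ∈ degree 0 (V := V)) : delta P q x = 0 := by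
  rw [mem_degree_zero hx, delta_algebraMap]

/-- Boundaries of antighost number `0` vanish where `R q = 0`. -/
theorem delta_of_mem_degree_one {P : V →ₗ[ℝ] V} {q : V} (hq : q - P q = 0)
    {x : AntighostAlgebra V} (hx : x ∈ degree 1 (V := V)) : delta P q x = 0 := by
  have : degree 1 ≤ LinearMap.ker (delta P q) := by
    refine degree_le fun l hl => ?_
    rcases l with _ | ⟨⟨r, ξ⟩, l⟩
    · simp at hl
    · simp only [wordDegree_cons] at hl
      have hr : r = 0 := by omega
      have hl' : wordDegree l = 0 := by omega
      have hnil : l = [] := by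
        cases l with
        | nil => rfl
        | cons p l => simp at hl'
      subst hr hnil
      rw [LinearMap.mem_ker, monomial_cons, monomial_nil, mul_one, delta_c_zero, hq, map_zero,
        map_zero]
  exact this hx

/-- The values of the odd derivation `contract P` on the generators. -/
noncomputable def contractGen (P : V →ₗ[ℝ] V) : AntighostGen V →ₗ[ℝ] AntighostAlgebra V :=
  Finsupp.lsum ℝ fun r => ι ∘ₗ Finsupp.lsingle (r + 1) ∘ₗ
    Module.Dual.transpose (R := ℝ) (altProj P r)

theorem contractGen_single (P : V →ₗ[ℝ] V) (r : ℕ) (ξ : Module.Dual ℝ V) :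
    contractGen P (Finsupp.single r ξ) = c (r + 1) (ξ ∘ₗ altProj P r) := by
  simp only [contractGen, Finsupp.lsum_single]
  rfl

/-- The algebra map `x ↦ (parity x, h x; 0, x)`. -/
noncomputable def contractMatrix (P : V →ₗ[ℝ] V) :
    AntighostAlgebra V →ₐ[ℝ] Matrix (Fin 2) (Fin 2) (AntighostAlgebra V) :=
  lift
    { toFun := fun e => !![parity (ι e), contractGen P e; 0, ι e]
      map_add' := fun e e' => by ext i j; fin_cases i <;> fin_cases j <;> simp
      map_smul' := fun t e => by ext i j; fin_cases i <;> fin_cases j <;> simp } (by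
    intro r s ξ η
    have h1 : ι (Finsupp.single r ξ) * ι (Finsupp.single s η) = _ := c_mul_c r s ξ η
    have h2 := congrArg parity h1
    simp only [map_mul, map_smul] at h2
    have key : parity (c r ξ) * c (s + 1) (η ∘ₗ altProj P s)
        + c (r + 1) (ξ ∘ₗ altProj P r) * c s η =
        (-1 : ℝ) ^ ((r + 1) * (s + 1)) • (parity (c s η) * c (r + 1) (ξ ∘ₗ altProj P r)
        + c (s + 1) (η ∘ₗ altProj P s) * c r ξ) := by
      have hsq : ∀ a : ℕ, (-1 : ℝ) ^ a * (-1 : ℝ) ^ a = 1 := fun a => by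
        rw [← mul_pow]; norm_num
      rw [parity_c, parity_c, c_mul_c (r + 1) s, smul_mul_assoc, c_mul_c r (s + 1), add_comm]
      simp only [smul_mul_assoc, smul_add, smul_smul]
      congr 2
      · calc _ = (-1 : ℝ) ^ ((r + 1) * (s + 1)) * (-1 : ℝ) ^ (s + 1) := by ring
          _ = _ := rfl
      · calc _ = (-1 : ℝ) ^ ((r + 1) * (s + 1)) * ((-1 : ℝ) ^ (r + 1) * (-1 : ℝ) ^ (r + 1)) := by
              ring
          _ = _ := by rw [hsq, mul_one]
    unfold c at key h2
    ext i j
    fin_cases i <;> fin_cases j <;>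
      simp [Matrix.mul_apply, Fin.sum_univ_two, contractGen_single, c, h2, h1, key])

/-- The odd derivation `h` with `h c^{(r+1)}(ξ) = c^{(r+2)}(ξ ∘ P)` for even `r` and
`h c^{(r+1)}(ξ) = c^{(r+2)}(ξ ∘ R)` for odd `r`.  It inverts `δ` on all antighosts except on the
`R`-components of `c^{(1)}`. -/
noncomputable def contract (P : V →ₗ[ℝ] V) : Module.End ℝ (AntighostAlgebra V) :=
  Matrix.entryLinearMap ℝ (AntighostAlgebra V) (0 : Fin 2) (1 : Fin 2) ∘ₗ
    (contractMatrix P).toLinearMap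

theorem contract_c (P : V →ₗ[ℝ] V) (r : ℕ) (ξ : Module.Dual ℝ V) :
    contract P (c r ξ) = c (r + 1) (ξ ∘ₗ altProj P r) := by
  simp [contract, contractMatrix, c, contractGen_single]

theorem contract_mem_oddDerivations (P : V →ₗ[ℝ] V) : contract P ∈ oddDerivations V := by
  have hc : ∀ r ξ, contractMatrix P (c r ξ) 0 0 = parity (c r ξ) ∧
      contractMatrix P (c r ξ) 1 0 = 0 ∧ contractMatrix P (c r ξ) 1 1 = c r ξ := by
    intro r ξ
    simp [contractMatrix, c]
  have h : ∀ x, contractMatrix P x 0 0 = parity x ∧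
      contractMatrix P x 1 0 = 0 ∧ contractMatrix P x 1 1 = x := by
    refine induction_monomial (by simp) ?_ ?_ ?_
    · rintro x y ⟨h1, h2, h3⟩ ⟨h1', h2', h3'⟩
      simp [h1, h2, h3, h1', h2', h3']
    · rintro t x ⟨h1, h2, h3⟩
      simp [h1, h2, h3]
    · intro l
      induction l with
      | nil => simp
      | cons p l ih =>
        obtain ⟨h1, h2, h3⟩ := ih
        obtain ⟨h1', h2', h3'⟩ := hc p.1 p.2
        rw [monomial_cons, map_mul]
        simp [Matrix.mul_apply, Fin.sum_univ_two, h1, h2, h3, h1', h2', h3']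
  intro x y
  simp only [contract, LinearMap.comp_apply, AlgHom.toLinearMap_apply, map_mul,
    Matrix.entryLinearMap_apply, Matrix.mul_apply, Fin.sum_univ_two]
  rw [(h x).1, (h y).2.2, add_comm]

theorem contract_mul (P : V →ₗ[ℝ] V) (x y : AntighostAlgebra V) :
    contract P (x * y) = contract P x * y + parity x * contract P y :=
  contract_mem_oddDerivations P x y

theorem parity_contract (P : V →ₗ[ℝ] V) (x : AntighostAlgebra V) :
    parity (contract P x) = - contract P (parity x) :=
  parity_apply_of_mem_oddDerivations (contract_mem_oddDerivations P)
    (fun r ξ => by rw [contract_c, parity_c, pow_add, pow_add]; norm_num) x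

theorem contract_one (P : V →ₗ[ℝ] V) : contract P 1 = 0 :=
  apply_one_of_mem_oddDerivations (contract_mem_oddDerivations P)

theorem contract_mem_degree (P : V →ₗ[ℝ] V) {k : ℕ} {x : AntighostAlgebra V}
    (hx : x ∈ degree k (V := V)) : contract P x ∈ degree (k + 1) (V := V) := by
  have key : ∀ l : List (ℕ × Module.Dual ℝ V),
      contract P (monomial l) ∈ degree (wordDegree l + 1) (V := V) := by
    intro l
    induction l with
    | nil => rw [monomial_nil, contract_one]; exact zero_mem _
    | cons p l ih =>
      rw [monomial_cons, contract_mul, contract_c, parity_c, smul_mul_assoc, wordDegree_cons]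
      refine add_mem ?_ (Submodule.smul_mem _ _ ?_)
      · exact mem_degree_of_eq (mul_mem_degree (c_mem_degree _ _) (monomial_mem_degree l))
          (by omega)
      · exact mem_degree_of_eq (mul_mem_degree (c_mem_degree _ _) ih) (by omega)
  have : degree k ≤ (degree (k + 1)).comap (contract P) :=
    degree_le fun l hl => hl ▸ key l
  exact this hx

/-- The derivative of `q ↦ δ_q` in the direction `v`: the odd derivation with
`c^{(1)}(ξ) ↦ ξ(R v)` which kills all other antighosts. -/
noncomputable def interior (P : V →ₗ[ℝ] V) (v : V) : Module.End ℝ (AntighostAlgebra V) :=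
  delta P v - delta P 0

theorem interior_mem_oddDerivations (P : V →ₗ[ℝ] V) (v : V) : interior P v ∈ oddDerivations V :=
  sub_mem (delta_mem_oddDerivations P v) (delta_mem_oddDerivations P 0)

theorem interior_c_zero (P : V →ₗ[ℝ] V) (v : V) (ξ : Module.Dual ℝ V) :
    interior P v (c 0 ξ) = algebraMap ℝ _ (ξ (v - P v)) := by
  simp [interior, delta_c_zero]

theorem interior_c_succ (P : V →ₗ[ℝ] V) (v : V) (r : ℕ) (ξ : Module.Dual ℝ V) :
    interior P v (c (r + 1) ξ) = 0 := by
  simp [interior, delta_c_succ]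

theorem delta_add_smul (P : V →ₗ[ℝ] V) (q v : V) (t : ℝ) :
    delta P (q + t • v) = delta P q + t • interior P v := by
  refine oddDerivation_ext (delta_mem_oddDerivations P _) (add_mem (delta_mem_oddDerivations P _)
    (Submodule.smul_mem _ _ (interior_mem_oddDerivations P v))) fun r ξ => ?_
  rw [LinearMap.add_apply, LinearMap.smul_apply]
  cases r with
  | zero =>
    rw [delta_c_zero, delta_c_zero, interior_c_zero]
    simp only [Algebra.algebraMap_eq_smul_one, map_sub, map_add, map_smul, smul_eq_mul]
    module
  | succ r => rw [delta_c_succ, delta_c_succ, interior_c_succ, smul_zero, add_zero]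

/-- `interior P v x` as a bilinear map. -/
noncomputable def interiorMap (P : V →ₗ[ℝ] V) :
    AntighostAlgebra V →ₗ[ℝ] V →ₗ[ℝ] AntighostAlgebra V :=
  LinearMap.mk₂ ℝ (fun x v => interior P v x) (fun x x' v => map_add _ x x')
    (fun t x v => map_smul _ t x)
    (fun x v w => by
      have h := delta_add_smul P v w 1
      rw [one_smul, one_smul] at h
      simp only [interior, h, LinearMap.sub_apply, LinearMap.add_apply]
      abel)
    (fun t x v => by
      have h := delta_add_smul P 0 v t
      rw [zero_add] at h
      simp only [interior, h, LinearMap.sub_apply, LinearMap.add_apply, LinearMap.smul_apply]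
      abel)

theorem interiorMap_apply (P : V →ₗ[ℝ] V) (x : AntighostAlgebra V) (v : V) :
    interiorMap P x v = interior P v x := rfl

/-! ### Rescaling of the antighosts -/

/-- The rescaling `c ↦ t c` of all antighosts. -/
noncomputable def scale (t : ℝ) : AntighostAlgebra V →ₐ[ℝ] AntighostAlgebra V :=
  lift (t • ι) (by
    intro r s ξ η
    have h : ι (Finsupp.single r ξ) * ι (Finsupp.single s η) = _ := c_mul_c r s ξ η
    simp only [LinearMap.smul_apply, smul_mul_assoc, mul_smul_comm, h, smul_smul]
    congr 1
    ring)

theorem scale_c (t : ℝ) (r : ℕ) (ξ : Module.Dual ℝ V) : scale t (c r ξ) = t • c r ξ := by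
  simp [scale, c]

theorem scale_monomial (t : ℝ) (l : List (ℕ × Module.Dual ℝ V)) :
    scale t (monomial l) = t ^ l.length • monomial l := by
  induction l with
  | nil => simp
  | cons p l ih =>
    rw [monomial_cons, map_mul, scale_c, ih, smul_mul_assoc, mul_smul_comm, smul_smul,
      List.length_cons, pow_succ']

theorem scale_zero_of_mem_degree {k : ℕ} {x : AntighostAlgebra V}
    (hx : x ∈ degree (k + 1) (V := V)) : scale 0 x = 0 := by
  have : degree (k + 1) ≤ LinearMap.ker (scale (V := V) 0).toLinearMap := by
    refine degree_le fun l hl => ?_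
    cases l with
    | nil => simp at hl
    | cons p l => rw [LinearMap.mem_ker, AlgHom.toLinearMap_apply, scale_monomial]; simp
  exact this hx

/-- The differential is equivariant under simultaneous rescaling of the antighosts and of the
`R`-component of the base point. -/
theorem scale_delta {P : V →ₗ[ℝ] V} (hP : P ∘ₗ P = P) (q : V) (t : ℝ) (x : AntighostAlgebra V) :
    scale t (delta P (P q + t • (q - P q)) x) = delta P q (scale t x) := by
  have hPP : ∀ v, P (P v) = P v := DFunLike.congr_fun hP
  have hc : ∀ r ξ, scale t (delta P (P q + t • (q - P q)) (c r ξ)) =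
      delta P q (scale t (c r ξ)) := by
    intro r ξ
    rw [scale_c, map_smul]
    cases r with
    | zero =>
      rw [delta_c_zero, delta_c_zero, AlgHom.commutes]
      simp only [Algebra.algebraMap_eq_smul_one, map_add, map_sub, map_smul, hPP, smul_eq_mul]
      module
    | succ r => rw [delta_c_succ, delta_c_succ, scale_c]
  have : (scale t).toLinearMap ∘ₗ delta P (P q + t • (q - P q)) =
      delta P q ∘ₗ (scale t).toLinearMap := by
    refine linearMap_ext fun l => ?_
    induction l with
    | nil =>
      simp [apply_one_of_mem_oddDerivations (delta_mem_oddDerivations P _)]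
    | cons p l ih =>
      simp only [LinearMap.comp_apply, AlgHom.toLinearMap_apply] at ih ⊢
      rw [monomial_cons, delta_mul, map_add, map_mul, map_mul, map_mul, hc, ih, delta_mul, parity_c,
        scale_c, map_smul, map_smul, map_smul, parity_c, scale_c, smul_comm]
  exact DFunLike.congr_fun this x

theorem c_sum_smul {α : Type*} (s : Finset α) (r : ℕ) (g : α → ℝ) (ξ : α → Module.Dual ℝ V) :
    c r (∑ a ∈ s, g a • ξ a) = ∑ a ∈ s, g a • c r (ξ a) := by
  have : ∀ ξ : Module.Dual ℝ V, c r ξ = (ι ∘ₗ Finsupp.lsingle r) ξ := fun _ => rfl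
  simp only [this, map_sum, map_smul]

/-! ### The homotopy formula at a point -/

variable [FiniteDimensional ℝ V]

/-- The contraction `∑ₐ c^{(1)}(eᵃ ∘ R) T(eₐ)` of a linear map `T : V → W`, where `W` is the
antighost algebra; applied to the derivative of a `W`-valued function it gives the Koszul part of
the homotopy. -/
noncomputable def koszul (P : V →ₗ[ℝ] V) :
    (V →ₗ[ℝ] AntighostAlgebra V) →ₗ[ℝ] AntighostAlgebra V :=
  ∑ a, LinearMap.mulLeft ℝ
      (c 0 ((Module.finBasis ℝ V).coord a ∘ₗ (LinearMap.id - P))) ∘ₗ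
    LinearMap.applyₗ (Module.finBasis ℝ V a)

theorem koszul_apply (P : V →ₗ[ℝ] V) (T : V →ₗ[ℝ] AntighostAlgebra V) :
    koszul P T = ∑ a, c 0 ((Module.finBasis ℝ V).coord a ∘ₗ (LinearMap.id - P)) *
      T (Module.finBasis ℝ V a) := by
  simp [koszul]

/-- The value of `koszul` on a tensor `ξ ⊗ x`; in particular `koszul` is independent of the
basis. -/
theorem koszul_smulRight (P : V →ₗ[ℝ] V) (ξ : Module.Dual ℝ V) (x : AntighostAlgebra V) :
    koszul P (ξ.smulRight x) = c 0 (ξ ∘ₗ (LinearMap.id - P)) * x := by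
  have h : ξ ∘ₗ (LinearMap.id - P) = ∑ a, ξ (Module.finBasis ℝ V a) •
      ((Module.finBasis ℝ V).coord a ∘ₗ (LinearMap.id - P)) := by
    ext v
    have := congrArg ξ ((Module.finBasis ℝ V).sum_repr (v - P v))
    simpa [map_sum, mul_comm] using this.symm
  rw [koszul_apply, h, c_sum_smul, Finset.sum_mul]
  simp

theorem koszul_mem_degree (P : V →ₗ[ℝ] V) {k : ℕ} {T : V →ₗ[ℝ] AntighostAlgebra V}
    (hT : ∀ v, T v ∈ degree k (V := V)) : koszul P T ∈ degree (k + 1) (V := V) := by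
  rw [koszul_apply]
  exact sum_mem fun a _ => mem_degree_of_eq (mul_mem_degree (c_mem_degree _ _) (hT _)) (by omega)

/-- The function part of the homotopy formula: the Euler field in the directions of `R`. -/
theorem delta_koszul_add {P : V →ₗ[ℝ] V} (hP : P ∘ₗ P = P) (q : V)
    (T : V →ₗ[ℝ] AntighostAlgebra V) :
    delta P q (koszul P T) + koszul P (delta P q ∘ₗ T) = T (q - P q) := by
  have hPP : ∀ v, P (P v) = P v := DFunLike.congr_fun hP
  rw [koszul_apply, koszul_apply, map_sum, ← Finset.sum_add_distrib]
  conv_rhs => rw [← (Module.finBasis ℝ V).sum_repr (q - P q), map_sum]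
  refine Finset.sum_congr rfl fun a _ => ?_
  rw [delta_mul, delta_c_zero, parity_c, map_smul, LinearMap.comp_apply, LinearMap.comp_apply,
    ← Algebra.smul_def]
  have : (LinearMap.id - P : V →ₗ[ℝ] V) (q - P q) = q - P q := by simp [hPP]
  rw [this]
  simp

/-- The contraction of an odd derivation with odd coefficients is an even derivation. -/
theorem koszul_interiorMap_mul (P : V →ₗ[ℝ] V) (x y : AntighostAlgebra V) :
    koszul P (interiorMap P (x * y)) =
      koszul P (interiorMap P x) * y + x * koszul P (interiorMap P y) := by
  simp only [koszul_apply, Finset.sum_mul, Finset.mul_sum, ← Finset.sum_add_distrib]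
  refine Finset.sum_congr rfl fun a _ => ?_
  have : ∀ x v, interiorMap P x v = interior P v x := fun _ _ => rfl
  rw [this, this, this, interior_mem_oddDerivations P, mul_add, mul_assoc, ← mul_assoc _ (parity x),
    c_zero_mul_parity, mul_assoc x]

/-- The algebraic part of the homotopy formula: the anticommutator of the differential with the
homotopy counts the antighosts of a word. -/
theorem homotopy_monomial {P : V →ₗ[ℝ] V} (hP : P ∘ₗ P = P) (q : V)
    (l : List (ℕ × Module.Dual ℝ V)) :
    delta P q (contract P (monomial l)) + contract P (delta P q (monomial l)) +
      koszul P (interiorMap P (monomial l)) = (l.length : ℝ) • monomial l := by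
  have hc : ∀ r ξ, delta P q (contract P (c r ξ)) + contract P (delta P q (c r ξ)) +
      koszul P (interiorMap P (c r ξ)) = c r ξ := by
    intro r ξ
    have hadd : ∀ r (ξ η : Module.Dual ℝ V), c r ξ + c r η = c r (ξ + η) := fun r ξ η => by
      simp [c]
    rw [contract_c, delta_c_succ, LinearMap.comp_assoc, altProj_comp_self hP]
    cases r with
    | zero =>
      have h0 : interiorMap P (c 0 ξ) = (ξ ∘ₗ (LinearMap.id - P)).smulRight 1 := by
        ext v
        change interior P v (c 0 ξ) = _
        rw [interior_c_zero, Algebra.algebraMap_eq_smul_one]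
        rfl
      have h1 : (LinearMap.id - P) ∘ₗ (LinearMap.id - P) = LinearMap.id - P := by
        have := altProj_comp_self hP 1
        rwa [altProj_succ, altProj_zero] at this
      rw [delta_c_zero, h0, koszul_smulRight, Algebra.algebraMap_eq_smul_one, map_smul,
        contract_one, smul_zero, add_zero, mul_one, altProj_zero, LinearMap.comp_assoc, h1, hadd,
        ← LinearMap.comp_add, add_sub_cancel, LinearMap.comp_id]
    | succ r =>
      have h0 : interiorMap P (c (r + 1) ξ) = 0 := by
        ext v
        exact interior_c_succ P v r ξ
      rw [delta_c_succ, contract_c, LinearMap.comp_assoc, altProj_comp_self hP, h0, map_zero,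
        add_zero, hadd, ← LinearMap.comp_add, altProj_succ, sub_add_cancel, LinearMap.comp_id]
  induction l with
  | nil =>
    have h0 : interiorMap P 1 = 0 := by
      ext v
      exact apply_one_of_mem_oddDerivations (interior_mem_oddDerivations P v)
    simp [h0, contract_one, apply_one_of_mem_oddDerivations (delta_mem_oddDerivations P q)]
  | cons p l ih =>
    rw [monomial_cons, anticommutator_mul (delta_mem_oddDerivations P q)
      (contract_mem_oddDerivations P) (parity_delta P q) (parity_contract P),
      koszul_interiorMap_mul]
    have : ∀ a b x y z w : AntighostAlgebra V,
      a * y + x * b + (z * y + x * w) = (a + z) * y + x * (b + w) := by intros; noncomm_ring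
    rw [this, hc, ih, List.length_cons, Nat.cast_add, Nat.cast_one, add_smul, one_smul,
      mul_smul_comm, add_comm]

end Algebra

end AntighostAlgebra

/-! ### Smooth dependence of integrals on parameters -/

section ParametricIntegral

open Set Filter Topology

variable {E : Type} [NormedAddCommGroup E] [NormedSpace ℝ E] [FiniteDimensional ℝ E]

/-- Differentiation under the integral sign; the derivative is bounded on a compact neighbourhood
of `{x} × [0, 1]`. -/
theorem hasFDerivAt_intervalIntegral_of_contDiffOn {F : Type} [NormedAddCommGroup F]
    [NormedSpace ℝ F] [CompleteSpace F] {U : Set E} (hU : IsOpen U)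
    {f : E × ℝ → F} (hf : ContDiffOn ℝ 1 f (U ×ˢ univ)) {x : E} (hx : x ∈ U) :
    HasFDerivAt (fun x => ∫ t in (0 : ℝ)..1, f (x, t))
      (∫ t in (0 : ℝ)..1, (fderiv ℝ f (x, t)).comp (ContinuousLinearMap.inl ℝ E ℝ)) x := by
  have hU' : IsOpen (U ×ˢ (univ : Set ℝ)) := hU.prod isOpen_univ
  have hdiff : ∀ y ∈ U, ∀ t : ℝ, HasFDerivAt (fun x => f (x, t))
      ((fderiv ℝ f (y, t)).comp (ContinuousLinearMap.inl ℝ E ℝ)) y := by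
    intro y hy t
    have h1 : HasFDerivAt f (fderiv ℝ f (y, t)) (y, t) :=
      ((hf.differentiableOn one_ne_zero).differentiableAt
        (hU'.mem_nhds ⟨hy, mem_univ t⟩)).hasFDerivAt
    exact h1.comp y (hasFDerivAt_prodMk_left y t)
  have hcont : ∀ y ∈ U, Continuous fun t : ℝ => f (y, t) := fun y hy =>
    hf.continuousOn.comp_continuous (by fun_prop) fun t => ⟨hy, mem_univ t⟩
  have hcd : ContinuousOn
      (fun z : E × ℝ => (fderiv ℝ f z).comp (ContinuousLinearMap.inl ℝ E ℝ)) (U ×ˢ univ) :=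
    (hf.continuousOn_fderiv_of_isOpen hU' le_rfl).clm_comp continuousOn_const
  obtain ⟨ε, hε, hball⟩ := Metric.nhds_basis_closedBall.mem_iff.1 (hU.mem_nhds hx)
  have hK : IsCompact (Metric.closedBall x ε ×ˢ Icc (0 : ℝ) 1) :=
    (isCompact_closedBall x ε).prod isCompact_Icc
  obtain ⟨C, hC⟩ := hK.exists_bound_of_continuousOn
    (hcd.mono (prod_mono hball (subset_univ _)))
  refine intervalIntegral.hasFDerivAt_integral_of_dominated_of_fderiv_le
    (F := fun x t => f (x, t))
    (F' := fun x t => (fderiv ℝ f (x, t)).comp (ContinuousLinearMap.inl ℝ E ℝ))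
    (bound := fun _ => C) (Metric.closedBall_mem_nhds x hε) ?_ ?_ ?_ ?_ ?_ ?_
  · filter_upwards [hU.mem_nhds hx] with y hy
    exact (hcont y hy).aestronglyMeasurable
  · exact (hcont x hx).intervalIntegrable _ _
  · exact (hcd.comp_continuous (by fun_prop) fun t => ⟨hx, mem_univ t⟩).aestronglyMeasurable
  · refine Filter.Eventually.of_forall fun t ht y hy => hC (y, t) ⟨hy, ?_⟩
    rw [uIoc_of_le zero_le_one] at ht
    exact ⟨ht.1.le, ht.2⟩
  · exact intervalIntegrable_const
  · exact Filter.Eventually.of_forall fun t _ y hy => hdiff y (hball hy) t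

theorem contDiffOn_nat_intervalIntegral (k : ℕ) {U : Set E} (hU : IsOpen U) :
    ∀ {F : Type} [NormedAddCommGroup F] [NormedSpace ℝ F] [CompleteSpace F] {f : E × ℝ → F},
      ContDiffOn ℝ ∞ f (U ×ˢ univ) →
      ContDiffOn ℝ k (fun x => ∫ t in (0 : ℝ)..1, f (x, t)) U := by
  induction k with
  | zero =>
    intro F _ _ _ f hf
    refine contDiffOn_zero.2 fun x hx => ?_
    exact (hasFDerivAt_intervalIntegral_of_contDiffOn hU (hf.of_le (by simp))
      hx).continuousAt.continuousWithinAt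
  | succ k ih =>
    intro F _ _ _ f hf
    have hd : ∀ x ∈ U, _ := fun x hx =>
      hasFDerivAt_intervalIntegral_of_contDiffOn hU (hf.of_le (by simp)) hx
    rw [Nat.cast_succ, contDiffOn_succ_iff_fderiv_of_isOpen hU]
    refine ⟨fun x hx => (hd x hx).differentiableAt.differentiableWithinAt, by simp, ?_⟩
    have hg : ContDiffOn ℝ ∞
        (fun z : E × ℝ => (fderiv ℝ f z).comp (ContinuousLinearMap.inl ℝ E ℝ)) (U ×ˢ univ) :=
      (hf.fderiv_of_isOpen (hU.prod isOpen_univ) (by simp)).clm_comp contDiffOn_const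
    exact (ih hg).congr fun x hx => (hd x hx).fderiv

theorem contDiffOn_intervalIntegral {F : Type} [NormedAddCommGroup F] [NormedSpace ℝ F]
    [CompleteSpace F] {U : Set E} (hU : IsOpen U) {f : E × ℝ → F}
    (hf : ContDiffOn ℝ ∞ f (U ×ˢ univ)) :
    ContDiffOn ℝ ∞ (fun x => ∫ t in (0 : ℝ)..1, f (x, t)) U :=
  contDiffOn_infty.2 fun k => contDiffOn_nat_intervalIntegral k hU hf

end ParametricIntegral

/-! ### Weak calculus for functions with values in the antighost algebra -/

section WeakCalculus

variable {V W : Type*} [AddCommGroup V] [Module ℝ V] [AddCommGroup W] [Module ℝ W]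

theorem eq_of_forall_dual {x y : W} (h : ∀ φ : Module.Dual ℝ W, φ x = φ y) : x = y := by
  rw [← sub_eq_zero, ← Module.forall_dual_apply_eq_zero_iff ℝ]
  intro φ
  rw [map_sub, h, sub_self]

/-- `T` is the derivative of `S` at `p`, tested on lines by all linear functionals.  No topology on
the antighost algebra is needed, and the derivative is unique because functionals separate
points. -/
def HasWeakDerivAt (S : V → W) (p : V) (T : V →ₗ[ℝ] W) : Prop :=
  ∀ (φ : Module.Dual ℝ W) (v : V), HasDerivAt (fun τ : ℝ => φ (S (p + τ • v))) (φ (T v)) 0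

theorem HasWeakDerivAt.unique {S : V → W} {p : V} {T T' : V →ₗ[ℝ] W} (h : HasWeakDerivAt S p T)
    (h' : HasWeakDerivAt S p T') : T = T' :=
  LinearMap.ext fun v => eq_of_forall_dual fun φ => (h φ v).unique (h' φ v)

/-- `w` is the integral of `f` over `[0, 1]`, tested by all linear functionals. -/
def HasWeakIntegral (f : ℝ → W) (w : W) : Prop :=
  ∀ φ : Module.Dual ℝ W, ∫ t in (0 : ℝ)..1, φ (f t) = φ w

theorem HasWeakIntegral.unique {f : ℝ → W} {w w' : W} (h : HasWeakIntegral f w)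
    (h' : HasWeakIntegral f w') : w = w' :=
  eq_of_forall_dual fun φ => (h φ).symm.trans (h' φ)

variable {E : Type*} [NormedAddCommGroup E] [NormedSpace ℝ E] (e : V →ₗ[ℝ] E)

/-- A finite combination of fixed vectors with differentiable coefficients has a weak
derivative. -/
theorem hasWeakDerivAt_sum {ι : Type*} [Fintype ι] {g : ι → E → ℝ} {x : ι → W} {S : V → W}
    (hS : ∀ p, S p = ∑ k, g k (e p) • x k) {p : V}
    (hg : ∀ k, DifferentiableAt ℝ (g k) (e p)) :
    HasWeakDerivAt S p
      (∑ k, ((fderiv ℝ (g k) (e p)).toLinearMap ∘ₗ e).smulRight (x k)) := by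
  intro φ v
  have hline : HasDerivAt (fun τ : ℝ => e p + τ • e v) (e v) 0 := by
    simpa using ((hasDerivAt_id (0 : ℝ)).smul_const (e v)).const_add (e p)
  have hk : ∀ k, HasDerivAt (fun τ : ℝ => g k (e p + τ • e v) * φ (x k))
      (fderiv ℝ (g k) (e p) (e v) * φ (x k)) 0 := by
    intro k
    have h0 : DifferentiableAt ℝ (g k) (e p + (0 : ℝ) • e v) := by simpa using hg k
    have := (h0.hasFDerivAt.comp_hasDerivAt (0 : ℝ) hline).mul_const (φ (x k))
    simpa using this
  have := HasDerivAt.fun_sum (u := Finset.univ) fun k _ => hk k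
  simpa [hS] using this

end WeakCalculus

namespace AntighostAlgebra

/-! ### The homotopy formula on a fibre -/

section Fibre

variable {V : Type*} [AddCommGroup V] [Module ℝ V]

/-- The differential of a function with values in the antighost algebra has the derivative given
by the product rule, since `δ_q` depends affinely on `q`. -/
theorem hasWeakDerivAt_delta {P : V →ₗ[ℝ] V} {S : V → AntighostAlgebra V} {p : V}
    {T : V →ₗ[ℝ] AntighostAlgebra V} (hT : HasWeakDerivAt S p T) :
    HasWeakDerivAt (fun p => delta P p (S p)) p
      (delta P p ∘ₗ T + interiorMap P (S p)) := by
  intro φ v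
  have h1 := hT (φ ∘ₗ delta P p) v
  have h2 := (hasDerivAt_id (0 : ℝ)).fun_mul (hT (φ ∘ₗ interior P v) v)
  have h3 := h1.fun_add h2
  simp only [delta_add_smul]
  simpa [interiorMap_apply] using h3

/-- The point `P p + t R p`: the contraction of a fibre onto the image of `P`, which is the
identity for `t = 1` and the projection `P` for `t = 0`. -/
def retract (P : V →ₗ[ℝ] V) (t : ℝ) (p : V) : V := P p + t • (p - P p)

variable {E : Type*} [NormedAddCommGroup E] [NormedSpace ℝ E] (e : V →ₗ[ℝ] E)

theorem map_retract (P : V →ₗ[ℝ] V) (t : ℝ) (p : V) :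
    e (retract P t p) = e (P p) + t • e (p - P p) := by
  rw [retract, map_add, map_smul]

/-- The integrand extends continuously to `t = 0` because every word contains an antighost, whose
rescaling cancels the factor `t⁻¹`. -/
theorem hasWeakIntegral_scale {ι : Type*} [Fintype ι] (P : V →ₗ[ℝ] V)
    {g : ι → E → ℝ} (hg : ∀ k, Continuous (g k))
    {l : ι → List (ℕ × Module.Dual ℝ V)} (hl : ∀ k, l k ≠ []) {S : V → AntighostAlgebra V}
    (hS : ∀ p, S p = ∑ k, g k (e p) • monomial (l k)) (p : V) :
    HasWeakIntegral (fun t : ℝ => t⁻¹ • scale t (S (retract P t p)))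
      (∑ k, (∫ t in (0 : ℝ)..1, t ^ ((l k).length - 1) * g k (e (retract P t p))) •
        monomial (l k)) := by
  intro φ
  have hcont : ∀ k, Continuous fun t : ℝ =>
      t ^ ((l k).length - 1) * g k (e (retract P t p)) := by
    intro k
    simp only [map_retract]
    exact (continuous_pow _).mul ((hg k).comp (by fun_prop))
  have h1 : ∫ t in (0 : ℝ)..1, φ (t⁻¹ • scale t (S (retract P t p))) =
      ∫ t in (0 : ℝ)..1, ∑ k, t ^ ((l k).length - 1) * g k (e (retract P t p)) *
        φ (monomial (l k)) := by
    refine intervalIntegral.integral_congr_ae (Filter.Eventually.of_forall fun t ht => ?_)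
    rw [Set.uIoc_of_le zero_le_one] at ht
    have ht0 : t ≠ 0 := ht.1.ne'
    simp only [hS, map_sum, map_smul, scale_monomial, smul_eq_mul, Finset.mul_sum]
    refine Finset.sum_congr rfl fun k _ => ?_
    have hpow : t ^ (l k).length = t * t ^ ((l k).length - 1) := by
      rw [← pow_succ', Nat.sub_add_cancel (List.length_pos_iff.2 (hl k))]
    rw [hpow]
    field_simp
  rw [h1, intervalIntegral.integral_finsetSum fun k _ =>
    ((hcont k).mul_const _).intervalIntegrable _ _]
  simp only [intervalIntegral.integral_mul_const, map_sum, map_smul, smul_eq_mul]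

variable [FiniteDimensional ℝ V]

/-- The homotopy formula at a point, for a function killed by the differential. -/
theorem delta_homotopy {ι : Type*} [Fintype ι] {P : V →ₗ[ℝ] V} (hP : P ∘ₗ P = P)
    {S : V → AntighostAlgebra V} {p : V} {T : V →ₗ[ℝ] AntighostAlgebra V}
    (hT : HasWeakDerivAt S p T) (hδ : ∀ p, delta P p (S p) = 0) {g : ι → ℝ}
    {l : ι → List (ℕ × Module.Dual ℝ V)} (hS : S p = ∑ k, g k • monomial (l k)) :
    delta P p (contract P (S p) + koszul P T) =
      (∑ k, (g k * (l k).length) • monomial (l k)) + T (p - P p) := by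
  -- the derivative of the vanishing function `p ↦ δ_p (S p)`
  have hT0 : delta P p ∘ₗ T + interiorMap P (S p) = 0 := by
    refine (hasWeakDerivAt_delta (P := P) hT).unique fun φ v => ?_
    simp only [hδ, map_zero, LinearMap.zero_apply]
    exact hasDerivAt_const _ _
  have hT1 : koszul P (delta P p ∘ₗ T) + koszul P (interiorMap P (S p)) = 0 := by
    rw [← map_add, hT0, map_zero]
  have hlen : delta P p (contract P (S p)) + contract P (delta P p (S p)) +
      koszul P (interiorMap P (S p)) = ∑ k, (g k * (l k).length) • monomial (l k) := by
    rw [hS]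
    simp only [map_sum, map_smul, ← Finset.sum_add_distrib, ← smul_add, homotopy_monomial hP,
      mul_smul]
  rw [hδ, map_zero, add_zero] at hlen
  rw [map_add, ← hlen, ← delta_koszul_add hP p T]
  have : ∀ a b c d : AntighostAlgebra V, c + d = 0 → a + b = a + d + (b + c) := by
    intro a b c d h
    rw [add_add_add_comm, add_comm d c, h, add_zero]
  exact this _ _ _ _ hT1

/-- The integrated homotopy formula.  The integrand is the image under the differential of the
derivative of `t ↦ scale t (S (retract P t p))`. -/
theorem delta_weakIntegral {ι : Type*} [Fintype ι] {P : V →ₗ[ℝ] V} (hP : P ∘ₗ P = P)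
    {S H : V → AntighostAlgebra V} {T : V → V →ₗ[ℝ] AntighostAlgebra V}
    {g : ι → E → ℝ} (hg : ∀ k, ContDiff ℝ 1 (g k)) {l : ι → List (ℕ × Module.Dual ℝ V)}
    (hS : ∀ p, S p = ∑ k, g k (e p) • monomial (l k)) (hδ : ∀ p, delta P p (S p) = 0)
    (hT : ∀ p, HasWeakDerivAt S p (T p))
    (hH : ∀ p, H p = contract P (S p) + koszul P (T p)) {p : V} {w : AntighostAlgebra V}
    (hw : HasWeakIntegral (fun t : ℝ => t⁻¹ • scale t (H (retract P t p))) w) :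
    delta P p w = S p - scale 0 (S (P p)) := by
  have hPP : ∀ v, P (P v) = P v := DFunLike.congr_fun hP
  refine eq_of_forall_dual fun φ => ?_
  let u : ℝ → ℝ := fun t => φ (scale t (S (retract P t p)))
  have hu : u = fun t => ∑ k, g k (e (P p) + t • e (p - P p)) * t ^ (l k).length *
      φ (monomial (l k)) := by
    funext t
    simp only [u, hS, map_sum, map_smul, scale_monomial, smul_eq_mul, map_retract, mul_assoc]
  have huC : ContDiff ℝ 1 u := by
    rw [hu]
    refine ContDiff.sum fun k _ => ?_
    exact (((hg k).comp (by fun_prop)).mul (contDiff_id.pow _)).mul contDiff_const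
  have hTeq : ∀ p v, T p v = ∑ k, fderiv ℝ (g k) (e p) (e v) • monomial (l k) := by
    intro p v
    rw [(hT p).unique (hasWeakDerivAt_sum e hS fun k =>
      (hg k).differentiable one_ne_zero _)]
    simp
  have hderiv : ∀ t : ℝ, t ≠ 0 →
      deriv u t = φ (delta P p (t⁻¹ • scale t (H (retract P t p)))) := by
    intro t ht
    have hR : retract P t p - P (retract P t p) = t • (p - P p) := by
      simp only [retract, map_add, map_smul, map_sub, hPP]
      module
    have hline : HasDerivAt (fun t : ℝ => e (P p) + t • e (p - P p)) (e (p - P p)) t := by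
      simpa using ((hasDerivAt_id t).smul_const (e (p - P p))).const_add (e (P p))
    have h1 : HasDerivAt u (∑ k, (fderiv ℝ (g k) (e (retract P t p)) (e (p - P p)) *
        t ^ (l k).length + g k (e (retract P t p)) * ((l k).length * t ^ ((l k).length - 1))) *
        φ (monomial (l k))) t := by
      rw [hu]
      simp only [map_retract]
      refine HasDerivAt.fun_sum fun k _ => HasDerivAt.mul_const (HasDerivAt.fun_mul ?_ ?_) _
      · exact ((hg k).differentiable one_ne_zero _).hasFDerivAt.comp_hasDerivAt t hline
      · exact hasDerivAt_pow _ t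
    rw [h1.deriv, map_smul, ← scale_delta hP, hH]
    change _ = φ (t⁻¹ • scale t (delta P (retract P t p) _))
    rw [delta_homotopy hP (hT _) hδ (hS _), hR, hTeq, ← Finset.sum_add_distrib]
    simp only [map_sum, map_smul, map_add, scale_monomial, smul_eq_mul, Finset.mul_sum]
    refine Finset.sum_congr rfl fun k _ => ?_
    -- the power `t ^ (length - 1)` is genuine only for a nonempty word
    rcases Nat.eq_zero_or_pos (l k).length with h0 | h0
    · rw [h0]
      field_simp
      simp only [Nat.cast_zero]
      ring
    · have hpow : t ^ (l k).length = t * t ^ ((l k).length - 1) := by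
        rw [← pow_succ', Nat.sub_add_cancel h0]
      rw [hpow]
      field_simp
      ring
  have h2 := intervalIntegral.integral_deriv_of_contDiffOn_Icc (huC.contDiffOn (s := Set.Icc 0 1))
    zero_le_one
  have h3 : ∫ t in (0 : ℝ)..1, deriv u t =
      ∫ t in (0 : ℝ)..1, (φ ∘ₗ delta P p) (t⁻¹ • scale t (H (retract P t p))) := by
    refine intervalIntegral.integral_congr_ae (Filter.Eventually.of_forall fun t ht => ?_)
    rw [Set.uIoc_of_le zero_le_one] at ht
    exact hderiv t ht.1.ne'
  rw [h3, hw] at h2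
  have hs1 : scale 1 (S p) = S p := by
    rw [hS]
    simp [scale_monomial]
  have e1 : retract P 1 p = p := by simp [retract]
  have e0 : retract P 0 p = P p := by simp [retract]
  change φ (delta P p w) = φ (scale 1 (S (retract P 1 p))) - φ (scale 0 (S (retract P 0 p))) at h2
  rw [h2, e1, e0, hs1, map_sub]

end Fibre

end AntighostAlgebra

section LegendreGeometry

variable {n m : ℕ}
  {X : Type*} [TopologicalSpace X] [ChartedSpace (EuclideanSpace ℝ (Fin n)) X]
  {Y : Type*} [TopologicalSpace Y]
  [ChartedSpace (EuclideanSpace ℝ (Fin n) × EuclideanSpace ℝ (Fin m)) Y]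
  {π : Y → X}

/-! ### Fibre coordinates of the Legendre bundle -/

theorem LegendreFibre.ext {y : Y} {p q : LegendreFibre n m π y}
    (h : ∀ w, p.eval w = q.eval w) : p = q :=
  LinearMap.ext (f := (show SolderingFibre n m π y →ₗ[ℝ] DensityFibre n π y from p))
    (g := (show SolderingFibre n m π y →ₗ[ℝ] DensityFibre n π y from q)) h

theorem SolderingFibre.ext {y : Y} {h h' : SolderingFibre n m π y}
    (H : ∀ v, h.toHom v = h'.toHom v) : h = h' :=
  LinearMap.ext (f := (show BaseTangent (n := n) π y →ₗ[ℝ] Vertical n m π y from h))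
    (g := (show BaseTangent (n := n) π y →ₗ[ℝ] Vertical n m π y from h'))
    fun v => Subtype.ext (H v)

/-- `h ↦ h.toHom` as a linear map. -/
noncomputable def SolderingFibre.toHomLinear (y : Y) : SolderingFibre n m π y →ₗ[ℝ]
    (BaseTangent (n := n) π y →ₗ[ℝ] TotalTangent n m y) where
  toFun := SolderingFibre.toHom
  map_add' _ _ := rfl
  map_smul' _ _ := rfl

@[simp] theorem SolderingFibre.toHom_add {y : Y} (h h' : SolderingFibre n m π y) :
    (h + h').toHom = h.toHom + h'.toHom := rfl

@[simp] theorem SolderingFibre.toHom_smul {y : Y} (t : ℝ) (h : SolderingFibre n m π y) :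
    (t • h).toHom = t • h.toHom := rfl

namespace FibredChart

variable (κ : FibredChart (n := n) (m := m) π) {y : Y} (hy : y ∈ κ.total.source)

@[simp] theorem velocity_add (j j' : BaseTangent (n := n) π y →ₗ[ℝ] TotalTangent n m y)
    (l : Fin n) (i : Fin m) :
    κ.velocity hy (j + j') l i = κ.velocity hy j l i + κ.velocity hy j' l i := by
  simp [velocity]

@[simp] theorem velocity_smul (t : ℝ) (j : BaseTangent (n := n) π y →ₗ[ℝ] TotalTangent n m y)
    (l : Fin n) (i : Fin m) : κ.velocity hy (t • j) l i = t * κ.velocity hy j l i := by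
  simp [velocity]

theorem velocity_translate (j : JetFibre n m π y) (h : SolderingFibre n m π y) (l : Fin n)
    (i : Fin m) :
    κ.velocity hy (j.translate h).1 l i = κ.velocity hy j.1 l i + κ.velocity hy h.toHom l i :=
  κ.velocity_add hy _ _ l i

/-- The coordinate vectors `∂_λ` form a basis. -/
noncomputable def baseBasis : Module.Basis (Fin n) ℝ (BaseTangent (n := n) π y) :=
  (EuclideanSpace.basisFun (Fin n) ℝ).toBasis.map (κ.dBase hy).symm.toLinearEquiv

theorem baseBasis_apply (l : Fin n) : κ.baseBasis hy l = κ.baseFrame hy l := by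
  simp [baseBasis, baseFrame]

/-- The density `ω = dx¹ ∧ ⋯ ∧ dxⁿ`. -/
noncomputable def volumeForm : DensityFibre n π y := (κ.baseBasis hy).det

theorem density_smul_volumeForm (d : DensityFibre n π y) :
    κ.density hy d • κ.volumeForm hy = d := by
  have h := d.eq_smul_basis_det (κ.baseBasis hy)
  have : (fun l => κ.baseFrame hy l) = κ.baseBasis hy := funext fun l =>
    (κ.baseBasis_apply hy l).symm
  rw [density, this, volumeForm, ← h]

theorem density_volumeForm : κ.density hy (κ.volumeForm hy) = 1 := by
  have : (fun l => κ.baseFrame hy l) = κ.baseBasis hy := funext fun l =>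
    (κ.baseBasis_apply hy l).symm
  rw [density, this, volumeForm, Module.Basis.det_self]

theorem velocity_soldFrame (l k : Fin n) (i j : Fin m) :
    κ.velocity hy (κ.soldFrame hy l i).toHom k j = if l = k ∧ i = j then 1 else 0 := by
  have h1 : (κ.soldFrame hy l i).toHom (κ.baseFrame hy k) =
      ((EuclideanSpace.single k (1 : ℝ) : EuclideanSpace ℝ (Fin n)) l) •
        (κ.vertFrame hy i : TotalTangent n m y) := by
    change ((κ.dBase hy ((κ.dBase hy).symm (EuclideanSpace.single k 1)) :
      EuclideanSpace ℝ (Fin n)) l : ℝ) • (κ.vertFrame hy i : TotalTangent n m y) = _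
    rw [ContinuousLinearEquiv.apply_symm_apply]
  rw [velocity, h1, map_smul]
  simp only [vertFrame, ContinuousLinearEquiv.apply_symm_apply]
  by_cases hl : l = k <;> by_cases hi : i = j <;>
    simp [hl, hi, eq_comm]

theorem velocity_injective {h h' : SolderingFibre n m π y}
    (H : ∀ l i, κ.velocity hy h.toHom l i = κ.velocity hy h'.toHom l i) : h = h' := by
  refine SolderingFibre.ext fun v => ?_
  have : h.toHom = h'.toHom := by
    refine (κ.baseBasis hy).ext fun l => ?_
    rw [baseBasis_apply]
    refine (κ.dTotal hy).injective (Prod.ext ?_ ?_)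
    · have hv : ∀ h : SolderingFibre n m π y, ∀ v,
          tangentMapAt (n := n) (m := m) π y (h.toHom v) = 0 := fun h v =>
        ((show BaseTangent (n := n) π y →ₗ[ℝ] Vertical n m π y from h) v).2
      rw [dTotal_fst, dTotal_fst, hv, hv]
    · ext i
      exact H l i
  rw [this]

/-- Evaluation of a momentum on an element of `T*X ⊗ VY` in coordinates. -/
theorem density_eval (q : LegendreFibre n m π y) (h : SolderingFibre n m π y) :
    κ.density hy (q.eval h) = ∑ l, ∑ i, κ.velocity hy h.toHom l i * κ.momentum hy l i q := by
  have hh : h = ∑ l, ∑ i, κ.velocity hy h.toHom l i • κ.soldFrame hy l i := by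
    refine κ.velocity_injective hy fun k j => ?_
    obtain ⟨Λ, hΛ⟩ : ∃ Λ : SolderingFibre n m π y →ₗ[ℝ] ℝ,
        ∀ w, κ.velocity hy w.toHom k j = Λ w :=
      ⟨((EuclideanSpace.proj j : EuclideanSpace ℝ (Fin m) →L[ℝ] ℝ).toLinearMap ∘ₗ
        LinearMap.snd ℝ (EuclideanSpace ℝ (Fin n)) (EuclideanSpace ℝ (Fin m)) ∘ₗ
        (κ.dTotal hy).toLinearEquiv.toLinearMap) ∘ₗ
        LinearMap.applyₗ (κ.baseFrame hy k) ∘ₗ SolderingFibre.toHomLinear y, fun _ => rfl⟩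
    rw [hΛ (∑ l, ∑ i, κ.velocity hy h.toHom l i • κ.soldFrame hy l i)]
    simp only [map_sum, map_smul]
    simp only [← hΛ, velocity_soldFrame]
    simp [ite_and]
  let Q : SolderingFibre n m π y →ₗ[ℝ] DensityFibre n π y := q
  have hQ : ∀ w, q.eval w = Q w := fun _ => rfl
  let D : DensityFibre n π y →ₗ[ℝ] ℝ :=
    { toFun := κ.density hy, map_add' := fun _ _ => rfl, map_smul' := fun _ _ => rfl }
  have hD : ∀ w, κ.density hy w = D w := fun _ => rfl
  conv_lhs => rw [hh]
  rw [hQ, hD]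
  simp only [map_sum, map_smul, smul_eq_mul]
  rfl

/-- The element of the fibre of `Π` with the given momenta. -/
noncomputable def ofMomentum (p : Fin n → Fin m → ℝ) : LegendreFibre n m π y :=
  show SolderingFibre n m π y →ₗ[ℝ] DensityFibre n π y from
    { toFun := fun h => (∑ l, ∑ i, κ.velocity hy h.toHom l i * p l i) • κ.volumeForm hy
      map_add' := fun h h' => by
        simp only [SolderingFibre.toHom_add, velocity_add, add_mul, Finset.sum_add_distrib,
          add_smul]
      map_smul' := fun t h => by
        simp only [SolderingFibre.toHom_smul, velocity_smul, mul_assoc, ← Finset.mul_sum, mul_smul,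
          RingHom.id_apply] }

theorem eval_ofMomentum (p : Fin n → Fin m → ℝ) (h : SolderingFibre n m π y) :
    (κ.ofMomentum hy p).eval h =
      (∑ l, ∑ i, κ.velocity hy h.toHom l i * p l i) • κ.volumeForm hy := rfl

theorem momentum_ofMomentum (p : Fin n → Fin m → ℝ) (l : Fin n) (i : Fin m) :
    κ.momentum hy l i (κ.ofMomentum hy p) = p l i := by
  change (∑ l', ∑ i', κ.velocity hy (κ.soldFrame hy l i).toHom l' i' * p l' i') *
    κ.density hy (κ.volumeForm hy) = _
  simp [density_volumeForm, velocity_soldFrame, ite_and]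

theorem momentum_injective {p q : LegendreFibre n m π y}
    (h : ∀ l i, κ.momentum hy l i p = κ.momentum hy l i q) : p = q := by
  refine LegendreFibre.ext fun w => ?_
  rw [← κ.density_smul_volumeForm hy (p.eval w), ← κ.density_smul_volumeForm hy (q.eval w),
    density_eval, density_eval]
  simp only [h]

/-- The coordinates `p^λ_i` as a linear isomorphism of the fibre of `Π`. -/
noncomputable def momentumEquiv : LegendreFibre n m π y ≃ₗ[ℝ] (Fin n → Fin m → ℝ) where
  toFun q l i := κ.momentum hy l i q
  invFun := κ.ofMomentum hy
  left_inv _ := κ.momentum_injective hy fun l i => κ.momentum_ofMomentum hy _ l i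
  right_inv p := funext fun l => funext fun i => κ.momentum_ofMomentum hy p l i
  map_add' _ _ := by ext; simp
  map_smul' _ _ := by ext; simp

theorem isOpen_coordRange : IsOpen κ.coordRange :=
  κ.total.open_target.prod isOpen_univ

theorem coord_mem (q : LegendreBundle n m π) (hq : q.1 ∈ κ.total.source) :
    κ.coord q hq ∈ κ.coordRange :=
  ⟨κ.total.map_source hq, trivial⟩

end FibredChart

/-! ### The Legendre map of a quadratic Lagrangian -/

theorem sum_sum_swap (F : Fin n → Fin m → Fin n → Fin m → ℝ) :
    ∑ l, ∑ i, ∑ k, ∑ h, F l i k h = ∑ l, ∑ i, ∑ k, ∑ h, F k h l i := by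
  have := Finset.sum_comm (s := Finset.univ) (t := Finset.univ)
    (f := fun (x y : Fin n × Fin m) => F x.1 x.2 y.1 y.2)
  simpa only [Fintype.sum_prod_type] using this

namespace Lagrangian

variable {L : Lagrangian n m π}

theorem IsFibreDerivative.unique {y : Y} {j : JetFibre n m π y} {p p' : LegendreFibre n m π y}
    (h : L.IsFibreDerivative j p) (h' : L.IsFibreDerivative j p') : p = p' :=
  LegendreFibre.ext fun w => AlternatingMap.ext fun v => (h w v).unique (h' w v)

theorem legendre_eq {y : Y} {j : JetFibre n m π y} {p : LegendreFibre n m π y}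
    (h : L.IsFibreDerivative j p) : L.legendre j = p := by
  have hex : ∃ p, L.IsFibreDerivative j p := ⟨p, h⟩
  rw [legendre, dif_pos hex]
  exact hex.choose_spec.unique h

/-- Coordinate expression of the Legendre map and of its linear part. -/
theorem IsQuadratic.exists_coord (hL : L.IsQuadratic) (hJ : ∀ y, Nonempty (JetFibre n m π y))
    (κ : FibredChart (n := n) (m := m) π) :
    ∃ a : EuclideanSpace ℝ (Fin n) × EuclideanSpace ℝ (Fin m) →
        Fin n → Fin m → Fin n → Fin m → ℝ, ContDiffOn ℝ ∞ a κ.total.target ∧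
      ∀ (y : Y) (hy : y ∈ κ.total.source),
        (∀ (j : JetFibre n m π y) (w : SolderingFibre n m π y),
          L.legendre (j.translate w) = L.legendre j + L.linearLegendre y w) ∧
        ∀ (w : SolderingFibre n m π y) (l : Fin n) (i : Fin m),
          κ.momentum hy l i (L.linearLegendre y w) =
            ∑ k, ∑ h, a (κ.total y) l i k h * κ.velocity hy w.toHom k h := by
  obtain ⟨a, b, c, ha, -, -, hsymm, hq⟩ := hL κ
  refine ⟨a, ha, fun y hy => ?_⟩
  set z := κ.total y
  have hder : ∀ j : JetFibre n m π y, L.IsFibreDerivative j (κ.ofMomentum hy fun l i =>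
      (∑ k, ∑ h, a z l i k h * κ.velocity hy j.1 k h) + b z l i) := by
    intro j w v
    rw [κ.eval_ofMomentum hy]
    have hval : (fun t : ℝ => L y (j.translate (t • w)) v) = fun t : ℝ =>
        ((1 / 2) * (∑ l, ∑ i, ∑ k, ∑ h, a z l i k h *
            (κ.velocity hy j.1 l i + t * κ.velocity hy w.toHom l i) *
            (κ.velocity hy j.1 k h + t * κ.velocity hy w.toHom k h)) +
          (∑ l, ∑ i, b z l i * (κ.velocity hy j.1 l i + t * κ.velocity hy w.toHom l i)) + c z) *
          κ.volumeForm hy v := by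
      funext t
      rw [← κ.density_smul_volumeForm hy (L y (j.translate (t • w))), hq y hy]
      simp only [κ.velocity_translate hy, SolderingFibre.toHom_smul, κ.velocity_smul hy]
      rfl
    rw [hval]
    have hv : ∀ l i, HasDerivAt
        (fun t : ℝ => κ.velocity hy j.1 l i + t * κ.velocity hy w.toHom l i)
        (κ.velocity hy w.toHom l i) 0 := fun l i => by
      simpa using ((hasDerivAt_id (0 : ℝ)).mul_const (κ.velocity hy w.toHom l i)).const_add
        (κ.velocity hy j.1 l i)
    have hd := ((((HasDerivAt.fun_sum (u := Finset.univ) fun l _ =>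
      HasDerivAt.fun_sum (u := Finset.univ) fun i _ =>
      HasDerivAt.fun_sum (u := Finset.univ) fun k _ =>
      HasDerivAt.fun_sum (u := Finset.univ) fun h _ =>
        ((hv l i).const_mul (a z l i k h)).fun_mul (hv k h)).const_mul (1 / 2 : ℝ)).fun_add
      (HasDerivAt.fun_sum (u := Finset.univ) fun l _ =>
        HasDerivAt.fun_sum (u := Finset.univ) fun i _ =>
        (hv l i).const_mul (b z l i))).add_const (c z)).mul_const (κ.volumeForm hy v)
    refine hd.congr_deriv ?_
    change _ = (∑ l, ∑ i, κ.velocity hy w.toHom l i *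
      ((∑ k, ∑ h, a z l i k h * κ.velocity hy j.1 k h) + b z l i)) * κ.volumeForm hy v
    congr 1
    -- the symmetry of `a` makes the two halves of the derivative of the quadratic part equal
    have hswap : ∑ l, ∑ i, ∑ k, ∑ h, a z l i k h * κ.velocity hy j.1 l i * κ.velocity hy w.toHom k h
        = ∑ l, ∑ i, ∑ k, ∑ h,
          a z l i k h * κ.velocity hy w.toHom l i * κ.velocity hy j.1 k h := by
      rw [sum_sum_swap]
      refine Finset.sum_congr rfl fun l _ => Finset.sum_congr rfl fun i _ =>
        Finset.sum_congr rfl fun k _ => Finset.sum_congr rfl fun h _ => ?_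
      rw [hsymm z k h l i]
      ring
    simp only [zero_mul, add_zero, Finset.sum_add_distrib]
    rw [hswap, ← two_mul, ← mul_assoc]
    norm_num
    rw [← Finset.sum_add_distrib]
    refine Finset.sum_congr rfl fun l _ => ?_
    rw [← Finset.sum_add_distrib]
    refine Finset.sum_congr rfl fun i _ => ?_
    rw [mul_add, Finset.mul_sum, mul_comm (b z l i)]
    congr 1
    refine Finset.sum_congr rfl fun k _ => ?_
    rw [Finset.mul_sum]
    refine Finset.sum_congr rfl fun h _ => ?_
    ring
  have hleg := fun j => legendre_eq (hder j)
  let A : SolderingFibre n m π y →ₗ[ℝ] LegendreFibre n m π y :=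
    { toFun := fun w => κ.ofMomentum hy fun l i =>
        ∑ k, ∑ h, a z l i k h * κ.velocity hy w.toHom k h
      map_add' := fun w w' => by
        refine κ.momentum_injective hy fun l i => ?_
        simp [κ.momentum_ofMomentum hy, mul_add, Finset.sum_add_distrib]
      map_smul' := fun t w => by
        refine κ.momentum_injective hy fun l i => ?_
        simp [κ.momentum_ofMomentum hy, Finset.mul_sum, mul_left_comm] }
  have hA : ∀ (j : JetFibre n m π y) (w : SolderingFibre n m π y),
      L.legendre (j.translate w) = L.legendre j + A w := by
    intro j w
    rw [hleg, hleg]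
    refine κ.momentum_injective hy fun l i => ?_
    simp only [A, LinearMap.coe_mk, AddHom.coe_mk, map_add, κ.momentum_ofMomentum hy,
      κ.velocity_translate hy, mul_add, Finset.sum_add_distrib]
    ring
  have hex : ∃ a : SolderingFibre n m π y →ₗ[ℝ] LegendreFibre n m π y,
    ∀ (j : JetFibre n m π y) (w : SolderingFibre n m π y),
      L.legendre (j.translate w) = L.legendre j + a w := ⟨A, hA⟩
  have hlin : L.linearLegendre y = A := by
    rw [linearLegendre, dif_pos hex]
    obtain ⟨j⟩ := hJ y
    refine LinearMap.ext fun w => ?_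
    exact add_left_cancel ((hex.choose_spec j w).symm.trans (hA j w))
  rw [hlin]
  exact ⟨hA, fun w l i => κ.momentum_ofMomentum hy _ l i⟩

theorem translate_sub {y : Y} (j j' : JetFibre n m π y) :
    ∃ w : SolderingFibre n m π y, j.translate w = j' := by
  refine ⟨(show BaseTangent (n := n) π y →ₗ[ℝ] Vertical n m π y from
    (j'.1 - j.1).codRestrict _ fun v => ?_), Subtype.ext ?_⟩
  · rw [LinearMap.mem_ker, LinearMap.sub_apply, map_sub, j'.2, j.2, sub_self]
  · exact add_sub_cancel j.1 j'.1

/-- The constraint space is the range of the linear part of the Legendre map: `L̂` is affine and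
takes the value `0` in every fibre. -/
theorem constraintSpace_eq_range (hL : L.IsQuadratic) (hπ : IsFibredManifold (n := n) (m := m) π)
    (hzero : ∀ y, (⟨y, 0⟩ : LegendreBundle n m π) ∈ L.constraintSpace) :
    L.constraintSpace = {q | q.2 ∈ LinearMap.range (L.linearLegendre q.1)} := by
  ext ⟨y, q⟩
  obtain ⟨κ, hy⟩ := hπ.exists_chart y
  obtain ⟨a, -, ha⟩ := hL.exists_coord (fun y => ⟨(hzero y).choose⟩) κ
  obtain ⟨hA, -⟩ := ha y hy
  obtain ⟨j₀, hj₀⟩ := hzero y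
  constructor
  · rintro ⟨j, hj⟩
    obtain ⟨w, rfl⟩ := translate_sub j₀ j
    exact ⟨w, by rw [← hj, hA, hj₀, zero_add]⟩
  · rintro ⟨w, hw⟩
    exact ⟨j₀.translate w, by rw [hA, hj₀, zero_add]; exact hw⟩

theorem IsSplitting.projP_comp_self {σ₀ : ∀ y, LegendreFibre n m π y →ₗ[ℝ] SolderingFibre n m π y}
    (hσ : L.IsSplitting σ₀) (y : Y) : L.projP σ₀ y ∘ₗ L.projP σ₀ y = L.projP σ₀ y :=
  LinearMap.ext fun q => hσ.a_σ_a y (σ₀ y q)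

theorem IsSplitting.range_linearLegendre
    {σ₀ : ∀ y, LegendreFibre n m π y →ₗ[ℝ] SolderingFibre n m π y}
    (hσ : L.IsSplitting σ₀) (y : Y) (q : LegendreFibre n m π y) :
    q ∈ LinearMap.range (L.linearLegendre y) ↔ L.projP σ₀ y q = q := by
  constructor
  · rintro ⟨w, rfl⟩
    exact hσ.a_σ_a y w
  · intro h
    exact ⟨σ₀ y q, h⟩

end Lagrangian

/-- A fibrewise linear map of `Π` over `Y` with components smooth in every fibred chart. -/
def IsSmoothEndomorphism (P : ∀ y, LegendreFibre n m π y →ₗ[ℝ] LegendreFibre n m π y) : Prop :=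
  ∀ κ : FibredChart (n := n) (m := m) π,
    ∃ s : EuclideanSpace ℝ (Fin n) × EuclideanSpace ℝ (Fin m) →
        Fin n → Fin m → Fin n → Fin m → ℝ,
      ContDiffOn ℝ ∞ s κ.total.target ∧
      ∀ (y : Y) (hy : y ∈ κ.total.source) (q : LegendreFibre n m π y) (l : Fin n) (i : Fin m),
        κ.momentum hy l i (P y q) = ∑ k, ∑ j, s (κ.total y) l i k j * κ.momentum hy k j q

theorem Lagrangian.isSmoothEndomorphism_projP {L : Lagrangian n m π} (hL : L.IsQuadratic)
    (hJ : ∀ y, Nonempty (JetFibre n m π y))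
    {σ₀ : ∀ y, LegendreFibre n m π y →ₗ[ℝ] SolderingFibre n m π y} (hσ : L.IsSplitting σ₀) :
    IsSmoothEndomorphism (L.projP σ₀) := by
  intro κ
  obtain ⟨a, ha, h⟩ := hL.exists_coord hJ κ
  obtain ⟨s, hs, h'⟩ := hσ.smooth κ
  refine ⟨fun z l i k j => ∑ k', ∑ h', a z l i k' h' * s z k' h' k j, ?_, ?_⟩
  · simp only [contDiffOn_pi] at ha hs ⊢
    exact fun l i k j => ContDiffOn.sum fun k' _ => ContDiffOn.sum fun h' _ =>
      (ha l i k' h').mul (hs k' h' k j)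
  · intro y hy q l i
    change κ.momentum hy l i (L.linearLegendre y (σ₀ y q)) = _
    rw [(h y hy).2]
    simp only [h' y hy, Finset.mul_sum, Finset.sum_mul, mul_assoc]
    exact sum_sum_swap _

end LegendreGeometry

section SmoothSections

variable {n m : ℕ}
  {X : Type*} [TopologicalSpace X] [ChartedSpace (EuclideanSpace ℝ (Fin n)) X]
  {Y : Type*} [TopologicalSpace Y]
  [ChartedSpace (EuclideanSpace ℝ (Fin n) × EuclideanSpace ℝ (Fin m)) Y]
  {π : Y → X}

/-! ### Smooth sections in a fibred chart -/

open AntighostAlgebra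

instance (y : Y) : FiniteDimensional ℝ (LegendreFibre n m π y) := by
  have h1 : FiniteDimensional ℝ (BaseTangent (n := n) π y) :=
    inferInstanceAs (FiniteDimensional ℝ (EuclideanSpace ℝ (Fin n)))
  have h2 : FiniteDimensional ℝ (TotalTangent n m y) :=
    inferInstanceAs (FiniteDimensional ℝ (EuclideanSpace ℝ (Fin n) × EuclideanSpace ℝ (Fin m)))
  have h3 : FiniteDimensional ℝ (SolderingFibre n m π y) :=
    inferInstanceAs (FiniteDimensional ℝ (BaseTangent (n := n) π y →ₗ[ℝ] Vertical n m π y))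
  have h4 : FiniteDimensional ℝ (DensityFibre n π y) :=
    Module.Finite.of_injective
      (AlternatingMap.toMultilinearMapLM (R := ℝ) (S := ℝ) (M := BaseTangent (n := n) π y) (N := ℝ)
        (ι := Fin n)) AlternatingMap.coe_multilinearMap_injective
  exact inferInstanceAs (FiniteDimensional ℝ (SolderingFibre n m π y →ₗ[ℝ] DensityFibre n π y))

/-- The functions on the range of the coordinates `(x^λ, y^i, p^λ_i)`. -/
abbrev CoordFunction (n m : ℕ) : Type :=
  (EuclideanSpace ℝ (Fin n) × EuclideanSpace ℝ (Fin m)) × (Fin n → Fin m → ℝ) → ℝ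

namespace FibredChart

variable (κ : FibredChart (n := n) (m := m) π)

/-- The product `c^{λ₁(r₁)}_{i₁} ⋯ c^{λ_k(r_k)}_{i_k}` of holonomic antighosts. -/
noncomputable def word {y : Y} (hy : y ∈ κ.total.source) (α : List (ℕ × Fin n × Fin m)) :
    AntighostAlgebra (LegendreFibre n m π y) :=
  monomial (α.map fun p => (p.1, κ.momentum hy p.2.1 p.2.2))

/-- Sections over the domain of a chart. -/
abbrev LocalSection : Type _ :=
  ∀ q : LegendreBundle n m π, q.1 ∈ κ.total.source → AntighostAlgebra (LegendreFibre n m π q.1)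

/-- A local section is smooth if it is a finite sum of words in the holonomic antighosts with
smooth coefficients. -/
def IsSmoothOn (s : κ.LocalSection) : Prop :=
  ∃ (N : ℕ) (α : Fin N → List (ℕ × Fin n × Fin m)) (g : Fin N → CoordFunction n m),
    (∀ k, ContDiffOn ℝ ∞ (g k) κ.coordRange) ∧
    ∀ q hq, s q hq = ∑ k, g k (κ.coord q hq) • κ.word hq (α k)

variable {κ}

theorem IsSmoothOn.of_fintype {ι : Type*} [Fintype ι] {s : κ.LocalSection}
    (α : ι → List (ℕ × Fin n × Fin m)) (g : ι → CoordFunction n m)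
    (hg : ∀ k, ContDiffOn ℝ ∞ (g k) κ.coordRange)
    (h : ∀ q hq, s q hq = ∑ k, g k (κ.coord q hq) • κ.word hq (α k)) : κ.IsSmoothOn s := by
  let e := (Fintype.equivFin ι).symm
  refine ⟨Fintype.card ι, α ∘ e, g ∘ e, fun k => hg _, fun q hq => ?_⟩
  rw [h]
  exact (e.sum_comp fun k => g k (κ.coord q hq) • κ.word hq (α k)).symm

theorem isSmoothOn_word (α : List (ℕ × Fin n × Fin m)) :
    κ.IsSmoothOn fun _ hq => κ.word hq α :=
  .of_fintype (ι := Unit) (fun _ => α) (fun _ _ => 1) (fun _ => contDiffOn_const) fun q hq => by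
    simp

theorem isSmoothOn_zero : κ.IsSmoothOn fun _ _ => 0 :=
  .of_fintype (ι := Empty) (fun k => k.elim) (fun k => k.elim) (fun k => k.elim) fun q hq => by
    simp

theorem IsSmoothOn.congr {s t : κ.LocalSection} (hs : κ.IsSmoothOn s)
    (h : ∀ q hq, t q hq = s q hq) : κ.IsSmoothOn t := by
  have : t = s := funext fun q => funext fun hq => h q hq
  rwa [this]

theorem IsSmoothOn.add {s t : κ.LocalSection} (hs : κ.IsSmoothOn s) (ht : κ.IsSmoothOn t) :
    κ.IsSmoothOn fun q hq => s q hq + t q hq := by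
  obtain ⟨N, α, g, hg, h⟩ := hs
  obtain ⟨N', α', g', hg', h'⟩ := ht
  refine .of_fintype (ι := Fin N ⊕ Fin N') (Sum.elim α α') (Sum.elim g g') ?_ fun q hq => ?_
  · rintro (k | k)
    · exact hg k
    · exact hg' k
  · simp [h, h']

theorem IsSmoothOn.smul {s : κ.LocalSection} (hs : κ.IsSmoothOn s) {f : CoordFunction n m}
    (hf : ContDiffOn ℝ ∞ f κ.coordRange) :
    κ.IsSmoothOn fun q hq => f (κ.coord q hq) • s q hq := by
  obtain ⟨N, α, g, hg, h⟩ := hs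
  refine ⟨N, α, fun k z => f z * g k z, fun k => hf.mul (hg k), fun q hq => ?_⟩
  simp only [h, Finset.smul_sum, mul_smul]

theorem IsSmoothOn.const_smul {s : κ.LocalSection} (hs : κ.IsSmoothOn s) (t : ℝ) :
    κ.IsSmoothOn fun q hq => t • s q hq :=
  hs.smul (f := fun _ => t) contDiffOn_const

theorem IsSmoothOn.sum {ι : Type*} (I : Finset ι) {s : ι → κ.LocalSection}
    (hs : ∀ k ∈ I, κ.IsSmoothOn (s k)) : κ.IsSmoothOn fun q hq => ∑ k ∈ I, s k q hq := by
  classical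
  induction I using Finset.induction_on with
  | empty => simpa using isSmoothOn_zero
  | insert a I ha ih =>
    simp only [Finset.sum_insert ha]
    exact (hs a (Finset.mem_insert_self a I)).add
      (ih fun k hk => hs k (Finset.mem_insert_of_mem hk))

theorem word_append {y : Y} (hy : y ∈ κ.total.source) (α β : List (ℕ × Fin n × Fin m)) :
    κ.word hy (α ++ β) = κ.word hy α * κ.word hy β := by
  simp [word, monomial_append]

theorem word_cons {y : Y} (hy : y ∈ κ.total.source) (a : ℕ × Fin n × Fin m)
    (α : List (ℕ × Fin n × Fin m)) :
    κ.word hy (a :: α) = c a.1 (κ.momentum hy a.2.1 a.2.2) * κ.word hy α := by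
  simp [word]

@[simp] theorem word_nil {y : Y} (hy : y ∈ κ.total.source) : κ.word hy [] = 1 := rfl

theorem isSmoothOn_c (r : ℕ) (l : Fin n) (i : Fin m) :
    κ.IsSmoothOn fun _ hq => c r (κ.momentum hq l i) :=
  (isSmoothOn_word [(r, l, i)]).congr fun q hq => by simp [word_cons]

theorem IsSmoothOn.mul {s t : κ.LocalSection} (hs : κ.IsSmoothOn s) (ht : κ.IsSmoothOn t) :
    κ.IsSmoothOn fun q hq => s q hq * t q hq := by
  obtain ⟨N, α, g, hg, h⟩ := hs
  obtain ⟨N', α', g', hg', h'⟩ := ht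
  refine .of_fintype (ι := Fin N × Fin N') (fun k => α k.1 ++ α' k.2)
    (fun k z => g k.1 z * g' k.2 z) (fun k => (hg _).mul (hg' _)) fun q hq => ?_
  rw [h, h', Fintype.sum_mul_sum, Fintype.sum_prod_type]
  simp only [word_append, smul_mul_smul_comm]

/-- A fibrewise linear operator preserves smoothness if it does so on words. -/
theorem IsSmoothOn.map {D : ∀ q : LegendreBundle n m π, q.1 ∈ κ.total.source →
      Module.End ℝ (AntighostAlgebra (LegendreFibre n m π q.1))}
    (hD : ∀ α, κ.IsSmoothOn fun q hq => D q hq (κ.word hq α)) {s : κ.LocalSection}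
    (hs : κ.IsSmoothOn s) : κ.IsSmoothOn fun q hq => D q hq (s q hq) := by
  obtain ⟨N, α, g, hg, h⟩ := hs
  simp only [h, map_sum, map_smul]
  exact IsSmoothOn.sum _ fun k _ => (hD (α k)).smul (hg k)

/-- An odd derivation preserves smoothness if it does so on the holonomic antighosts. -/
theorem IsSmoothOn.map_oddDerivation {D : ∀ q : LegendreBundle n m π, q.1 ∈ κ.total.source →
      Module.End ℝ (AntighostAlgebra (LegendreFibre n m π q.1))}
    (hD : ∀ q hq, D q hq ∈ oddDerivations (LegendreFibre n m π q.1))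
    (hc : ∀ r l i, κ.IsSmoothOn fun q hq => D q hq (c r (κ.momentum hq l i)))
    {s : κ.LocalSection} (hs : κ.IsSmoothOn s) : κ.IsSmoothOn fun q hq => D q hq (s q hq) := by
  refine hs.map fun α => ?_
  induction α with
  | nil =>
    simp only [word_nil]
    exact isSmoothOn_zero.congr fun q hq => apply_one_of_mem_oddDerivations (hD q hq)
  | cons a α ih =>
    refine (((hc a.1 a.2.1 a.2.2).mul (isSmoothOn_word α)).add
      (((isSmoothOn_c a.1 a.2.1 a.2.2).mul ih).const_smul ((-1 : ℝ) ^ (a.1 + 1)))).congr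
      fun q hq => ?_
    rw [word_cons, hD q hq, parity_c, smul_mul_assoc]

end FibredChart

open FibredChart

theorem IsSmoothEndomorphism.id_sub
    {P : ∀ y, LegendreFibre n m π y →ₗ[ℝ] LegendreFibre n m π y} (hP : IsSmoothEndomorphism P) :
    IsSmoothEndomorphism fun y => LinearMap.id - P y := by
  intro κ
  obtain ⟨s, hs, h⟩ := hP κ
  refine ⟨fun z l i k j => (if l = k ∧ i = j then 1 else 0) - s z l i k j, ?_,
    fun y hy q l i => ?_⟩
  · simp only [contDiffOn_pi] at hs ⊢
    exact fun l i k j => contDiffOn_const.sub (hs l i k j)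
  · simp only [LinearMap.sub_apply, LinearMap.id_apply, map_sub, h y hy, sub_mul,
      Finset.sum_sub_distrib]
    simp [ite_and]

theorem IsSmoothEndomorphism.altProj
    {P : ∀ y, LegendreFibre n m π y →ₗ[ℝ] LegendreFibre n m π y} (hP : IsSmoothEndomorphism P)
    (r : ℕ) : IsSmoothEndomorphism fun y => AntighostAlgebra.altProj (P y) r := by
  unfold AntighostAlgebra.altProj
  split_ifs
  · exact hP
  · exact hP.id_sub

namespace FibredChart

variable {κ : FibredChart (n := n) (m := m) π}
  {P : ∀ y, LegendreFibre n m π y →ₗ[ℝ] LegendreFibre n m π y}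

theorem isSmoothOn_c_comp (hP : IsSmoothEndomorphism P) (r : ℕ) (l : Fin n) (i : Fin m) :
    κ.IsSmoothOn fun q hq => c r (κ.momentum hq l i ∘ₗ P q.1) := by
  obtain ⟨s, hs, h⟩ := hP κ
  simp only [contDiffOn_pi] at hs
  have hs' : ∀ k : Fin n × Fin m,
      ContDiffOn ℝ ∞ (fun z : (EuclideanSpace ℝ (Fin n) × EuclideanSpace ℝ (Fin m)) ×
        (Fin n → Fin m → ℝ) => s z.1 l i k.1 k.2) κ.coordRange := fun k =>
    (hs l i k.1 k.2).comp contDiffOn_fst fun z hz => hz.1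
  refine (IsSmoothOn.sum Finset.univ fun (k : Fin n × Fin m) _ =>
    (isSmoothOn_c r k.1 k.2).smul (hs' k)).congr fun q hq => ?_
  rw [← c_sum_smul]
  congr 1
  ext p
  have := h q.1 hq p l i
  simpa [Fintype.sum_prod_type, FibredChart.coord] using this

theorem isSmoothOn_algebraMap {f : CoordFunction n m} (hf : ContDiffOn ℝ ∞ f κ.coordRange) :
    κ.IsSmoothOn fun q hq => algebraMap ℝ _ (f (κ.coord q hq)) :=
  ((isSmoothOn_word []).smul hf).congr fun q hq => by
    rw [word_nil, Algebra.algebraMap_eq_smul_one]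

/-- The coordinates of the image of a point under a smooth endomorphism are smooth. -/
theorem exists_coord_map (hP : IsSmoothEndomorphism P) (κ : FibredChart (n := n) (m := m) π) :
    ∃ F : (EuclideanSpace ℝ (Fin n) × EuclideanSpace ℝ (Fin m)) × (Fin n → Fin m → ℝ) →
        Fin n → Fin m → ℝ, ContDiffOn ℝ ∞ F κ.coordRange ∧
      ∀ q hq l i, κ.momentum hq l i (P q.1 q.2) = F (κ.coord q hq) l i := by
  obtain ⟨s, hs, h⟩ := hP κ
  simp only [contDiffOn_pi] at hs
  refine ⟨fun z l i => ∑ k, ∑ j, s z.1 l i k j * z.2 k j, ?_, fun q hq l i => h q.1 hq q.2 l i⟩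
  simp only [contDiffOn_pi]
  intro l i
  refine ContDiffOn.sum fun k _ => ContDiffOn.sum fun j _ => ContDiffOn.mul ?_ ?_
  · exact (hs l i k j).comp contDiffOn_fst fun z hz => hz.1
  · exact ContDiff.contDiffOn (by fun_prop)

theorem IsSmoothOn.delta (hP : IsSmoothEndomorphism P) {s : κ.LocalSection}
    (hs : κ.IsSmoothOn s) :
    κ.IsSmoothOn fun q hq => AntighostAlgebra.delta (P q.1) q.2 (s q hq) := by
  refine hs.map_oddDerivation (fun q _ => delta_mem_oddDerivations _ _) fun r l i => ?_
  cases r with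
  | zero =>
    obtain ⟨F, hF, h⟩ := exists_coord_map hP.id_sub κ
    simp only [contDiffOn_pi] at hF
    exact (isSmoothOn_algebraMap (hF l i)).congr fun q hq => by
      rw [delta_c_zero, ← h q hq]
      rfl
  | succ r =>
    simp only [delta_c_succ]
    exact isSmoothOn_c_comp (hP.altProj r) r l i

theorem IsSmoothOn.contract (hP : IsSmoothEndomorphism P) {s : κ.LocalSection}
    (hs : κ.IsSmoothOn s) :
    κ.IsSmoothOn fun q hq => AntighostAlgebra.contract (P q.1) (s q hq) := by
  refine hs.map_oddDerivation (fun q _ => contract_mem_oddDerivations _) fun r l i => ?_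
  simp only [contract_c]
  exact isSmoothOn_c_comp (hP.altProj r) (r + 1) l i

/-! ### The homotopy operator on smooth sections -/

theorem contDiff_fibre {g : CoordFunction n m} (hg : ContDiffOn ℝ ∞ g κ.coordRange) {y : Y}
    (hy : y ∈ κ.total.source) : ContDiff ℝ ∞ fun p => g (κ.total y, p) :=
  hg.comp_contDiff (contDiff_const.prodMk contDiff_id) fun _ => ⟨κ.total.map_source hy, trivial⟩

theorem pi_eq_sum (p : Fin n → Fin m → ℝ) :
    p = ∑ l, ∑ i, p l i • (Pi.single l (Pi.single i 1) : Fin n → Fin m → ℝ) := by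
  funext k j
  simp [Finset.sum_apply, Pi.single_apply, ite_apply]

/-- The partial derivatives with respect to the momenta. -/
noncomputable def momentumDeriv (g : CoordFunction n m) (l : Fin n) (i : Fin m) :
    CoordFunction n m :=
  fun z => fderiv ℝ g z (0, Pi.single l (Pi.single i 1))

theorem contDiffOn_momentumDeriv {g : CoordFunction n m} (hg : ContDiffOn ℝ ∞ g κ.coordRange)
    (l : Fin n) (i : Fin m) : ContDiffOn ℝ ∞ (momentumDeriv g l i) κ.coordRange :=
  (hg.fderiv_of_isOpen κ.isOpen_coordRange (by simp)).clm_apply contDiffOn_const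

theorem fderiv_fibre {g : CoordFunction n m} (hg : ContDiffOn ℝ ∞ g κ.coordRange) {y : Y}
    (hy : y ∈ κ.total.source) (p v : Fin n → Fin m → ℝ) :
    fderiv ℝ (fun p => g (κ.total y, p)) p v =
      ∑ l, ∑ i, v l i * momentumDeriv g l i (κ.total y, p) := by
  have h1 : HasFDerivAt g (fderiv ℝ g (κ.total y, p)) (κ.total y, p) :=
    ((hg.differentiableOn (by simp)).differentiableAt
      (κ.isOpen_coordRange.mem_nhds ⟨κ.total.map_source hy, trivial⟩)).hasFDerivAt
  have h2 := h1.comp p (hasFDerivAt_prodMk_right (κ.total y) p)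
  have h3 : fderiv ℝ (fun p => g (κ.total y, p)) p = _ := h2.fderiv
  rw [h3]
  conv_lhs => rw [pi_eq_sum v]
  simp only [map_sum, map_smul, smul_eq_mul]
  rfl

/-- The weak derivative along the fibre of a smooth section, in coordinates. -/
theorem hasWeakDerivAt_of_local {N : Type*} [Fintype N] {s : AntighostSections n m π}
    {α : N → List (ℕ × Fin n × Fin m)} {g : N → CoordFunction n m}
    (hg : ∀ k, ContDiffOn ℝ ∞ (g k) κ.coordRange)
    (h : ∀ q hq, s q = ∑ k, g k (κ.coord q hq) • κ.word hq (α k))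
    (q : LegendreBundle n m π) (hq : q.1 ∈ κ.total.source) :
    HasWeakDerivAt (fun p => s ⟨q.1, p⟩) q.2 (∑ k, ∑ l, ∑ i,
      momentumDeriv (g k) l i (κ.coord q hq) •
        (κ.momentum hq l i).smulRight (κ.word hq (α k))) := by
  have := hasWeakDerivAt_sum (κ.momentumEquiv hq).toLinearMap
    (g := fun k p => g k (κ.total q.1, p)) (x := fun k => κ.word hq (α k))
    (S := fun p => s ⟨q.1, p⟩) (fun p => h ⟨q.1, p⟩ hq) (p := q.2)
    fun k => (contDiff_fibre (hg k) hq).differentiable (by simp) _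
  convert this using 1
  refine Finset.sum_congr rfl fun k _ => LinearMap.ext fun v => ?_
  simp only [LinearMap.sum_apply, LinearMap.smul_apply, LinearMap.smulRight_apply,
    LinearMap.comp_apply]
  rw [ContinuousLinearMap.coe_coe, fderiv_fibre (hg k) hq, Finset.sum_smul]
  refine Finset.sum_congr rfl fun l _ => ?_
  rw [Finset.sum_smul]
  refine Finset.sum_congr rfl fun i _ => ?_
  rw [smul_smul, mul_comm]
  rfl

end FibredChart

theorem FibredChart.wordDegree_map {κ : FibredChart (n := n) (m := m) π} {y : Y}
    (hy : y ∈ κ.total.source) (α : List (ℕ × Fin n × Fin m)) :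
    wordDegree (α.map fun p => (p.1, κ.momentum hy p.2.1 p.2.2)) = wordDegree α := by
  simp [wordDegree, Function.comp_def]

theorem FibredChart.isSmoothOn_of_mem {d : ℕ} {s : AntighostSections n m π}
    (hs : s ∈ GradedFunctions n m π d) (κ : FibredChart (n := n) (m := m) π) :
    κ.IsSmoothOn fun q _ => s q := hs.1 κ

/-- A graded function of antighost number `d` is, in any chart, a combination of words of
antighost number `d`. -/
theorem exists_local_form {d : ℕ} {s : AntighostSections n m π}
    (hs : s ∈ GradedFunctions n m π d) (κ : FibredChart (n := n) (m := m) π) :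
    ∃ (ι : Type) (_ : Fintype ι) (α : ι → List (ℕ × Fin n × Fin m)) (g : ι → CoordFunction n m),
      (∀ k, wordDegree (α k) = d) ∧ (∀ k, ContDiffOn ℝ ∞ (g k) κ.coordRange) ∧
      ∀ (q : LegendreBundle n m π) (hq : q.1 ∈ κ.total.source),
        s q = ∑ k, g k (κ.coord q hq) • κ.word hq (α k) := by
  classical
  obtain ⟨N, α, g, hg, h⟩ := hs.1 κ
  refine ⟨{k : Fin N // wordDegree (α k) = d}, inferInstance, fun k => α k, fun k => g k,
    fun k => k.2, fun k => hg k, fun q hq => ?_⟩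
  have h1 : s q = proj d (s q) := by rw [proj_of_mem d (hs.2 q), if_pos rfl]
  rw [h1, h q hq]
  simp only [map_sum, map_smul, proj_monomial, wordDegree_map, smul_ite, smul_zero]
  rw [← Finset.sum_filter, Finset.sum_subtype (p := fun k => wordDegree (α k) = d)]
  · rfl
  · simp

variable {P : ∀ y, LegendreFibre n m π y →ₗ[ℝ] LegendreFibre n m π y}

/-- The homotopy derivation on graded functions: `contract` on the antighosts and
`f ↦ ∑ (∂f/∂p) c^{(1)} ∘ R` on functions. -/
theorem exists_homotopy_section (hcov : ∀ y, ∃ κ : FibredChart (n := n) (m := m) π,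
    y ∈ κ.total.source) (hP : IsSmoothEndomorphism P) {d : ℕ} {s : AntighostSections n m π}
    (hs : s ∈ GradedFunctions n m π d) :
    ∃ (H : AntighostSections n m π) (T : ∀ q : LegendreBundle n m π,
        LegendreFibre n m π q.1 →ₗ[ℝ] AntighostAlgebra (LegendreFibre n m π q.1)),
      H ∈ GradedFunctions n m π (d + 1) ∧
      ∀ q, HasWeakDerivAt (fun p => s ⟨q.1, p⟩) q.2 (T q) ∧
        H q = contract (P q.1) (s q) + koszul (P q.1) (T q) := by
  have hex : ∀ q : LegendreBundle n m π,
      ∃ T : LegendreFibre n m π q.1 →ₗ[ℝ] AntighostAlgebra (LegendreFibre n m π q.1),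
        HasWeakDerivAt (fun p => s ⟨q.1, p⟩) q.2 T := by
    intro q
    obtain ⟨κ, hq⟩ := hcov q.1
    obtain ⟨N, α, g, hg, h⟩ := hs.1 κ
    exact ⟨_, hasWeakDerivAt_of_local hg h q hq⟩
  choose T hT using hex
  refine ⟨fun q => contract (P q.1) (s q) + koszul (P q.1) (T q), T, ⟨fun κ => ?_, fun q => ?_⟩,
    fun q => ⟨hT q, rfl⟩⟩
  · obtain ⟨N, α, g, hg, h⟩ := hs.1 κ
    have h2 : κ.IsSmoothOn fun q _ => koszul (P q.1) (T q) := by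
      refine (IsSmoothOn.sum Finset.univ fun (k : Fin N) _ =>
        IsSmoothOn.sum Finset.univ fun (l : Fin n) _ =>
        IsSmoothOn.sum Finset.univ fun (i : Fin m) _ =>
        ((isSmoothOn_c_comp hP.id_sub 0 l i).mul (isSmoothOn_word (α k))).smul
          (contDiffOn_momentumDeriv (hg k) l i)).congr fun q hq => ?_
      rw [(hT q).unique (hasWeakDerivAt_of_local hg h q hq)]
      simp only [map_sum, map_smul, koszul_smulRight]
    exact (IsSmoothOn.contract hP (isSmoothOn_of_mem hs κ)).add h2
  · refine add_mem (contract_mem_degree _ (hs.2 q)) (koszul_mem_degree _ fun v => ?_)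
    -- the derivative keeps the antighost number, since it commutes with the projection `proj d`
    have hproj : proj d ∘ₗ T q = T q := by
      refine HasWeakDerivAt.unique (S := fun p => s ⟨q.1, p⟩) (p := q.2) (fun φ v => ?_) (hT q)
      have := hT q (φ ∘ₗ proj d) v
      refine this.congr_of_eventuallyEq (Filter.Eventually.of_forall fun t => ?_)
      have hp := proj_of_mem d (hs.2 ⟨q.1, q.2 + t • v⟩)
      rw [if_pos rfl] at hp
      exact congrArg φ hp.symm
    rw [← hproj]
    exact proj_mem_degree d _

/-- Integration of a graded function along the contraction of `Π` onto the constraint space. -/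
theorem exists_integral_section (hcov : ∀ y, ∃ κ : FibredChart (n := n) (m := m) π,
    y ∈ κ.total.source) (hP : IsSmoothEndomorphism P) {d : ℕ} {H : AntighostSections n m π}
    (hH : H ∈ GradedFunctions n m π (d + 1)) :
    ∃ K ∈ GradedFunctions n m π (d + 1), ∀ q : LegendreBundle n m π,
      HasWeakIntegral (fun t : ℝ => t⁻¹ • scale t (H ⟨q.1, retract (P q.1) t q.2⟩)) (K q) := by
  -- in a chart only the coefficient functions are integrated
  have hloc : ∀ κ : FibredChart (n := n) (m := m) π, ∃ (ι : Type) (_ : Fintype ι)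
      (α : ι → List (ℕ × Fin n × Fin m)) (f : ι → CoordFunction n m),
      (∀ k, wordDegree (α k) = d + 1) ∧ (∀ k, ContDiffOn ℝ ∞ (f k) κ.coordRange) ∧
      ∀ (q : LegendreBundle n m π) (hq : q.1 ∈ κ.total.source),
        HasWeakIntegral (fun t : ℝ => t⁻¹ • scale t (H ⟨q.1, retract (P q.1) t q.2⟩))
          (∑ k, f k (κ.coord q hq) • κ.word hq (α k)) := by
    intro κ
    obtain ⟨ι, _, α, g, hα, hg, h⟩ := exists_local_form hH κ
    obtain ⟨F, hF, hFP⟩ := exists_coord_map hP κ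
    refine ⟨ι, inferInstance, α, fun k z => ∫ t in (0 : ℝ)..1,
      t ^ ((α k).length - 1) * g k (z.1, F z + t • (z.2 - F z)), hα, fun k => ?_,
      fun q hq => ?_⟩
    · refine contDiffOn_intervalIntegral
        (f := fun x => x.2 ^ ((α k).length - 1) *
          g k (x.1.1, F x.1 + x.2 • (x.1.2 - F x.1))) κ.isOpen_coordRange ?_
      have hF' : ContDiffOn ℝ ∞ (fun x : ((EuclideanSpace ℝ (Fin n) × EuclideanSpace ℝ (Fin m)) ×
          (Fin n → Fin m → ℝ)) × ℝ => F x.1) (κ.coordRange ×ˢ Set.univ) :=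
        hF.comp contDiffOn_fst fun x hx => hx.1
      refine ContDiffOn.mul (ContDiff.contDiffOn (by fun_prop)) ?_
      refine (hg k).comp (ContDiffOn.prodMk (ContDiff.contDiffOn (by fun_prop))
        (hF'.add (ContDiffOn.smul contDiffOn_snd
          (ContDiffOn.sub (ContDiff.contDiffOn (by fun_prop)) hF')))) ?_
      exact fun x hx => ⟨hx.1.1, trivial⟩
    · have := hasWeakIntegral_scale (κ.momentumEquiv hq).toLinearMap (P q.1)
        (g := fun k p => g k (κ.total q.1, p))
        (fun k => (contDiff_fibre (hg k) hq).continuous)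
        (l := fun k => (α k).map fun a : ℕ × Fin n × Fin m => (a.1, κ.momentum hq a.2.1 a.2.2))
        (fun k hk => by
          have h0 := hα k
          rw [List.map_eq_nil_iff.1 hk] at h0
          simp at h0)
        (S := fun p => H ⟨q.1, p⟩) (fun p => h ⟨q.1, p⟩ hq) q.2
      convert this using 1
      refine Finset.sum_congr rfl fun k _ => ?_
      have hFq : F (κ.coord q hq) = κ.momentumEquiv hq (P q.1 q.2) :=
        funext fun l => funext fun i => (hFP q hq l i).symm
      have hp : (κ.coord q hq).2 = κ.momentumEquiv hq q.2 := rfl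
      congr 1
      simp only [List.length_map, map_retract, hFq, hp, map_sub]
      rfl
  have hex : ∀ q : LegendreBundle n m π,
      ∃ w : AntighostAlgebra (LegendreFibre n m π q.1),
        HasWeakIntegral (fun t : ℝ => t⁻¹ • scale t (H ⟨q.1, retract (P q.1) t q.2⟩)) w := by
    intro q
    obtain ⟨κ, hq⟩ := hcov q.1
    obtain ⟨ι, _, α, f, -, -, h⟩ := hloc κ
    exact ⟨_, h q hq⟩
  choose K hK using hex
  refine ⟨K, ⟨fun κ => ?_, fun q => ?_⟩, hK⟩
  · obtain ⟨ι, _, α, f, -, hf, h⟩ := hloc κ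
    exact IsSmoothOn.of_fintype (s := fun q _ => K q) α f hf fun q hq => (hK q).unique (h q hq)
  · obtain ⟨κ, hq⟩ := hcov q.1
    obtain ⟨ι, _, α, f, hα, -, h⟩ := hloc κ
    rw [(hK q).unique (h q hq)]
    refine sum_mem fun k _ => Submodule.smul_mem _ _ ?_
    exact mem_degree_of_eq (monomial_mem_degree _) ((wordDegree_map hq (α k)).trans (hα k))

/-- A cycle which vanishes on the constraint space after the antighosts are set to zero is a
boundary. -/
theorem exists_primitive (hcov : ∀ y, ∃ κ : FibredChart (n := n) (m := m) π,
    y ∈ κ.total.source) (hP : IsSmoothEndomorphism P) (hPP : ∀ y, P y ∘ₗ P y = P y)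
    {d : ℕ} {s : AntighostSections n m π} (hs : s ∈ GradedFunctions n m π d)
    (hδ : ∀ q : LegendreBundle n m π, delta (P q.1) q.2 (s q) = 0)
    (h0 : ∀ q : LegendreBundle n m π, scale 0 (s ⟨q.1, P q.1 q.2⟩) = 0) :
    ∃ K ∈ GradedFunctions n m π (d + 1),
      ∀ q : LegendreBundle n m π, delta (P q.1) q.2 (K q) = s q := by
  obtain ⟨H, T, hH, hT⟩ := exists_homotopy_section hcov hP hs
  obtain ⟨K, hK, hint⟩ := exists_integral_section hcov hP hH
  refine ⟨K, hK, fun q => ?_⟩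
  obtain ⟨κ, hq⟩ := hcov q.1
  obtain ⟨N, α, g, hg, h⟩ := hs.1 κ
  have hTw : ∀ p, HasWeakDerivAt (fun p => s ⟨q.1, p⟩) p (T ⟨q.1, p⟩) := fun p =>
    (hT ⟨q.1, p⟩).1
  have hHp : ∀ p, H ⟨q.1, p⟩ = contract (P q.1) (s ⟨q.1, p⟩) + koszul (P q.1) (T ⟨q.1, p⟩) :=
    fun p => (hT ⟨q.1, p⟩).2
  have hδp : ∀ p, delta (P q.1) p (s ⟨q.1, p⟩) = 0 := fun p => hδ ⟨q.1, p⟩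
  have := delta_weakIntegral (κ.momentumEquiv hq).toLinearMap (hPP q.1)
    (S := fun p => s ⟨q.1, p⟩) (H := fun p => H ⟨q.1, p⟩) (T := fun p => T ⟨q.1, p⟩)
    (g := fun k p => g k (κ.total q.1, p))
    (fun k => (contDiff_fibre (hg k) hq).of_le (by simp))
    (l := fun k => (α k).map fun a : ℕ × Fin n × Fin m => (a.1, κ.momentum hq a.2.1 a.2.2))
    (fun p => h ⟨q.1, p⟩ hq) hδp hTw hHp (p := q.2) (w := K q) (hint q)
  rw [this, h0 q, sub_zero]

/-! ### The graded algebra of sections -/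

theorem mul_mem_gradedFunctions {j k : ℕ} {s t : AntighostSections n m π}
    (hs : s ∈ GradedFunctions n m π j) (ht : t ∈ GradedFunctions n m π k) :
    s * t ∈ GradedFunctions n m π (j + k) :=
  ⟨fun κ => (isSmoothOn_of_mem hs κ).mul (isSmoothOn_of_mem ht κ),
    fun q => mul_mem_degree (hs.2 q) (ht.2 q)⟩

theorem smul_section_apply (f : SmoothFunctions n m π) (s : AntighostSections n m π)
    (q : LegendreBundle n m π) : (f • s) q = f.toFun q • s q := rfl

theorem algebraMap_section_apply (f : SmoothFunctions n m π) (q : LegendreBundle n m π) :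
    algebraMap (SmoothFunctions n m π) (AntighostSections n m π) f q =
      algebraMap ℝ _ (f.toFun q) := by
  rw [Algebra.algebraMap_eq_smul_one, smul_section_apply, Algebra.algebraMap_eq_smul_one]
  rfl

theorem algebraMap_mem_gradedFunctions (f : SmoothFunctions n m π) :
    algebraMap (SmoothFunctions n m π) (AntighostSections n m π) f ∈ GradedFunctions n m π 0 := by
  refine ⟨fun κ => ?_, fun q => ?_⟩
  · obtain ⟨g, hg, h⟩ := f.2 κ
    refine (isSmoothOn_algebraMap hg).congr
      (t := fun q _ => algebraMap (SmoothFunctions n m π) (AntighostSections n m π) f q)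
      fun q hq => ?_
    rw [algebraMap_section_apply, ← h q hq]
    rfl
  · rw [algebraMap_section_apply]
    exact algebraMap_mem_degree _

namespace GradedFunctionAlgebra

/-- A homogeneous graded function as an element of the graded algebra. -/
noncomputable def ofGraded {k : ℕ} (s : AntighostSections n m π)
    (hs : s ∈ GradedFunctions n m π k) : GradedFunctionAlgebra n m π :=
  ⟨s, Algebra.subset_adjoin (Set.mem_iUnion.2 ⟨k, hs⟩)⟩

theorem ext {s t : GradedFunctionAlgebra n m π} (h : ∀ q, s.toSection q = t.toSection q) :
    s = t :=
  Subtype.ext (funext h)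

theorem toSection_algebraMap (f : SmoothFunctions n m π) (q : LegendreBundle n m π) :
    (algebraMap (SmoothFunctions n m π) (GradedFunctionAlgebra n m π) f).toSection q =
      algebraMap ℝ _ (f.toFun q) := by
  rw [AlgHom.commutes, algebraMap_section_apply]

theorem algebraMap_mem (f : SmoothFunctions n m π) :
    algebraMap (SmoothFunctions n m π) (GradedFunctionAlgebra n m π) f ∈ gradedPart n m π 0 := by
  change GradedFunctionAlgebra.toSection _ ∈ GradedFunctions n m π 0
  rw [AlgHom.commutes]
  exact algebraMap_mem_gradedFunctions f

theorem toSection_mem_degree {k : ℕ} {s : GradedFunctionAlgebra n m π}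
    (hs : s ∈ gradedPart n m π k) (q : LegendreBundle n m π) :
    s.toSection q ∈ degree k (V := LegendreFibre n m π q.1) := hs.2 q

theorem mul_mem {j k : ℕ} {s t : GradedFunctionAlgebra n m π} (hs : s ∈ gradedPart n m π j)
    (ht : t ∈ gradedPart n m π k) : s * t ∈ gradedPart n m π (j + k) := by
  change toSection (s * t) ∈ GradedFunctions n m π (j + k)
  rw [map_mul]
  exact mul_mem_gradedFunctions hs ht

theorem iSup_gradedPart : ⨆ k, gradedPart n m π k = ⊤ := by
  have hmul : ∀ s ∈ ⨆ k, gradedPart n m π k, ∀ t ∈ ⨆ k, gradedPart n m π k,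
      s * t ∈ ⨆ k, gradedPart n m π k := by
    intro s hs t ht
    refine Submodule.iSup_induction _ (motive := fun s => s * t ∈ ⨆ k, gradedPart n m π k) hs
      (fun j s hs => ?_) ?_ fun s s' h h' => ?_
    · refine Submodule.iSup_induction _ (motive := fun t => s * t ∈ ⨆ k, gradedPart n m π k) ht
        (fun k t ht => ?_) ?_ fun t t' h h' => ?_
      · exact Submodule.mem_iSup_of_mem (j + k) (mul_mem hs ht)
      · rw [mul_zero]; exact zero_mem _
      · rw [mul_add]; exact add_mem h h'
    · rw [zero_mul]; exact zero_mem _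
    · rw [add_mul]; exact add_mem h h'
  rw [eq_top_iff]
  rintro ⟨s, hs⟩ -
  induction hs using Algebra.adjoin_induction with
  | mem s h =>
    obtain ⟨k, hk⟩ := Set.mem_iUnion.1 h
    exact Submodule.mem_iSup_of_mem k hk
  | algebraMap f => exact Submodule.mem_iSup_of_mem 0 (algebraMap_mem f)
  | add s t hs ht hs' ht' => exact add_mem hs' ht'
  | mul s t hs ht hs' ht' => exact hmul _ hs' _ ht'

/-- The elements without component of antighost number `k`. -/
noncomputable def projKer (k : ℕ) :
    Submodule (SmoothFunctions n m π) (GradedFunctionAlgebra n m π) where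
  carrier := {s | ∀ q, proj k (s.toSection q) = 0}
  add_mem' := by
    intro s t hs ht q
    rw [map_add, Pi.add_apply, map_add, hs q, ht q, add_zero]
  zero_mem' := by
    intro q
    rw [map_zero, Pi.zero_apply, map_zero]
  smul_mem' := by
    intro f s hs q
    rw [map_smul, smul_section_apply, map_smul, hs q, smul_zero]

theorem isInternal : DirectSum.IsInternal (gradedPart n m π) := by
  classical
  rw [DirectSum.isInternal_submodule_iff_iSupIndep_and_iSup_eq_top]
  refine ⟨fun k => ?_, iSup_gradedPart⟩
  rw [Submodule.disjoint_def]
  intro s hs hs'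
  have hle : ⨆ j, ⨆ (_ : j ≠ k), gradedPart n m π j ≤ projKer k := by
    refine iSup₂_le fun j hj t ht q => ?_
    rw [proj_of_mem k (toSection_mem_degree ht q), if_neg hj]
  refine ext fun q => ?_
  have h := hle hs' q
  rw [proj_of_mem k (toSection_mem_degree hs q), if_pos rfl] at h
  rw [h, map_zero, Pi.zero_apply]

theorem mul_comm_of_mem {j k : ℕ} {s t : GradedFunctionAlgebra n m π}
    (hs : s ∈ gradedPart n m π j) (ht : t ∈ gradedPart n m π k) :
    s * t = (-1) ^ (j * k) * (t * s) := by
  refine ext fun q => ?_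
  simp only [map_mul, map_pow, map_neg, map_one, Pi.mul_apply, Pi.pow_apply, Pi.neg_apply,
    Pi.one_apply]
  rw [mul_comm_of_mem_degree (toSection_mem_degree hs q) (toSection_mem_degree ht q),
    Algebra.smul_def]
  simp

theorem toFun_injective :
    Function.Injective (SmoothFunctions.toFun (n := n) (m := m) (π := π)) :=
  Subtype.val_injective

theorem algebraMap_injective : Function.Injective
    (algebraMap (SmoothFunctions n m π) (GradedFunctionAlgebra n m π)) := by
  intro f g h
  refine toFun_injective (funext fun q => ?_)
  have h' := congrArg (fun s => GradedFunctionAlgebra.toSection s q) h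
  simp only [toSection_algebraMap] at h'
  exact (algebraMap ℝ (AntighostAlgebra (LegendreFibre n m π q.1))).injective h'

/-- Graded functions of antighost number `0` are smooth functions. -/
theorem exists_of_mem_zero {s : GradedFunctionAlgebra n m π} (hs : s ∈ gradedPart n m π 0) :
    ∃ f : SmoothFunctions n m π, algebraMap _ (GradedFunctionAlgebra n m π) f = s := by
  refine ⟨⟨fun q => augmentation (s.toSection q), fun κ => ?_⟩, ext fun q => ?_⟩
  · obtain ⟨N, α, g, hg, h⟩ := hs.1 κ
    refine ⟨fun z => ∑ k, g k z * if α k = [] then 1 else 0,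
      ContDiffOn.sum fun k _ => (hg k).mul contDiffOn_const, fun q hq => ?_⟩
    have h' := h q hq
    simp only [AlgHom.toLinearMap_apply] at h'
    change augmentation (s.toSection q) = ∑ k, g k (κ.coord q hq) * if α k = [] then 1 else 0
    rw [h']
    simp only [map_sum, map_smul, augmentation_monomial, List.map_eq_nil_iff, smul_eq_mul]
  · exact (toSection_algebraMap _ q).trans (mem_degree_zero (toSection_mem_degree hs q)).symm

theorem mem_zero_iff (s : GradedFunctionAlgebra n m π) : s ∈ gradedPart n m π 0 ↔
    ∃! f : SmoothFunctions n m π, algebraMap _ (GradedFunctionAlgebra n m π) f = s := by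
  constructor
  · intro hs
    obtain ⟨f, hf⟩ := exists_of_mem_zero hs
    exact ⟨f, hf, fun g hg => algebraMap_injective (hg.trans hf.symm)⟩
  · rintro ⟨f, rfl, -⟩
    exact algebraMap_mem f

/-! ### The Koszul–Tate differential on sections -/

theorem delta_mem_gradedFunctions (hP : IsSmoothEndomorphism P) {k : ℕ}
    {s : AntighostSections n m π} (hs : s ∈ GradedFunctions n m π (k + 1)) :
    (fun q : LegendreBundle n m π => delta (P q.1) q.2 (s q)) ∈ GradedFunctions n m π k :=
  ⟨fun κ => IsSmoothOn.delta hP (isSmoothOn_of_mem hs κ), fun q => delta_mem_degree _ _ (hs.2 q)⟩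

theorem delta_mem_gradedSubalgebra (hP : IsSmoothEndomorphism P)
    (s : GradedFunctionAlgebra n m π) :
    (fun q : LegendreBundle n m π => delta (P q.1) q.2 (s.toSection q)) ∈ gradedSubalgebra n m π := by
  have hs : s ∈ ⨆ k, gradedPart n m π k := by rw [iSup_gradedPart]; trivial
  refine Submodule.iSup_induction _ (motive := fun s : GradedFunctionAlgebra n m π =>
    (fun q : LegendreBundle n m π => delta (P q.1) q.2 (s.toSection q)) ∈ gradedSubalgebra n m π) hs
    (fun k s hs => ?_) ?_ fun s t h h' => ?_
  · cases k with
    | zero =>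
      have : (fun q : LegendreBundle n m π => delta (P q.1) q.2 (s.toSection q)) = (0 : AntighostSections n m π) :=
        funext fun q => delta_of_mem_degree_zero _ _ (hs.2 q)
      rw [this]
      exact zero_mem _
    | succ k =>
      exact Algebra.subset_adjoin (Set.mem_iUnion.2 ⟨k, delta_mem_gradedFunctions hP hs⟩)
  · simp only [map_zero, Pi.zero_apply]
    exact zero_mem _
  · simp only [map_add, Pi.add_apply]
    exact add_mem h h'

/-- The Koszul–Tate differential of the graded algebra `𝒜(Π)`. -/
noncomputable def koszulTate (hP : IsSmoothEndomorphism P) :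
    GradedFunctionAlgebra n m π →ₗ[SmoothFunctions n m π] GradedFunctionAlgebra n m π where
  toFun s := ⟨fun q => delta (P q.1) q.2 (s.toSection q), delta_mem_gradedSubalgebra hP s⟩
  map_add' s t := Subtype.ext (funext fun q => by
    change delta (P q.1) q.2 (GradedFunctionAlgebra.toSection (s + t) q) = _
    rw [map_add, Pi.add_apply, map_add]
    rfl)
  map_smul' f s := Subtype.ext (funext fun q => by
    change delta (P q.1) q.2 (GradedFunctionAlgebra.toSection (f • s) q) = _
    rw [map_smul, smul_section_apply, map_smul]
    rfl)

theorem toSection_koszulTate (hP : IsSmoothEndomorphism P) (s : GradedFunctionAlgebra n m π)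
    (q : LegendreBundle n m π) :
    (koszulTate hP s).toSection q = delta (P q.1) q.2 (s.toSection q) := rfl

/-- Every cycle of positive antighost number is a boundary. -/
theorem exists_koszulTate_eq (hcov : ∀ y, ∃ κ : FibredChart (n := n) (m := m) π,
    y ∈ κ.total.source) (hP : IsSmoothEndomorphism P) (hPP : ∀ y, P y ∘ₗ P y = P y) {k : ℕ}
    {s : GradedFunctionAlgebra n m π} (hs : s ∈ gradedPart n m π (k + 1))
    (h : koszulTate hP s = 0) : ∃ t ∈ gradedPart n m π (k + 2), koszulTate hP t = s := by
  have hδ : ∀ q : LegendreBundle n m π, delta (P q.1) q.2 (s.toSection q) = 0 := by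
    intro q
    rw [← toSection_koszulTate hP, h, map_zero, Pi.zero_apply]
  obtain ⟨K, hK, hKs⟩ := exists_primitive hcov hP hPP (s := s.toSection) hs hδ fun q =>
    scale_zero_of_mem_degree (hs.2 ⟨q.1, P q.1 q.2⟩)
  exact ⟨ofGraded K hK, hK, ext hKs⟩

/-- The boundaries of antighost number `0` are the functions which vanish on the image of `P`. -/
theorem algebraMap_mem_map_koszulTate (hcov : ∀ y, ∃ κ : FibredChart (n := n) (m := m) π,
    y ∈ κ.total.source) (hP : IsSmoothEndomorphism P) (hPP : ∀ y, P y ∘ₗ P y = P y)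
    {N : Set (LegendreBundle n m π)} (hN : ∀ q, q ∈ N ↔ P q.1 q.2 = q.2)
    (f : SmoothFunctions n m π) :
    algebraMap _ (GradedFunctionAlgebra n m π) f ∈ (gradedPart n m π 1).map (koszulTate hP) ↔
      f ∈ vanishingIdeal N := by
  constructor
  · rintro ⟨s, hs, hsf⟩ q hq
    have h1 := congrArg (fun t => GradedFunctionAlgebra.toSection t q) hsf
    simp only [toSection_koszulTate, toSection_algebraMap] at h1
    rw [delta_of_mem_degree_one (by rw [(hN q).1 hq, sub_self])
      (toSection_mem_degree hs q)] at h1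
    refine (algebraMap ℝ (AntighostAlgebra (LegendreFibre n m π q.1))).injective ?_
    rw [← h1, map_zero]
  · intro hf
    have hPN : ∀ q : LegendreBundle n m π, (⟨q.1, P q.1 q.2⟩ : LegendreBundle n m π) ∈ N :=
      fun q => (hN _).2 (DFunLike.congr_fun (hPP q.1) q.2)
    obtain ⟨K, hK, hKs⟩ := exists_primitive hcov hP hPP (algebraMap_mem_gradedFunctions f)
      (fun q => by rw [algebraMap_section_apply, delta_algebraMap]) fun q => by
        rw [algebraMap_section_apply, hf _ (hPN q), map_zero, map_zero]
    refine ⟨ofGraded K hK, hK, ext fun q => ?_⟩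
    rw [toSection_algebraMap, ← algebraMap_section_apply, ← hKs q]
    rfl

/-- `C^∞(Π)` is the term `𝒩^0`. -/
noncomputable def zeroEquiv :
    gradedPart n m π 0 ≃ₗ[SmoothFunctions n m π] SmoothFunctions n m π :=
  (LinearEquiv.ofBijective
    ((Algebra.linearMap (SmoothFunctions n m π) (GradedFunctionAlgebra n m π)).codRestrict
      (gradedPart n m π 0) algebraMap_mem)
    ⟨fun _ _ h => algebraMap_injective (congrArg Subtype.val h), fun s => by
      obtain ⟨f, hf⟩ := exists_of_mem_zero s.2
      exact ⟨f, Subtype.ext hf⟩⟩).symm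

theorem zeroEquiv_of_eq {f : SmoothFunctions n m π} {s : gradedPart n m π 0}
    (h : s.1 = algebraMap _ _ f) : zeroEquiv s = f := by
  have : s = zeroEquiv.symm f := Subtype.ext h
  rw [this, LinearEquiv.apply_symm_apply]

/-- The homology in antighost number `0`. -/
theorem exists_homology_zero_equiv (hcov : ∀ y, ∃ κ : FibredChart (n := n) (m := m) π,
    y ∈ κ.total.source) (hP : IsSmoothEndomorphism P) (hPP : ∀ y, P y ∘ₗ P y = P y)
    {N : Set (LegendreBundle n m π)} (hN : ∀ q, q ∈ N ↔ P q.1 q.2 = q.2) :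
    ∃ e : (gradedPart n m π 0 ⧸
          ((gradedPart n m π 1).map (koszulTate hP)).comap (gradedPart n m π 0).subtype)
        ≃ₗ[SmoothFunctions n m π] (SmoothFunctions n m π ⧸ vanishingIdeal N),
      ∀ (f : SmoothFunctions n m π) (s : gradedPart n m π 0), s.1 = algebraMap _ _ f →
        e (Submodule.Quotient.mk s) = Ideal.Quotient.mk _ f := by
  refine ⟨Submodule.Quotient.equiv _ (vanishingIdeal N) zeroEquiv ?_, fun f s h => ?_⟩
  · ext f
    rw [Submodule.mem_map_equiv, Submodule.mem_comap,
      ← algebraMap_mem_map_koszulTate hcov hP hPP hN]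
    rfl
  · rw [← zeroEquiv_of_eq h]
    rfl

end GradedFunctionAlgebra

/-! ### Smooth functions on the constraint space -/

/-- Restriction of smooth functions on `Π`. -/
noncomputable def restrictHom (N : Set (LegendreBundle n m π)) :
    SmoothFunctions n m π →ₐ[ℝ] SmoothFunctionsOn N where
  toFun f := ⟨fun q => f.toFun q.1, fun κ q₀ hq₀ => by
    obtain ⟨g, hg, h⟩ := f.2 κ
    exact ⟨κ.coordRange, g, κ.isOpen_coordRange, κ.coord_mem _ _, hg, fun q hq _ => h q.1 hq⟩⟩
  map_one' := rfl
  map_mul' _ _ := rfl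
  map_zero' := rfl
  map_add' _ _ := rfl
  commutes' _ := rfl

/-- Every smooth function on the image of a smooth projection operator `P` extends to `Π`, by
composition with `P`. -/
theorem restrictHom_surjective (hP : IsSmoothEndomorphism P) (hPP : ∀ y, P y ∘ₗ P y = P y)
    {N : Set (LegendreBundle n m π)} (hN : ∀ q, q ∈ N ↔ P q.1 q.2 = q.2) :
    Function.Surjective (restrictHom N) := by
  intro f
  have hPN : ∀ q : LegendreBundle n m π, (⟨q.1, P q.1 q.2⟩ : LegendreBundle n m π) ∈ N :=
    fun q => (hN _).2 (DFunLike.congr_fun (hPP q.1) q.2)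
  refine ⟨⟨fun q => f.1 ⟨⟨q.1, P q.1 q.2⟩, hPN q⟩, fun κ => ?_⟩, Subtype.ext (funext fun q => ?_)⟩
  · classical
    obtain ⟨F, hF, hFP⟩ := exists_coord_map hP κ
    -- the point of `Π` with given coordinates
    let pt : ∀ z : (EuclideanSpace ℝ (Fin n) × EuclideanSpace ℝ (Fin m)) ×
        (Fin n → Fin m → ℝ), z ∈ κ.coordRange → LegendreBundle n m π := fun z hz =>
      ⟨κ.total.symm z.1, κ.ofMomentum (κ.total.map_target hz.1) z.2⟩
    have hpt : ∀ z hz, ∃ hq : (pt z hz).1 ∈ κ.total.source, κ.coord (pt z hz) hq = z := by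
      intro z hz
      refine ⟨κ.total.map_target hz.1, Prod.ext (κ.total.right_inv hz.1) ?_⟩
      exact funext fun l => funext fun i => κ.momentum_ofMomentum _ _ l i
    have hinj : ∀ (q q' : LegendreBundle n m π) (hq : q.1 ∈ κ.total.source)
        (hq' : q'.1 ∈ κ.total.source), κ.coord q hq = κ.coord q' hq' → q = q' := by
      rintro ⟨y, p⟩ ⟨y', p'⟩ hq hq' h
      have hy : y = y' := κ.total.injOn hq hq' (congrArg Prod.fst h)
      subst hy
      have hp : p = p' := κ.momentum_injective hq fun l i =>
        congrFun (congrFun (congrArg Prod.snd h) l) i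
      rw [hp]
    -- the extension `f ∘ P`
    let val : LegendreBundle n m π → ℝ := fun q => f.1 ⟨⟨q.1, P q.1 q.2⟩, hPN q⟩
    -- the extension as a function of the coordinates, with an arbitrary value off their range
    let G : (EuclideanSpace ℝ (Fin n) × EuclideanSpace ℝ (Fin m)) ×
        (Fin n → Fin m → ℝ) → ℝ := fun z =>
      if hz : z ∈ κ.coordRange then val (pt z hz) else 0
    have hG : ∀ (q : LegendreBundle n m π) (hq : q.1 ∈ κ.total.source),
        val q = G (κ.coord q hq) := by
      intro q hq
      have hz := κ.coord_mem q hq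
      obtain ⟨hq', h⟩ := hpt _ hz
      have hqq : pt _ hz = q := hinj _ _ hq' hq h
      simp only [G, dif_pos hz, hqq]
    refine ⟨G, fun z hz => ?_, hG⟩
    obtain ⟨hq, hz'⟩ := hpt z hz
    obtain ⟨U, g, hU, hmem, hg, hfg⟩ := f.2 κ ⟨⟨(pt z hz).1, P _ (pt z hz).2⟩, hPN _⟩ hq
    have hcoordP : ∀ (q : LegendreBundle n m π) (hq : q.1 ∈ κ.total.source),
        κ.coord ⟨q.1, P q.1 q.2⟩ hq = ((κ.coord q hq).1, F (κ.coord q hq)) := by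
      intro q hq
      exact Prod.ext rfl (funext fun l => funext fun i => hFP q hq l i)
    have hC : ContDiffOn ℝ ∞ (fun z => (z.1, F z)) κ.coordRange := contDiffOn_fst.prodMk hF
    have hzU : (z.1, F z) ∈ U := by
      have := hcoordP (pt z hz) hq
      rw [hz'] at this
      rw [← this]
      exact hmem
    have hmap := (hC.contDiffAt (κ.isOpen_coordRange.mem_nhds hz)).continuousAt
    have hev : ∀ᶠ w in nhds z, w ∈ κ.coordRange ∧ (w.1, F w) ∈ U :=
      (κ.isOpen_coordRange.eventually_mem hz).and (hmap.eventually_mem (hU.mem_nhds hzU))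
    refine ContDiffAt.contDiffWithinAt ?_
    refine ((hg.contDiffAt (hU.mem_nhds hzU)).comp z
      (hC.contDiffAt (κ.isOpen_coordRange.mem_nhds hz))).congr_of_eventuallyEq ?_
    filter_upwards [hev] with w hw
    obtain ⟨hqw, hcw⟩ := hpt w hw.1
    have h1 := hG (pt w hw.1) hqw
    have h2 := hcoordP (pt w hw.1) hqw
    rw [hcw] at h1 h2
    rw [← h1]
    change f.1 ⟨⟨(pt w hw.1).1, P _ (pt w hw.1).2⟩, _⟩ = _
    rw [hfg _ hqw (by rw [h2]; exact hw.2), h2]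
    rfl
  · change f.1 ⟨⟨q.1.1, P q.1.1 q.1.2⟩, _⟩ = f.1 q
    refine congrArg f.1 (Subtype.ext ?_)
    change (⟨q.1.1, P q.1.1 q.1.2⟩ : LegendreBundle n m π) = q.1
    rw [(hN q.1).1 q.2]

theorem exists_quotient_equiv (hP : IsSmoothEndomorphism P) (hPP : ∀ y, P y ∘ₗ P y = P y)
    {N : Set (LegendreBundle n m π)} (hN : ∀ q, q ∈ N ↔ P q.1 q.2 = q.2) :
    ∃ e : (SmoothFunctions n m π ⧸ vanishingIdeal N) ≃ₐ[ℝ] SmoothFunctionsOn N,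
      ∀ (f : SmoothFunctions n m π) (q : N), (e (Ideal.Quotient.mk _ f)).1 q = f.toFun q.1 := by
  have hker : ∀ f, f ∈ vanishingIdeal N ↔ restrictHom N f = 0 := by
    intro f
    rw [Subtype.ext_iff, funext_iff]
    exact ⟨fun h q => h q.1 q.2, fun h q hq => h ⟨q, hq⟩⟩
  refine ⟨AlgEquiv.ofBijective
    (Ideal.Quotient.liftₐ (vanishingIdeal N) (restrictHom N) fun f hf => (hker f).1 hf)
    ⟨?_, ?_⟩, fun f q => rfl⟩
  · rw [injective_iff_map_eq_zero]
    intro f hf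
    obtain ⟨f, rfl⟩ := Ideal.Quotient.mk_surjective f
    exact Ideal.Quotient.eq_zero_iff_mem.2 ((hker f).2 hf)
  · intro f
    obtain ⟨g, rfl⟩ := restrictHom_surjective hP hPP hN f
    exact ⟨Ideal.Quotient.mk _ g, rfl⟩

end SmoothSections

theorem mainTheorem4 {n m : ℕ}
    {X : Type*} [TopologicalSpace X] [T2Space X] [SecondCountableTopology X] [ConnectedSpace X]
    [ChartedSpace (EuclideanSpace ℝ (Fin n)) X]
    [IsManifold 𝓘(ℝ, EuclideanSpace ℝ (Fin n)) ∞ X]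
    {Y : Type*} [TopologicalSpace Y] [T2Space Y] [SecondCountableTopology Y] [ConnectedSpace Y]
    [ChartedSpace (EuclideanSpace ℝ (Fin n) × EuclideanSpace ℝ (Fin m)) Y]
    [IsManifold 𝓘(ℝ, EuclideanSpace ℝ (Fin n) × EuclideanSpace ℝ (Fin m)) ∞ Y]
    (π : Y → X) (_hπ : IsFibredManifold (n := n) (m := m) π)
    (L : Lagrangian n m π) (_hL : L.IsQuadratic)
    -- almost regular: the matrix `a` has constant rank
    (_hrank : ∃ ρ : ℕ, ∀ y, Module.finrank ℝ (LinearMap.range (L.linearLegendre y)) = ρ)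
    -- the zero section of `Π → Y` takes its values in the constraint space
    (_hzero : ∀ y, (⟨y, 0⟩ : LegendreBundle n m π) ∈ L.constraintSpace)
    (σ₀ : ∀ y, LegendreFibre n m π y →ₗ[ℝ] SolderingFibre n m π y) (_hσ : L.IsSplitting σ₀) :
    -- the constraint space is given by the constraints `R = 0`
    L.constraintSpace = {q | L.projR σ₀ q.1 q.2 = 0} ∧
    -- `𝒜(Π)` is the direct sum of the `𝒩^k`, it is graded commutative, and `𝒩^0 = C^∞(Π)`
    DirectSum.IsInternal (gradedPart n m π) ∧
    (∀ k l, ∀ s ∈ gradedPart n m π k, ∀ t ∈ gradedPart n m π l,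
      s * t ∈ gradedPart n m π (k + l) ∧ s * t = (-1) ^ (k * l) * (t * s)) ∧
    (∀ s, s ∈ gradedPart n m π 0 ↔
      ∃! f : SmoothFunctions n m π, algebraMap _ (GradedFunctionAlgebra n m π) f = s) ∧
    -- the Koszul-Tate differential `δ` is a well-defined differential of `𝒜(Π)`
    ∃ δ : GradedFunctionAlgebra n m π →ₗ[SmoothFunctions n m π] GradedFunctionAlgebra n m π,
      (∀ (s : GradedFunctionAlgebra n m π) (q : LegendreBundle n m π),
        (δ s).toSection q = AntighostAlgebra.delta (L.projP σ₀ q.1) q.2 (s.toSection q)) ∧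
      (∀ s, δ (δ s) = 0) ∧
      (∀ s ∈ gradedPart n m π 0, δ s = 0) ∧
      (∀ k, ∀ s ∈ gradedPart n m π (k + 1), δ s ∈ gradedPart n m π k) ∧
      -- `H_k = 0` for `k > 0`
      (∀ k, ∀ s ∈ gradedPart n m π (k + 1), δ s = 0 → ∃ t ∈ gradedPart n m π (k + 2), δ t = s) ∧
      -- `H_0 = C^∞(Π) / I_{N_L}`
      (∃ e : (gradedPart n m π 0 ⧸
            ((gradedPart n m π 1).map δ).comap (gradedPart n m π 0).subtype)
          ≃ₗ[SmoothFunctions n m π] (SmoothFunctions n m π ⧸ vanishingIdeal L.constraintSpace),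
        ∀ (f : SmoothFunctions n m π) (s : gradedPart n m π 0), s.1 = algebraMap _ _ f →
          e (Submodule.Quotient.mk s) = Ideal.Quotient.mk _ f) ∧
      -- `C^∞(Π) / I_{N_L} = C^∞(N_L)`
      (∃ e : (SmoothFunctions n m π ⧸ vanishingIdeal L.constraintSpace)
          ≃ₐ[ℝ] SmoothFunctionsOn L.constraintSpace,
        ∀ (f : SmoothFunctions n m π) (q : L.constraintSpace),
          (e (Ideal.Quotient.mk _ f)).1 q = f.toFun q.1) := by
  have hcov := _hπ.exists_chart
  have hJ : ∀ y, Nonempty (JetFibre n m π y) := fun y => ⟨(_hzero y).choose⟩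
  have hP : IsSmoothEndomorphism (L.projP σ₀) := L.isSmoothEndomorphism_projP _hL hJ _hσ
  have hPP := _hσ.projP_comp_self
  have hN : ∀ q, q ∈ L.constraintSpace ↔ L.projP σ₀ q.1 q.2 = q.2 := fun q => by
    rw [Lagrangian.constraintSpace_eq_range _hL _hπ _hzero]
    exact _hσ.range_linearLegendre q.1 q.2
  refine ⟨?_, GradedFunctionAlgebra.isInternal, fun k l s hs t ht =>
      ⟨GradedFunctionAlgebra.mul_mem hs ht, GradedFunctionAlgebra.mul_comm_of_mem hs ht⟩,
    GradedFunctionAlgebra.mem_zero_iff, GradedFunctionAlgebra.koszulTate hP, fun s q => rfl,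
    fun s => ?_, fun s hs => ?_, fun k s hs => ?_,
    fun k s hs h => GradedFunctionAlgebra.exists_koszulTate_eq hcov hP hPP hs h,
    GradedFunctionAlgebra.exists_homology_zero_equiv hcov hP hPP hN,
    exists_quotient_equiv hP hPP hN⟩
  · ext q
    rw [hN]
    exact eq_comm.trans sub_eq_zero.symm
  · exact GradedFunctionAlgebra.ext fun q => AntighostAlgebra.delta_delta (hPP q.1) q.2 _
  · exact GradedFunctionAlgebra.ext fun q => AntighostAlgebra.delta_of_mem_degree_zero _ _
      (GradedFunctionAlgebra.toSection_mem_degree hs q)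
  · exact GradedFunctionAlgebra.delta_mem_gradedFunctions hP hs
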